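/- Let $d\ge 1$ and $1<s<\infty$. A cube means a cube in $\mathbb{R}^d$ with sides parallel to the axes; $\ell(Q)$ is its side length, $|Q|$ its Lebesgue measure, $aQ$ its concentric dilate, and $\|h\|_{L^s,Q}=\big(\frac1{|Q|}\int_Q|h|^s\big)^{1/s}$. A bounded linear operator $T$ on $L^2(\mathbb{R}^d)$ is an $L^{s}$-Hörmander operator if there is a kernel $K(x,y)$, locally integrable on $\{x\ne y\}$, such that $T\varphi(x)=\int K(x,y)\varphi(y)\,dy$ for every $\varphi\in C_c^\infty(\mathbb{R}^d)$ and almost every $x\notin\operatorname{supp}\varphi$, and such that $$\sup_Q\sup_{x,z\in\frac12Q}\sum_{k=1}^\infty (2^k\ell(Q))^d\,\big\|(K(x,\cdot)-K(z,\cdot))\chi_{2^kQ\setminus2^{k-1}Q}\big\|_{L^s,2^kQ}<\infty,$$ together with the same condition with $K(\cdot,x)-K(\cdot,z)$ in place of $K(x,\cdot)-K(z,\cdot)$. For $\vec f:\mathbb{R}^d\to\mathbb{R}^n$ with $|\vec f|\in L^p_{loc}$, $1\le p<\infty$, and a cube $Q$, put $$\langle\langle\vec f\rangle\rangle_{p,Q}=\Big\{\tfrac1{|Q|}\int_Q\vec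 f\varphi\,dx:\ \|\varphi\|_{L^{p'},Q}\le1\Big\}\subset\mathbb{R}^n$$ (with the essential supremum norm if $p=1$), and for compact, convex, symmetric, non-empty sets $A,B\subset\mathbb{R}^n$ let $AB=\max\{\langle a,b\rangle: a\in A,\ b\in B\}$. A family $\mathcal S$ of cubes is $\eta$-sparse if there are pairwise disjoint measurable sets $E_Q\subset Q$, $Q\in\mathcal S$, with $\eta|Q|\le|E_Q|$. Then there is $\eta\in(0,1)$, depending only on $d$, such that the following holds for every $n$ and every $r\in(1,\infty)$. Let $T$ be an $L^{r'}$-Hörmander operator, $\frac1r+\frac1{r'}=1$. Then $T\vec f$ is well defined, componentwise, for every compactly supported $\vec f:\mathbb{R}^d\to\mathbb{R}^n$ with $|\vec f|\in L^r(\mathbb{R}^d)$: for each component $f_j$ there is a unique (up to null sets) measurable function $Tf_j$ such that $T\varphi_k\to Tf_j$ in measure whenever $\varphi_k\in L^2$ and $\varphi_k\to f_j$ in $L^1$. Moreover there is a constant $c_{T}<\infty$, depending only on $n$, $d$, $r$ and $T$, such that for all such $\vec f$ and all $\vec g:\mathbb{R}^d\to\mathbb{R}^n$ with $|\vec g|\in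 L^1(\mathbb{R}^d)$ there is an $\eta$-sparse family $\mathcal S$ of cubes with $$\int_{\mathbb{R}^d}\big|\langle T\vec f(x),\vec g(x)\rangle\big|\,dx\le c_{T}\sum_{Q\in\mathcal S}\langle\langle\vec f\rangle\rangle_{r,Q}\,\langle\langle\vec g\rangle\rangle_{1,Q}\,|Q|,$$ where both sides may be $+\infty$. -/

import Mathlib

open MeasureTheory Filter Topology
open scoped ENNReal NNReal ContDiff

noncomputable section

namespace ConvexBody

/-- `ℝ^d` with its Euclidean structure and Lebesgue measure. -/
abbrev Space (d : ℕ) : Type := EuclideanSpace ℝ (Fin d)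

/-- A cube in `ℝ^d` with sides parallel to the axes, given by its centre and its side length. -/
@[ext]
structure Cube (d : ℕ) where
  center : Space d
  side : ℝ
  side_pos : 0 < side

namespace Cube

variable {d : ℕ}

/-- The (closed) set of points of the cube. -/
def toSet (Q : Cube d) : Set (Space d) :=
  {x | ∀ i, |x i - Q.center i| ≤ Q.side / 2}

/-- The concentric dilate `a Q` of the cube, `a > 0`. -/
def dilate (Q : Cube d) (a : ℝ) (ha : 0 < a) : Cube d where
  center := Q.center
  side := a * Q.side
  side_pos := mul_pos ha Q.side_pos

/-- `2^k Q`. -/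
def dyadic (Q : Cube d) (k : ℕ) : Cube d := Q.dilate (2 ^ k) (by positivity)

/-- `(1/2) Q`. -/
def half (Q : Cube d) : Cube d := Q.dilate (1 / 2) (by norm_num)

/-- The normalized Lebesgue measure `|Q|⁻¹ dx` on `Q`. -/
def avgMeasure (Q : Cube d) : Measure (Space d) :=
  (volume Q.toSet)⁻¹ • volume.restrict Q.toSet

end Cube

/-- A set of cubes is `η`-sparse if there are pairwise disjoint measurable sets
`E Q ⊆ Q` with `η |Q| ≤ |E Q|`. -/
def IsSparse {d : ℕ} (η : ℝ) (S : Set (Cube d)) : Prop :=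
  ∃ E : Cube d → Set (Space d),
    (∀ Q ∈ S, MeasurableSet (E Q) ∧ E Q ⊆ Q.toSet ∧
      ENNReal.ofReal η * volume Q.toSet ≤ volume (E Q)) ∧
    S.PairwiseDisjoint E

/-- For an exponent `s`, the quantity
`sup_Q sup_{x, z ∈ (1/2) Q} ∑_{k ≥ 1} (2^k ℓ(Q))^d ‖(K(x, ·) - K(z, ·)) 1_{2^k Q ∖ 2^(k-1) Q}‖`,
with the normalized `L^s` norm over `2^k Q`. -/
def hormanderConst {d : ℕ} (s : ℝ≥0∞) (K : Space d → Space d → ℝ) : ℝ≥0∞ :=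
  ⨆ (Q : Cube d) (x ∈ Q.half.toSet) (z ∈ Q.half.toSet),
    ∑' k : ℕ, ENNReal.ofReal ((Q.dyadic (k + 1)).side ^ d) *
      eLpNorm (((Q.dyadic (k + 1)).toSet \ (Q.dyadic k).toSet).indicator
        fun y => K x y - K z y) s (Q.dyadic (k + 1)).avgMeasure

/-- A bounded linear operator `T` on `L²(ℝ^d)` is an `L^s`-Hörmander operator if there is a kernel
`K`, locally integrable off the diagonal, with `T φ (x) = ∫ K(x, y) φ(y) dy` for all
`φ ∈ C_c^∞` and (almost) all `x ∉ supp φ`, which satisfies the `L^s`-Hörmander condition in each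
of its two variables. -/
def IsHormanderOperator {d : ℕ} (s : ℝ≥0∞)
    (T : Lp ℝ 2 (volume : Measure (Space d)) →L[ℝ] Lp ℝ 2 (volume : Measure (Space d))) : Prop :=
  ∃ K : Space d → Space d → ℝ,
    LocallyIntegrableOn (Function.uncurry K) {p : Space d × Space d | p.1 ≠ p.2} volume ∧
    (∀ (φ : Space d → ℝ) (hφ : MemLp φ 2 volume), ContDiff ℝ ∞ φ → HasCompactSupport φ →
      ∀ᵐ x ∂volume, x ∉ tsupport φ → (T (hφ.toLp φ) : Space d → ℝ) x = ∫ y, K x y * φ y) ∧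
    hormanderConst s K < ⊤ ∧
    hormanderConst s (fun x y => K y x) < ⊤

/-- `u = T f`, where `T` is extended by continuity from `L¹ ∩ L²` to `L¹`: whenever
`φ_k ∈ L²` converges to `f` in `L¹`, the functions `T φ_k` converge to `u` in measure. -/
def IsExtendedValue {d : ℕ}
    (T : Lp ℝ 2 (volume : Measure (Space d)) →L[ℝ] Lp ℝ 2 (volume : Measure (Space d)))
    (f u : Space d → ℝ) : Prop :=
  AEStronglyMeasurable u volume ∧
  ∀ φ : ℕ → Lp ℝ 2 (volume : Measure (Space d)),
    Tendsto (fun k => eLpNorm (fun x => φ k x - f x) 1 volume) atTop (𝓝 0) →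
    TendstoInMeasure volume (fun k => (T (φ k) : Space d → ℝ)) atTop u

/-- `u = T f` for the vector valued extension `T f = ∑_j T(⟨f, e_j⟩) e_j`. -/
def IsVectorExtendedValue {d n : ℕ}
    (T : Lp ℝ 2 (volume : Measure (Space d)) →L[ℝ] Lp ℝ 2 (volume : Measure (Space d)))
    (f u : Space d → Space n) : Prop :=
  ∀ j, IsExtendedValue T (fun x => f x j) (fun x => u x j)

/-- The convex body `⟨⟨f⟩⟩_{p,Q}`: all averages over `Q` of `φ f`, where `φ` has normalized
`L^{p'}(Q)` norm at most one. -/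
def body {d n : ℕ} (p : ℝ≥0∞) (f : Space d → Space n) (Q : Cube d) : Set (Space n) :=
  {a | ∃ φ : Space d → ℝ, MemLp φ p.conjExponent Q.avgMeasure ∧
    eLpNorm φ p.conjExponent Q.avgMeasure ≤ 1 ∧ a = ∫ x, φ x • f x ∂Q.avgMeasure}

/-- The right endpoint of the interval `{⟨a, b⟩ : a ∈ A, b ∈ B}` (for convex, compact, symmetric,
non-empty sets `A`, `B`, where this endpoint is non-negative). -/
def bodyProd {n : ℕ} (A B : Set (Space n)) : ℝ≥0∞ :=
  ⨆ (a ∈ A) (b ∈ B), ENNReal.ofReal (inner ℝ a b)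

end ConvexBody

end

/-! The proof has a scalar half and a convex-body half.

Scalar half. The Calderón–Zygmund decomposition, with the Hörmander condition in the second variable
of the kernel, gives the weak type (1,1) bound (`measure_app_le_of_bounded`,
`hasWeakType_of_isKernel`). This bound makes the images of an L¹-convergent sequence Cauchy in
measure, so `T` extends to L¹. The condition in the first variable bounds the oscillation over P of
the image of a function vanishing on 2P, by the L^r averages of that function over dilates of P
(`exists_ae_enorm_extendedValue_sub_le`).

The scalar step `exists_stopping` takes finitely many functions h on 3Q with normalized L^r norm at
most 1. It selects the maximal dyadic P in Q where either the set {|Th| large} has high density or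
the L^r average of h over 3P is large. The selected cubes fill at most half of Q, and Th is bounded
almost everywhere off them. On a selected P, the image of h restricted to 3Q minus 3P is bounded as
well: the parent was not selected, so some point of P has both Th and T(h 1_{3P}) under control, and
the oscillation bound carries the resulting estimate to the rest of P. No maximal truncation of T is
needed.

Convex-body half. An approximate Auerbach basis for the seminorm w ↦ ‖⟨f, w⟩‖ (normalized L^r over
3Q) writes f on 3Q as a sum of ⟨f, w_j⟩ a_j, where the scalar functions are normalized and ⟨a_j, b⟩
is at most 2^n times the norm of ⟨f, b⟩ (`exists_adapted_coordinates`). The scalar step then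
controls ⟨T(f 1_{3Q}), g⟩ off the stopping cubes, and ⟨T(f 1_{3Q}) - T(f 1_{3P}), g⟩ on each P, by a
constant times the sum of |⟨a_j, g⟩|. By duality the integral of |⟨a_j, g⟩| over 3Q is at most 2^n
times the product of the two bodies times |3Q| (`setLIntegral_inner_le_bodyProd`).

Iterating from a partition of space into cubes whose triples contain the support of f gives a
pointwise telescoping bound. Integrating it gives the theorem, with the triples of all cubes met as
the sparse family. -/

noncomputable section

/-! ### Cubes, dyadic descent, stopping cubes and Lebesgue differentiation. -/

namespace ConvexBody

namespace Cube

variable {d : ℕ}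

/-- The half-open cube. -/
def box (Q : Cube d) : Set (Space d) :=
  {x | ∀ i, -(Q.side / 2) ≤ x i - Q.center i ∧ x i - Q.center i < Q.side / 2}

theorem box_subset_toSet (Q : Cube d) : Q.box ⊆ Q.toSet := fun _ hx i =>
  abs_le.2 ⟨(hx i).1, (hx i).2.le⟩

theorem isClosed_toSet (Q : Cube d) : IsClosed Q.toSet := by
  have : Q.toSet = ⋂ i, {x | |x i - Q.center i| ≤ Q.side / 2} := by
    ext x; simp [toSet]
  rw [this]
  exact isClosed_iInter fun i => isClosed_le (by fun_prop) continuous_const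

theorem measurableSet_toSet (Q : Cube d) : MeasurableSet Q.toSet :=
  Q.isClosed_toSet.measurableSet

theorem measurableSet_box (Q : Cube d) : MeasurableSet Q.box := by
  have : Q.box = ⋂ i, ({x | -(Q.side / 2) ≤ x i - Q.center i} ∩
      {x | x i - Q.center i < Q.side / 2}) := by
    ext x; simp [box]
  rw [this]
  exact MeasurableSet.iInter fun i =>
    (measurableSet_le measurable_const (by fun_prop)).inter
      (measurableSet_lt (by fun_prop) measurable_const)

theorem volume_toSet (Q : Cube d) : volume Q.toSet = ENNReal.ofReal (Q.side ^ d) := by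
  have h := (EuclideanSpace.volume_preserving_symm_measurableEquiv_toLp (Fin d)).symm
  have e : Q.toSet = (MeasurableEquiv.toLp 2 (Fin d → ℝ)).symm ⁻¹'
      Set.Icc (fun i => Q.center i - Q.side / 2) (fun i => Q.center i + Q.side / 2) := by
    ext x
    simp only [toSet, Set.mem_ofPred_eq, Set.mem_preimage, Set.mem_Icc, Pi.le_def, abs_le]
    constructor
    · intro hx
      exact ⟨fun i => by have := (hx i).1; simp; linarith, fun i => by have := (hx i).2; simp; linarith⟩
    · rintro ⟨h1, h2⟩ i
      have := h1 i; have := h2 i; simp at *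
      constructor <;> linarith
  rw [e, (EuclideanSpace.volume_preserving_symm_measurableEquiv_toLp (Fin d)).measure_preimage
    measurableSet_Icc.nullMeasurableSet, Real.volume_Icc_pi]
  simp [← ENNReal.ofReal_pow Q.side_pos.le]

theorem volume_box (Q : Cube d) : volume Q.box = ENNReal.ofReal (Q.side ^ d) := by
  have e : Q.box = (MeasurableEquiv.toLp 2 (Fin d → ℝ)).symm ⁻¹'
      (Set.univ.pi fun i => Set.Ico (Q.center i - Q.side / 2) (Q.center i + Q.side / 2)) := by
    ext x
    simp only [box, Set.mem_ofPred_eq, Set.mem_preimage, Set.mem_pi, Set.mem_univ, true_imp_iff,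
      Set.mem_Ico]
    refine forall_congr' fun i => ?_
    change _ ↔ Q.center i - Q.side / 2 ≤ x i ∧ x i < Q.center i + Q.side / 2
    constructor <;> rintro ⟨h1, h2⟩ <;> constructor <;> linarith
  rw [e, (EuclideanSpace.volume_preserving_symm_measurableEquiv_toLp (Fin d)).measure_preimage
    (MeasurableSet.univ_pi fun i => measurableSet_Ico).nullMeasurableSet, Real.volume_pi_Ico]
  simp [← ENNReal.ofReal_pow Q.side_pos.le]

theorem side_pow_pos (Q : Cube d) : 0 < Q.side ^ d := pow_pos Q.side_pos d

theorem volume_toSet_ne_zero (Q : Cube d) : volume Q.toSet ≠ 0 := by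
  rw [volume_toSet]; simpa using Q.side_pow_pos

theorem volume_toSet_ne_top (Q : Cube d) : volume Q.toSet ≠ ⊤ := by
  rw [volume_toSet]; exact ENNReal.ofReal_ne_top

theorem volume_box_ne_zero (Q : Cube d) : volume Q.box ≠ 0 := by
  rw [volume_box]; simpa using Q.side_pow_pos

theorem volume_real_toSet (Q : Cube d) : volume.real Q.toSet = Q.side ^ d := by
  rw [Measure.real, volume_toSet, ENNReal.toReal_ofReal Q.side_pow_pos.le]

/-- Half-open cubes give exact partitions, while the averages are taken over closed cubes; equal
finite volumes make the two interchangeable in integrals. -/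
theorem box_ae_eq_toSet (Q : Cube d) : Q.box =ᵐ[volume] Q.toSet :=
  ae_eq_of_subset_of_measure_ge Q.box_subset_toSet (by rw [volume_box, volume_toSet])
    Q.measurableSet_box.nullMeasurableSet Q.volume_toSet_ne_top

theorem center_mem_box (Q : Cube d) : Q.center ∈ Q.box := fun i => by
  have := Q.side_pos
  constructor <;> simp <;> linarith

theorem isCompact_toSet (Q : Cube d) : IsCompact Q.toSet := by
  refine Metric.isCompact_of_isClosed_isBounded Q.isClosed_toSet ?_
  refine (Metric.isBounded_iff_subset_closedBall Q.center).2 ⟨Real.sqrt (d * (Q.side / 2) ^ 2), ?_⟩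
  intro x hx
  rw [Metric.mem_closedBall, EuclideanSpace.dist_eq]
  refine Real.sqrt_le_sqrt ?_
  calc ∑ i, dist (x i) (Q.center i) ^ 2 ≤ ∑ _i : Fin d, (Q.side / 2) ^ 2 := by
        refine Finset.sum_le_sum fun i _ => ?_
        rw [Real.dist_eq]
        exact pow_le_pow_left₀ (abs_nonneg _) (hx i) 2
    _ = _ := by simp

/-- The child of `Q` containing `x` (if `x` lies in `Q`). -/
def child (Q : Cube d) (x : Space d) : Cube d where
  center := WithLp.toLp 2 fun i =>
    if x i < Q.center i then Q.center i - Q.side / 4 else Q.center i + Q.side / 4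
  side := Q.side / 2
  side_pos := half_pos Q.side_pos

theorem mem_box_child {Q : Cube d} {x : Space d} (hx : x ∈ Q.box) : x ∈ (Q.child x).box := by
  intro i
  have := hx i
  simp only [child]
  split_ifs <;> constructor <;> linarith

theorem child_eq_child {Q : Cube d} {x y : Space d} (hy : y ∈ (Q.child x).box) :
    Q.child y = Q.child x := by
  ext i
  · have := hy i
    have := Q.side_pos
    simp only [child] at *
    split_ifs at * <;> first | rfl | (exfalso; linarith)
  · rfl

/-- `P` sits inside `Q`. -/
def Inside (P Q : Cube d) : Prop :=
  P.side ≤ Q.side ∧ ∀ i, |P.center i - Q.center i| ≤ (Q.side - P.side) / 2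

theorem Inside.refl (Q : Cube d) : Q.Inside Q := ⟨le_rfl, fun i => by simp⟩

theorem Inside.trans {P Q R : Cube d} (h : P.Inside Q) (h' : Q.Inside R) : P.Inside R :=
  ⟨h.1.trans h'.1, fun i => by
    have h1 := abs_le.1 (h.2 i); have h2 := abs_le.1 (h'.2 i)
    exact abs_le.2 ⟨by linarith, by linarith⟩⟩

theorem Inside.box_subset {P Q : Cube d} (h : P.Inside Q) : P.box ⊆ Q.box := fun x hx i => by
  have h1 := abs_le.1 (h.2 i); have := hx i
  constructor <;> linarith

theorem Inside.toSet_subset {P Q : Cube d} (h : P.Inside Q) : P.toSet ⊆ Q.toSet := fun x hx i => by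
  have h1 := abs_le.1 (h.2 i); have := abs_le.1 (hx i)
  exact abs_le.2 ⟨by linarith, by linarith⟩

theorem Inside.dilate {P Q : Cube d} (h : P.Inside Q) {a : ℝ} (ha : 1 ≤ a) :
    (P.dilate a (by linarith)).Inside (Q.dilate a (by linarith)) :=
  ⟨mul_le_mul_of_nonneg_left h.1 (by linarith), fun i => by
    refine (h.2 i).trans ?_
    simp only [Cube.dilate]
    nlinarith [h.1]⟩

theorem child_inside (Q : Cube d) (x : Space d) : (Q.child x).Inside Q := by
  have := Q.side_pos
  refine ⟨by simp only [child]; linarith, fun i => ?_⟩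
  simp only [child]
  split_ifs <;> rw [abs_le] <;> constructor <;> linarith

/-- The `k`-th generation dyadic subcube of `Q` containing `x`. -/
def descend (Q : Cube d) (x : Space d) : ℕ → Cube d
  | 0 => Q
  | k + 1 => (descend Q x k).child x

theorem mem_box_descend {Q : Cube d} {x : Space d} (hx : x ∈ Q.box) (k : ℕ) :
    x ∈ (Q.descend x k).box := by
  induction k with
  | zero => exact hx
  | succ k ih => exact mem_box_child ih

theorem descend_side (Q : Cube d) (x : Space d) (k : ℕ) :
    (Q.descend x k).side = Q.side / 2 ^ k := by
  induction k with
  | zero => simp [descend]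
  | succ k ih =>
    change (Q.descend x k).side / 2 = _
    rw [ih, pow_succ]; field_simp

theorem descend_inside (Q : Cube d) (x : Space d) {j k : ℕ} (h : j ≤ k) :
    (Q.descend x k).Inside (Q.descend x j) := by
  induction k, h using Nat.le_induction with
  | base => exact Inside.refl _
  | succ k _ ih => exact (child_inside _ _).trans ih

/-- Nestedness of the dyadic grid, expressed through paths: a point of the k-th cube on the path of
x has made the same choices as x up to generation k. -/
theorem descend_eq {Q : Cube d} {x y : Space d} {k : ℕ} (hy : y ∈ (Q.descend x k).box) :
    ∀ j ≤ k, Q.descend y j = Q.descend x j := by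
  intro j hj
  induction j with
  | zero => rfl
  | succ j ih =>
    have h1 := (descend_inside Q x hj).box_subset hy
    have h2 := ih (by omega)
    change (Q.descend y j).child y = (Q.descend x j).child x
    rw [h2]
    exact child_eq_child h1

/-- The maximal dyadic subcubes of `Q` with the property `Sel`. -/
def stopped (Q : Cube d) (Sel : Cube d → Prop) : Set (Cube d) :=
  {P | ∃ x ∈ Q.box, ∃ k, P = Q.descend x k ∧ Sel P ∧ ∀ j < k, ¬ Sel (Q.descend x j)}

/-- A common point of two stopped cubes puts both on its own dyadic path, and only the first
selected cube of a path is stopped. -/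
theorem stopped_pairwiseDisjoint (Q : Cube d) (Sel : Cube d → Prop) :
    (Q.stopped Sel).PairwiseDisjoint box := by
  rintro P ⟨x, hx, k, rfl, hs, hj⟩ P' ⟨x', hx', k', rfl, hs', hj'⟩ hne
  refine Set.disjoint_left.2 fun y hy hy' => hne ?_
  have h1 := descend_eq hy
  have h2 := descend_eq hy'
  rcases lt_trichotomy k k' with h | h | h
  · exact absurd hs (by rw [← h1 k le_rfl, h2 k h.le]; exact hj' k h)
  · subst h; rw [← h1 k le_rfl, ← h2 k le_rfl]
  · exact absurd hs' (by rw [← h2 k' le_rfl, h1 k' h.le]; exact hj k' h)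

/-- Disjoint sets of positive measure in a σ-finite space are countable in number. -/
theorem countable_of_pairwiseDisjoint {S : Set (Cube d)} (h : S.PairwiseDisjoint box) :
    S.Countable := by
  have := Measure.countable_meas_pos_of_disjoint_iUnion (μ := (volume : Measure (Space d)))
    (As := fun Q : S => Q.1.box) (fun Q => Q.1.measurableSet_box)
    (fun Q Q' hne => h Q.2 Q'.2 (fun e => hne (Subtype.ext e)))
  have e : {Q : S | 0 < volume Q.1.box} = Set.univ := by
    ext Q; simpa using pos_iff_ne_zero.2 Q.1.volume_box_ne_zero
  rw [e] at this
  exact Set.countable_coe_iff.1 (Set.countable_univ_iff.1 this)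

theorem stopped_countable (Q : Cube d) (Sel : Cube d → Prop) : (Q.stopped Sel).Countable :=
  countable_of_pairwiseDisjoint (Q.stopped_pairwiseDisjoint Sel)

theorem not_sel_of_notMem_stopped {Q : Cube d} {Sel : Cube d → Prop} {x : Space d}
    (hx : x ∈ Q.box) (h : ∀ P ∈ Q.stopped Sel, x ∉ P.box) (k : ℕ) : ¬ Sel (Q.descend x k) := by
  classical
  intro hs
  have hex : ∃ k, Sel (Q.descend x k) := ⟨k, hs⟩
  exact h _ ⟨x, hx, Nat.find hex, rfl, Nat.find_spec hex, fun j hj => Nat.find_min hex hj⟩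
    (mem_box_descend hx _)

theorem stopped_inside {Q P : Cube d} {Sel : Cube d → Prop} (h : P ∈ Q.stopped Sel) :
    P.Inside Q := by
  obtain ⟨x, -, k, rfl, -⟩ := h
  exact descend_inside Q x (Nat.zero_le k)

theorem stopped_sel {Q P : Cube d} {Sel : Cube d → Prop} (h : P ∈ Q.stopped Sel) : Sel P := by
  obtain ⟨x, -, k, rfl, hs, -⟩ := h
  exact hs

theorem dist_le_of_mem_toSet {Q : Cube d} {x y : Space d} (hx : x ∈ Q.toSet) (hy : y ∈ Q.toSet) :
    dist y x ≤ d * Q.side := by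
  have hs := Q.side_pos
  rw [EuclideanSpace.dist_eq]
  refine Real.sqrt_le_iff.2 ⟨by positivity, ?_⟩
  calc ∑ i, dist (y i) (x i) ^ 2 ≤ ∑ _i : Fin d, Q.side ^ 2 := by
        refine Finset.sum_le_sum fun i _ => ?_
        rw [Real.dist_eq]
        have h1 := abs_le.1 (hx i); have h2 := abs_le.1 (hy i)
        exact pow_le_pow_left₀ (abs_nonneg _) (abs_le.2 ⟨by linarith, by linarith⟩) 2
    _ = d * Q.side ^ 2 := by simp
    _ ≤ (d * Q.side) ^ 2 := by
        rw [mul_pow]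
        refine mul_le_mul_of_nonneg_right ?_ (by positivity)
        rcases Nat.eq_zero_or_pos d with h | h
        · simp [h]
        · have : (1 : ℝ) ≤ d := by exact_mod_cast h
          nlinarith

theorem center_mem_interior (Q : Cube d) : Q.center ∈ interior Q.toSet := by
  refine mem_interior.2 ⟨{x | ∀ i, |x i - Q.center i| < Q.side / 2}, fun x hx i => (hx i).le, ?_,
    fun i => by simpa using Q.side_pos⟩
  have : {x : Space d | ∀ i, |x i - Q.center i| < Q.side / 2} =
      ⋂ i, {x | |x i - Q.center i| < Q.side / 2} := by ext x; simp
  rw [this]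
  exact isOpen_iInter_of_finite fun i => isOpen_lt (by fun_prop) continuous_const

/-- Lebesgue's differentiation theorem along dyadic subcubes. -/
theorem ae_tendsto_average_descend (f : Space d → ℝ) (hf : LocallyIntegrable f volume) :
    ∀ᵐ x ∂(volume : Measure (Space d)), ∀ Q : Cube d, x ∈ Q.box →
      Tendsto (fun k => ⨍ y in (Q.descend x k).toSet, f y) atTop (𝓝 (f x)) := by
  -- The Vitali family asks for the doubling constant, which is 3^d, and for each cube to fill a
  -- fixed proportion of the ball of radius 3ρ about x, where ρ bounds distances in the cube. With ρ
  -- = dℓ(Q) the ratio of volumes is (3d)^d times the volume of the unit ball.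
  obtain ⟨C, hC1, hC2⟩ : ∃ C : ℝ≥0, (∀ (x : Space d) (r : ℝ), 0 < r →
      volume (Metric.closedBall x (3 * r)) ≤ C * volume (Metric.closedBall x r)) ∧
      ∀ (Q : Cube d) (x : Space d), x ∈ Q.toSet →
        volume (Metric.closedBall x (3 * (d * Q.side))) ≤ C * volume Q.toSet := by
    set V : ℝ≥0 := (volume (Metric.ball (0 : Space d) 1)).toNNReal with hV
    have hV' : volume (Metric.ball (0 : Space d) 1) = V :=
      (ENNReal.coe_toNNReal measure_ball_lt_top.ne).symm
    refine ⟨max (3 ^ d) ((3 * d) ^ d * V), fun x r hr => ?_, fun Q x _ => ?_⟩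
    · rw [Measure.addHaar_closedBall _ _ (by positivity), Measure.addHaar_closedBall _ _ hr.le,
        finrank_euclideanSpace_fin, mul_pow, ENNReal.ofReal_mul (by positivity), mul_assoc]
      gcongr
      rw [ENNReal.ofReal_pow (by norm_num)]
      push_cast
      exact le_trans (by norm_num) (le_max_left _ _)
    · have hs := Q.side_pos
      rw [Measure.addHaar_closedBall _ _ (by positivity), finrank_euclideanSpace_fin, volume_toSet,
        ← mul_assoc, mul_pow, ENNReal.ofReal_mul (by positivity), hV', mul_right_comm]
      gcongr
      refine le_trans (le_of_eq ?_) (ENNReal.coe_le_coe.2 (le_max_right _ _))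
      push_cast
      rw [ENNReal.ofReal_pow (by positivity), ENNReal.ofReal_mul (by norm_num)]
      simp
  let v := Vitali.vitaliFamily (volume : Measure (Space d)) C fun x =>
    Filter.Eventually.frequently (f := 𝓝[>] (0 : ℝ))
      (eventually_mem_nhdsWithin.mono fun r hr => hC1 x r hr)
  filter_upwards [v.ae_tendsto_average hf] with x hx Q hxQ
  refine hx.comp (v.tendsto_filterAt_iff.2 ⟨Eventually.of_forall fun k => ?_, fun ε hε => ?_⟩)
  · have hm := (Q.descend x k).box_subset_toSet (mem_box_descend hxQ k)
    exact ⟨isClosed_toSet _, ⟨_, center_mem_interior _⟩, d * (Q.descend x k).side,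
      fun y hy => dist_le_of_mem_toSet hm hy, hC2 _ _ hm⟩
  · have : Tendsto (fun k : ℕ => d * (Q.side * (1 / 2 : ℝ) ^ k)) atTop (𝓝 (d * (Q.side * 0))) :=
      ((tendsto_pow_atTop_nhds_zero_of_lt_one (by norm_num) (by norm_num)).const_mul _).const_mul _
    rw [mul_zero, mul_zero] at this
    filter_upwards [this.eventually (gt_mem_nhds hε)] with k hk y hy
    have hm := (Q.descend x k).box_subset_toSet (mem_box_descend hxQ k)
    refine (dist_le_of_mem_toSet hm hy).trans ?_
    rw [descend_side]
    refine le_of_eq_of_le ?_ hk.le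
    simp [div_eq_mul_inv]

end Cube

end ConvexBody

end

/-! ### The operator on functions, and its kernel representation for bounded compactly supported
functions. -/

noncomputable section

namespace ConvexBody

variable {d : ℕ}

/-- Bounded operators on `L²(ℝ^d)`. -/
abbrev Op (d : ℕ) : Type :=
  Lp ℝ 2 (volume : Measure (Space d)) →L[ℝ] Lp ℝ 2 (volume : Measure (Space d))

/-- Dominated convergence in `L^p`. -/
theorem tendsto_eLpNorm_sub_of_dominated {α : Type*} [MeasurableSpace α] {μ : Measure α}
    {p : ℝ≥0∞} (hp0 : p ≠ 0) (hp : p ≠ ⊤) {F : ℕ → α → ℝ} {f G : α → ℝ}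
    (hF : ∀ k, AEStronglyMeasurable (F k) μ) (hG : MemLp G p μ)
    (hb : ∀ k, ∀ᵐ x ∂μ, ‖F k x‖ ≤ G x)
    (hlim : ∀ᵐ x ∂μ, Tendsto (fun k => F k x) atTop (𝓝 (f x))) :
    Tendsto (fun k => eLpNorm (fun x => F k x - f x) p μ) atTop (𝓝 0) := by
  have hf : AEStronglyMeasurable f μ := aestronglyMeasurable_of_tendsto_ae _ hF hlim
  have hpos : 0 < p.toReal := ENNReal.toReal_pos hp0 hp
  have key : Tendsto (fun k => ∫⁻ x, ‖F k x - f x‖ₑ ^ p.toReal ∂μ) atTop (𝓝 (∫⁻ _, 0 ∂μ)) := by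
    refine tendsto_lintegral_of_dominated_convergence' (fun x => ‖2 * G x‖ₑ ^ p.toReal)
      (fun k => ((hF k).sub hf).enorm.pow_const _) (fun k => ?_) ?_ ?_
    · filter_upwards [hlim, ae_all_iff.2 hb] with x hx hbx
      have h1 : ‖f x‖ ≤ G x := le_of_tendsto hx.norm (Eventually.of_forall hbx)
      refine ENNReal.rpow_le_rpow ?_ hpos.le
      rw [enorm_le_iff_norm_le]
      calc ‖F k x - f x‖ ≤ ‖F k x‖ + ‖f x‖ := norm_sub_le _ _
        _ ≤ 2 * G x := by linarith [hbx k]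
        _ ≤ ‖2 * G x‖ := Real.le_norm_self _
    · have := (hG.const_mul 2).eLpNorm_lt_top
      exact (lintegral_rpow_enorm_lt_top_of_eLpNorm_lt_top hp0 hp this).ne
    · filter_upwards [hlim] with x hx
      have h2 : Tendsto (fun k => ‖F k x - f x‖ₑ) atTop (𝓝 0) := by
        have := (hx.sub_const (f x)).enorm
        simpa using this
      have := h2.ennrpow_const p.toReal
      rwa [ENNReal.zero_rpow_of_pos hpos] at this
  rw [lintegral_zero] at key
  have := key.ennrpow_const (1 / p.toReal)
  rw [ENNReal.zero_rpow_of_pos (by positivity)] at this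
  refine this.congr fun k => ?_
  rw [eLpNorm_eq_lintegral_rpow_enorm_toReal hp0 hp]

open Classical in
/-- The operator `T` on functions. -/
def app (T : Op d) (φ : Space d → ℝ) : Space d → ℝ :=
  if h : MemLp φ 2 volume then T (h.toLp φ) else 0

theorem app_eq (T : Op d) {φ : Space d → ℝ} (h : MemLp φ 2 volume) :
    app T φ = T (h.toLp φ) := dif_pos h

theorem app_coe (T : Op d) (φ : Lp ℝ 2 (volume : Measure (Space d))) :
    app T φ = T φ := by
  rw [app_eq T (Lp.memLp φ), Lp.toLp_coeFn]

theorem memLp_app (T : Op d) (φ : Space d → ℝ) : MemLp (app T φ) 2 volume := by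
  unfold app
  split_ifs
  · exact Lp.memLp _
  · exact MemLp.zero

theorem app_add (T : Op d) {φ ψ : Space d → ℝ} (hφ : MemLp φ 2 volume) (hψ : MemLp ψ 2 volume) :
    app T (φ + ψ) =ᵐ[volume] app T φ + app T ψ := by
  rw [app_eq T hφ, app_eq T hψ, app_eq T (hφ.add hψ), MemLp.toLp_add hφ hψ, map_add]
  exact Lp.coeFn_add _ _

theorem app_smul (T : Op d) (c : ℝ) {φ : Space d → ℝ} (hφ : MemLp φ 2 volume) :
    app T (c • φ) =ᵐ[volume] c • app T φ := by
  rw [app_eq T hφ, app_eq T (hφ.const_smul c), MemLp.toLp_const_smul c hφ, map_smul]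
  exact Lp.coeFn_smul _ _

theorem app_sub (T : Op d) {φ ψ : Space d → ℝ} (hφ : MemLp φ 2 volume) (hψ : MemLp ψ 2 volume) :
    app T (φ - ψ) =ᵐ[volume] app T φ - app T ψ := by
  rw [app_eq T hφ, app_eq T hψ, app_eq T (hφ.sub hψ), MemLp.toLp_sub hφ hψ, map_sub]
  exact Lp.coeFn_sub _ _

theorem app_zero (T : Op d) : app T 0 =ᵐ[volume] 0 := by
  have := app_smul T 0 (MemLp.zero (p := 2) (μ := (volume : Measure (Space d))) (ε := ℝ))
  simpa using this

theorem app_sum (T : Op d) {ι : Type*} (s : Finset ι) {φ : ι → Space d → ℝ}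
    (hφ : ∀ i ∈ s, MemLp (φ i) 2 volume) :
    app T (∑ i ∈ s, φ i) =ᵐ[volume] ∑ i ∈ s, app T (φ i) := by
  classical
  induction s using Finset.induction_on with
  | empty => simpa using app_zero T
  | insert i s his ih =>
    rw [Finset.sum_insert his, Finset.sum_insert his]
    refine (app_add T (hφ i (by simp)) (memLp_finsetSum' s fun j hj => hφ j (by simp [hj]))).trans ?_
    exact (EventuallyEq.refl _ _).add (ih fun j hj => hφ j (by simp [hj]))

theorem eLpNorm_app_le (T : Op d) {φ : Space d → ℝ} (hφ : MemLp φ 2 volume) :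
    eLpNorm (app T φ) 2 volume ≤ ‖T‖ₑ * eLpNorm φ 2 volume := by
  rw [app_eq T hφ, ← Lp.enorm_def, ← Lp.enorm_toLp hφ]
  exact T.le_opENorm _

theorem tendsto_app (T : Op d) {φ : ℕ → Space d → ℝ} {f : Space d → ℝ}
    (hφ : ∀ k, MemLp (φ k) 2 volume) (hf : MemLp f 2 volume)
    (h : Tendsto (fun k => eLpNorm (fun x => φ k x - f x) 2 volume) atTop (𝓝 0)) :
    TendstoInMeasure volume (fun k => app T (φ k)) atTop (app T f) := by
  refine tendstoInMeasure_of_tendsto_eLpNorm (p := 2) (by norm_num)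
    (fun k => (memLp_app T _).aestronglyMeasurable) (memLp_app T _).aestronglyMeasurable ?_
  have h1 : Tendsto (fun k => ‖T‖ₑ * eLpNorm (fun x => φ k x - f x) 2 volume) atTop (𝓝 0) := by
    have := ENNReal.Tendsto.const_mul (a := ‖T‖ₑ) h (Or.inr enorm_ne_top)
    simpa using this
  refine tendsto_of_tendsto_of_tendsto_of_le_of_le tendsto_const_nhds h1 (fun _ => zero_le) ?_
  intro k
  change eLpNorm (app T (φ k) - app T f) 2 volume ≤ _
  rw [← eLpNorm_congr_ae (app_sub T (hφ k) hf)]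
  exact eLpNorm_app_le T ((hφ k).sub hf)

/-- A distributional bound passes to limits in measure. -/
theorem measure_le_of_tendstoInMeasure {α : Type*} [MeasurableSpace α] {μ : Measure α}
    {v : ℕ → α → ℝ} {u : α → ℝ} (h : TendstoInMeasure μ v atTop u) {t : ℝ} (ht : 0 < t)
    {F : Set α} {M : ℕ → ℝ≥0∞} {M' : ℝ≥0∞} (hv : ∀ k, μ ({x | t < |v k x|} ∩ F) ≤ M k)
    (hM : Tendsto M atTop (𝓝 M')) : μ ({x | 2 * t < |u x|} ∩ F) ≤ M' := by
  have h1 := (tendstoInMeasure_iff_norm.1 h) t ht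
  have h2 := hM.add h1
  rw [add_zero] at h2
  -- Where |u| > 2t, either |v_k| > t or |u - v_k| ≥ t, and the second set disappears in the limit.
  -- This is why the level is doubled.
  refine ge_of_tendsto' h2 fun k => ?_
  refine le_trans (measure_mono ?_) ((measure_union_le _ _).trans (add_le_add (hv k) le_rfl))
  rintro x ⟨hx, hxF⟩
  by_cases hk : t < |v k x|
  · exact Or.inl ⟨hk, hxF⟩
  · refine Or.inr ?_
    simp only [Set.mem_ofPred_eq, Real.norm_eq_abs] at *
    have := abs_sub_abs_le_abs_sub (u x) (v k x)
    rw [abs_sub_comm] at this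
    linarith

theorem memLp_of_bounded {h : Space d → ℝ} (hm : AEStronglyMeasurable h volume) {M : ℝ}
    (hM : ∀ x, |h x| ≤ M) {F : Set (Space d)} (hF : IsCompact F) (h0 : ∀ x ∉ F, h x = 0)
    (p : ℝ≥0∞) : MemLp h p volume := by
  have e : h = F.indicator h := by
    ext x
    by_cases hx : x ∈ F
    · simp [hx]
    · simp [hx, h0 x hx]
  rw [e, memLp_indicator_iff_restrict hF.measurableSet]
  have : IsFiniteMeasure (volume.restrict F) := ⟨by simpa using hF.measure_lt_top⟩
  exact MemLp.of_bound hm.restrict M (Eventually.of_forall hM)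

/-- Representation of `T h` by the kernel, for smooth test functions. -/
def IsKernel (T : Op d) (K : Space d → Space d → ℝ) : Prop :=
  LocallyIntegrableOn (Function.uncurry K) {p : Space d × Space d | p.1 ≠ p.2} volume ∧
    (∀ (φ : Space d → ℝ) (hφ : MemLp φ 2 volume), ContDiff ℝ ∞ φ → HasCompactSupport φ →
      ∀ᵐ x ∂volume, x ∉ tsupport φ → (T (hφ.toLp φ) : Space d → ℝ) x = ∫ y, K x y * φ y)

/-- The product of disjoint compact sets is a compact set off the diagonal, where K is integrable;
Fubini gives almost every section. -/
theorem ae_integrableOn_kernel {T : Op d} {K : Space d → Space d → ℝ} (hK : IsKernel T K)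
    {A B : Set (Space d)} (hA : IsCompact A) (hB : IsCompact B) (hAB : Disjoint A B) :
    ∀ᵐ x ∂volume, x ∈ A → IntegrableOn (K x) B volume := by
  have h1 : IntegrableOn (Function.uncurry K) (A ×ˢ B) volume := by
    refine hK.1.integrableOn_compact_subset ?_ (hA.prod hB)
    rintro ⟨x, y⟩ ⟨hx, hy⟩ (rfl : x = y)
    exact Set.disjoint_left.1 hAB hx hy
  have h2 : Integrable (Function.uncurry K) ((volume.restrict A).prod (volume.restrict B)) := by
    rw [Measure.prod_restrict]; exact h1
  exact (ae_restrict_iff' hA.measurableSet).1 h2.prod_right_ae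

/-- A countable exhaustion of the complement of a closed set by compact sets at positive distance
from it. -/
def awayFrom (F : Set (Space d)) (m : ℕ) : Set (Space d) :=
  Metric.closedBall 0 m ∩ {x | ENNReal.ofReal (2 / (m + 1)) ≤ Metric.infEDist x F}

theorem isCompact_awayFrom (F : Set (Space d)) (m : ℕ) : IsCompact (awayFrom F m) :=
  (isCompact_closedBall _ _).inter_right
    (isClosed_le continuous_const Metric.continuous_infEDist)

theorem exists_mem_awayFrom {F : Set (Space d)} (hF : IsClosed F) {x : Space d} (hx : x ∉ F) :
    ∃ m, x ∈ awayFrom F m := by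
  have h1 : 0 < Metric.infEDist x F := by
    rw [pos_iff_ne_zero]
    intro h
    exact hx (by rw [← hF.closure_eq]; exact Metric.mem_closure_iff_infEDist_zero.2 h)
  have h2 : Tendsto (fun m : ℕ => ENNReal.ofReal (2 / ((m : ℝ) + 1))) atTop (𝓝 0) := by
    have : Tendsto (fun m : ℕ => 2 * (1 / ((m : ℝ) + 1))) atTop (𝓝 (2 * 0)) :=
      tendsto_one_div_add_atTop_nhds_zero_nat.const_mul 2
    have := ENNReal.tendsto_ofReal this
    simpa [div_eq_mul_inv] using this
  obtain ⟨m, hm1, hm2⟩ := ((h2.eventually (gt_mem_nhds h1)).and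
    (eventually_ge_atTop ⌈‖x‖⌉₊)).exists
  exact ⟨m, by simpa using (Nat.le_ceil _).trans (Nat.cast_le.2 hm2), hm1.le⟩

/-- The 2 in the numerator of `awayFrom` leaves room for mollification: the supports of late
mollifications stay in the thickening by 1/(m+1). -/
theorem disjoint_awayFrom (F : Set (Space d)) (m : ℕ) :
    Disjoint (awayFrom F m) (Metric.cthickening (1 / (m + 1)) F) := by
  refine Set.disjoint_left.2 fun x hx hx' => ?_
  have h1 := hx.2.trans (Metric.mem_cthickening_iff.1 hx')
  have hm : (0 : ℝ) < m + 1 := by positivity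
  rw [ENNReal.ofReal_le_ofReal_iff (by positivity)] at h1
  rw [div_le_div_iff_of_pos_right hm] at h1
  norm_num at h1

-- Mollify h. The images converge in measure, hence almost everywhere along a subsequence. At a
-- point x outside F the mollifications are eventually supported in a thickening of F on which K(x,
-- ·) is integrable, so the kernel integrals converge by dominated convergence.
open scoped Convolution in
theorem ae_app_eq_integral {T : Op d} {K : Space d → Space d → ℝ} (hK : IsKernel T K)
    {h : Space d → ℝ} (hm : AEStronglyMeasurable h volume) {M : ℝ}
    (hM : ∀ x, |h x| ≤ M) {F : Set (Space d)} (hF : IsCompact F) (h0 : ∀ x ∉ F, h x = 0) :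
    ∀ᵐ x ∂volume, x ∉ F → app T h x = ∫ y, K x y * h y := by
  have hM0 : 0 ≤ M := (abs_nonneg _).trans (hM 0)
  have hh2 := memLp_of_bounded hm hM hF h0 2
  have hhi : Integrable h volume := memLp_one_iff_integrable.1 (memLp_of_bounded hm hM hF h0 1)
  -- The outer radius is always twice the inner one; almost everywhere convergence of the
  -- convolutions needs this ratio bounded.
  let ρ : ℕ → ContDiffBump (0 : Space d) := fun k =>
    ⟨1 / (k + 1) / 2, 1 / (k + 1), by positivity, half_lt_self (by positivity)⟩
  have hρ : ∀ k, (ρ k).rOut = 1 / ((k : ℝ) + 1) := fun k => rfl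
  let φ : ℕ → Space d → ℝ := fun k =>
    (ρ k).normed volume ⋆[ContinuousLinearMap.lsmul ℝ ℝ, volume] h
  have hφlim : ∀ᵐ x ∂volume, Tendsto (fun k => φ k x) atTop (𝓝 (h x)) :=
    ContDiffBump.ae_convolution_tendsto_right_of_locallyIntegrable (K := 2)
      tendsto_one_div_add_atTop_nhds_zero_nat
      (Eventually.of_forall fun k => by change (1 / ((k : ℝ) + 1)) ≤ 2 * (1 / (k + 1) / 2); linarith)
      hhi.locallyIntegrable
  have hφs : ∀ k, ContDiff ℝ ∞ (φ k) := fun k =>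
    (ρ k).hasCompactSupport_normed.contDiff_convolution_left _ (ρ k).contDiff_normed
      hhi.locallyIntegrable
  have hφM : ∀ k x, |φ k x| ≤ M := by
    intro k x
    have : ‖∫ t, (ρ k).normed volume t • h (x - t)‖ ≤ ∫ t, (ρ k).normed volume t * M := by
      refine norm_integral_le_of_norm_le ((ρ k).integrable_normed.mul_const M)
        (Eventually.of_forall fun t => ?_)
      rw [norm_smul, Real.norm_eq_abs, Real.norm_eq_abs, abs_of_nonneg ((ρ k).nonneg_normed t)]
      exact mul_le_mul_of_nonneg_left (hM _) ((ρ k).nonneg_normed t)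
    rw [integral_mul_const, (ρ k).integral_normed, one_mul] at this
    exact this
  have hφt : ∀ k, tsupport (φ k) ⊆ Metric.cthickening (1 / (k + 1)) F := by
    intro k
    refine closure_minimal ?_ Metric.isClosed_cthickening
    refine (support_convolution_subset _).trans ?_
    rw [(ρ k).support_normed_eq]
    rintro _ ⟨a, ha, b, hb, rfl⟩
    have hbF : b ∈ F := by
      by_contra hc; exact hb (h0 b hc)
    refine Metric.mem_cthickening_of_dist_le (a + b) b _ _ hbF ?_
    rw [dist_eq_norm, add_sub_cancel_right]
    rw [mem_ball_zero_iff] at ha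
    exact ha.le
  have hφ1 : ∀ k, tsupport (φ k) ⊆ Metric.cthickening 1 F := fun k =>
    (hφt k).trans (Metric.cthickening_mono (by
      rw [div_le_one (by positivity)]; linarith [(Nat.cast_nonneg k : (0 : ℝ) ≤ k)]) F)
  have hφc : ∀ k, HasCompactSupport (φ k) := fun k =>
    hF.cthickening.of_isClosed_subset (isClosed_tsupport _) (hφ1 k)
  have hφ0 : ∀ k, ∀ x ∉ Metric.cthickening 1 F, φ k x = 0 := fun k x hx =>
    image_eq_zero_of_notMem_tsupport fun hc => hx (hφ1 k hc)
  have hφm : ∀ k, MemLp (φ k) 2 volume := fun k =>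
    memLp_of_bounded (hφs k).continuous.aestronglyMeasurable (hφM k) hF.cthickening (hφ0 k) 2
  have hconv : Tendsto (fun k => eLpNorm (fun x => φ k x - h x) 2 volume) atTop (𝓝 0) := by
    refine tendsto_eLpNorm_sub_of_dominated (by norm_num) (by norm_num)
      (fun k => (hφs k).continuous.aestronglyMeasurable)
      (G := (Metric.cthickening 1 F).indicator fun _ => M) ?_
      (fun k => Eventually.of_forall fun x => ?_) hφlim
    · exact memLp_indicator_const 2 hF.cthickening.measurableSet M
        (Or.inr hF.cthickening.measure_lt_top.ne)
    · by_cases hx : x ∈ Metric.cthickening 1 F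
      · simpa [hx] using hφM k x
      · simp [hx, hφ0 k x hx]
  obtain ⟨ns, hns, hlim⟩ := (tendsto_app T hφm hh2 hconv).exists_seq_tendsto_ae
  have hrep : ∀ᵐ x ∂volume, ∀ k, x ∉ tsupport (φ k) → app T (φ k) x = ∫ y, K x y * φ k y := by
    refine ae_all_iff.2 fun k => ?_
    rw [app_eq T (hφm k)]
    exact hK.2 (φ k) (hφm k) (hφs k) (hφc k)
  have hint : ∀ᵐ x ∂volume, ∀ m : ℕ, x ∈ awayFrom F m →
      IntegrableOn (K x) (Metric.cthickening (1 / (m + 1)) F) volume :=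
    ae_all_iff.2 fun m => ae_integrableOn_kernel hK (isCompact_awayFrom F m) hF.cthickening
      (disjoint_awayFrom F m)
  filter_upwards [hlim, hrep, hint] with x hx hxr hxi hxF
  obtain ⟨m, hxm⟩ := exists_mem_awayFrom hF.isClosed hxF
  set B := Metric.cthickening (1 / ((m : ℝ) + 1)) F with hB
  have hBm : MeasurableSet B := Metric.isClosed_cthickening.measurableSet
  have hxB : x ∉ B := Set.disjoint_left.1 (disjoint_awayFrom F m) hxm
  have hKB : Integrable (B.indicator (K x)) volume := (integrable_indicator_iff hBm).2 (hxi m hxm)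
  have hsub : ∀ k ≥ m, tsupport (φ k) ⊆ B := fun k hk =>
    (hφt k).trans (Metric.cthickening_mono (by gcongr) F)
  have hFB : F ⊆ B := Metric.self_subset_cthickening F
  -- Cutting K(x, ·) down to B changes no product with a function supported there, and supplies the
  -- integrable majorant.
  have hind : ∀ g : Space d → ℝ, (∀ y ∉ B, g y = 0) → ∀ y, K x y * g y = B.indicator (K x) y * g y := by
    intro g hg y
    by_cases hy : y ∈ B
    · simp [hy]
    · simp [hy, hg y hy]
  have hh0 : ∀ y ∉ B, h y = 0 := fun y hy => h0 y fun hc => hy (hFB hc)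
  have lim2 : Tendsto (fun k => ∫ y, B.indicator (K x) y * φ (ns k) y) atTop
      (𝓝 (∫ y, B.indicator (K x) y * h y)) := by
    refine tendsto_integral_of_dominated_convergence (fun y => ‖B.indicator (K x) y‖ * M)
      (fun k => hKB.aestronglyMeasurable.mul (hφs _).continuous.aestronglyMeasurable)
      (hKB.norm.mul_const M) (fun k => Eventually.of_forall fun y => ?_) ?_
    · rw [norm_mul]
      exact mul_le_mul_of_nonneg_left (hφM _ _) (norm_nonneg _)
    · filter_upwards [hφlim] with y hy
      exact (hy.comp hns.tendsto_atTop).const_mul _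
  refine tendsto_nhds_unique (hx.congr' ?_) ((lim2.congr' EventuallyEq.rfl).trans_eq ?_)
  · filter_upwards [eventually_ge_atTop m] with k hk
    have hk' : m ≤ ns k := hk.trans (hns.id_le k)
    rw [hxr (ns k) fun hc => hxB (hsub _ hk' hc)]
    exact integral_congr_ae (Eventually.of_forall fun y =>
      hind _ (fun y hy => image_eq_zero_of_notMem_tsupport fun hc => hy (hsub _ hk' hc)) y)
  · congr 1
    exact integral_congr_ae (Eventually.of_forall fun y => (hind h hh0 y).symm)

end ConvexBody

end

/-! ### Consequences of the Hörmander condition. -/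

noncomputable section

namespace ConvexBody

variable {d : ℕ}

namespace Cube

instance (Q : Cube d) : IsProbabilityMeasure Q.avgMeasure :=
  ⟨by simp [avgMeasure, ENNReal.inv_mul_cancel Q.volume_toSet_ne_zero Q.volume_toSet_ne_top]⟩

theorem avgMeasure_absolutelyContinuous (Q : Cube d) : Q.avgMeasure ≪ volume :=
  Measure.smul_absolutelyContinuous.trans Measure.absolutelyContinuous_restrict

theorem setLIntegral_eq (Q : Cube d) (F : Space d → ℝ≥0∞) :
    ∫⁻ x in Q.toSet, F x = ENNReal.ofReal (Q.side ^ d) * ∫⁻ x, F x ∂Q.avgMeasure := by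
  rw [avgMeasure, lintegral_smul_measure, smul_eq_mul, ← mul_assoc, ← volume_toSet,
    ENNReal.mul_inv_cancel Q.volume_toSet_ne_zero Q.volume_toSet_ne_top, one_mul]

theorem dyadic_side (Q : Cube d) (k : ℕ) : (Q.dyadic k).side = 2 ^ k * Q.side := rfl

theorem compl_subset_iUnion_annuli (Q : Cube d) :
    Q.toSetᶜ ⊆ ⋃ k, (Q.dyadic (k + 1)).toSet \ (Q.dyadic k).toSet := by
  classical
  intro x hx
  have hex : ∃ k, x ∈ (Q.dyadic k).toSet := by
    have h1 : ∀ᶠ k : ℕ in atTop, ∀ i, |x i - Q.center i| * (2 / Q.side) ≤ 2 ^ k :=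
      eventually_all.2 fun i =>
        (tendsto_pow_atTop_atTop_of_one_lt one_lt_two).eventually (eventually_ge_atTop _)
    obtain ⟨k, hk⟩ := h1.exists
    refine ⟨k, fun i => ?_⟩
    have h2 := hk i
    have hs := Q.side_pos
    rw [dyadic_side]
    rw [← mul_div_assoc, div_le_iff₀ hs] at h2
    change |x i - Q.center i| ≤ _
    linarith
  have h0 : Nat.find hex ≠ 0 := by
    intro h
    have := Nat.find_spec hex
    rw [h] at this
    refine hx fun i => ?_
    have := this i
    simpa [dyadic, Cube.dilate] using this
  obtain ⟨k, hk⟩ := Nat.exists_eq_succ_of_ne_zero h0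
  refine Set.mem_iUnion.2 ⟨k, ?_, Nat.find_min hex (by omega)⟩
  have := Nat.find_spec hex
  rwa [hk] at this

/-- Hölder's inequality on the dyadic annuli around a cube. -/
theorem setLIntegral_compl_mul_le (Q : Cube d) {s r : ℝ≥0∞} [s.HolderConjugate r]
    {G h : Space d → ℝ} (hG : AEStronglyMeasurable G volume) (hh : AEStronglyMeasurable h volume)
    {B : ℝ≥0∞} (hB : ∀ k, eLpNorm h r (Q.dyadic (k + 1)).avgMeasure ≤ B) :
    ∫⁻ x in Q.toSetᶜ, ‖G x‖ₑ * ‖h x‖ₑ ≤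
      (∑' k : ℕ, ENNReal.ofReal ((Q.dyadic (k + 1)).side ^ d) *
      eLpNorm (((Q.dyadic (k + 1)).toSet \ (Q.dyadic k).toSet).indicator G) s
        (Q.dyadic (k + 1)).avgMeasure) * B := by
  calc ∫⁻ x in Q.toSetᶜ, ‖G x‖ₑ * ‖h x‖ₑ
      ≤ ∫⁻ x in ⋃ k, (Q.dyadic (k + 1)).toSet \ (Q.dyadic k).toSet, ‖G x‖ₑ * ‖h x‖ₑ :=
        lintegral_mono_set Q.compl_subset_iUnion_annuli
    _ ≤ ∑' k, ∫⁻ x in (Q.dyadic (k + 1)).toSet \ (Q.dyadic k).toSet, ‖G x‖ₑ * ‖h x‖ₑ :=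
        lintegral_iUnion_le _ _
    _ ≤ ∑' k : ℕ, ENNReal.ofReal ((Q.dyadic (k + 1)).side ^ d) *
      eLpNorm (((Q.dyadic (k + 1)).toSet \ (Q.dyadic k).toSet).indicator G) s
        (Q.dyadic (k + 1)).avgMeasure * B := by
        refine ENNReal.tsum_le_tsum fun k => ?_
        set R := Q.dyadic (k + 1)
        set A := R.toSet \ (Q.dyadic k).toSet with hA
        have hAm : MeasurableSet A := R.measurableSet_toSet.diff (Cube.measurableSet_toSet _)
        have e : ∫⁻ x in A, ‖G x‖ₑ * ‖h x‖ₑ = ∫⁻ x in R.toSet, ‖(A.indicator G • h) x‖ₑ := by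
          rw [← lintegral_indicator hAm, ← lintegral_indicator R.measurableSet_toSet]
          refine lintegral_congr fun x => ?_
          by_cases hx : x ∈ A
          · rw [Set.indicator_of_mem hx, Set.indicator_of_mem hx.1]
            simp [hx, enorm_mul]
          · rw [Set.indicator_of_notMem hx]
            by_cases hx' : x ∈ R.toSet <;> simp [hx, hx']
        rw [e, setLIntegral_eq, ← eLpNorm_one_eq_lintegral_enorm, mul_assoc]
        gcongr
        refine (eLpNorm_smul_le_mul_eLpNorm (p := s) (q := r) (r := 1)
          (hh.mono_ac R.avgMeasure_absolutelyContinuous)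
          ((hG.indicator hAm).mono_ac R.avgMeasure_absolutelyContinuous)).trans ?_
        gcongr
        exact hB k
    _ = _ := ENNReal.tsum_mul_right

/-- This turns the Hörmander condition for 2P into a comparison of arbitrary pairs of points of P.
-/
theorem half_dyadic_one (Q : Cube d) : (Q.dyadic 1).half = Q := by
  ext
  · rfl
  · simp [half, dyadic, Cube.dilate]

end Cube

theorem le_hormanderConst (s : ℝ≥0∞) (K : Space d → Space d → ℝ) (Q : Cube d) {x z : Space d}
    (hx : x ∈ Q.half.toSet) (hz : z ∈ Q.half.toSet) :
    ∑' k : ℕ, ENNReal.ofReal ((Q.dyadic (k + 1)).side ^ d) *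
      eLpNorm (((Q.dyadic (k + 1)).toSet \ (Q.dyadic k).toSet).indicator
        fun y => K x y - K z y) s (Q.dyadic (k + 1)).avgMeasure ≤ hormanderConst s K :=
  le_iSup_of_le Q <| le_iSup_of_le x <| le_iSup_of_le hx <| le_iSup_of_le z <|
    le_iSup_of_le hz le_rfl

/-- In positive dimension points are null, so by Fubini the diagonal is null, and measurability off
it is measurability on the whole product. -/
theorem aestronglyMeasurable_kernel (hd : 0 < d) {K : Space d → Space d → ℝ}
    (hK : LocallyIntegrableOn (Function.uncurry K) {p : Space d × Space d | p.1 ≠ p.2} volume) :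
    AEStronglyMeasurable (Function.uncurry K) (volume.prod volume) := by
  have h1 := hK.aestronglyMeasurable
  have : Nonempty (Fin d) := ⟨⟨0, hd⟩⟩
  have hdm : MeasurableSet {p : Space d × Space d | p.1 ≠ p.2} :=
    (isOpen_ne_fun continuous_fst continuous_snd).measurableSet
  have h2 : ∀ᵐ p ∂(volume.prod volume : Measure (Space d × Space d)),
      p ∈ {p : Space d × Space d | p.1 ≠ p.2} := by
    rw [ae_iff]
    refine (Measure.measure_prod_null hdm.compl).2 (Eventually.of_forall fun x => ?_)
    have : Prod.mk x ⁻¹' {p : Space d × Space d | ¬ p ∈ {p : Space d × Space d | p.1 ≠ p.2}} = {x} := by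
      ext y; simp [eq_comm]
    exact (congrArg volume this).trans (measure_singleton x)
  rwa [Measure.volume_eq_prod, Measure.restrict_eq_self_of_ae_mem h2] at h1

/-- Countably many sets `awayFrom F m` exhaust the complement of F, so one null set serves for all
of them. -/
theorem ae_integrableOn_kernel_of_notMem {T : Op d} {K : Space d → Space d → ℝ}
    (hK : IsKernel T K) {F : Set (Space d)} (hF : IsCompact F) :
    ∀ᵐ x ∂volume, x ∉ F → IntegrableOn (K x) F volume := by
  have := ae_all_iff.2 fun m : ℕ => ae_integrableOn_kernel hK (isCompact_awayFrom F m) hF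
    ((disjoint_awayFrom F m).mono_right (Metric.self_subset_cthickening F))
  filter_upwards [this] with x hx hxF
  obtain ⟨m, hm⟩ := exists_mem_awayFrom hF.isClosed hxF
  exact hx m hm

/-- The image of a function with mean zero supported in a cube is integrable away from the
cube. -/
theorem setLIntegral_compl_app_le (hd : 0 < d) {T : Op d} {K : Space d → Space d → ℝ}
    (hK : IsKernel T K) {s r : ℝ≥0∞} [s.HolderConjugate r] (P : Cube d)
    {b : Space d → ℝ} (hm : AEStronglyMeasurable b volume) {M : ℝ} (hM : ∀ x, |b x| ≤ M)
    (h0 : ∀ x ∉ P.toSet, b x = 0) (hb : ∫ x, b x = 0) :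
    ∫⁻ x in (P.dyadic 1).toSetᶜ, ‖app T b x‖ₑ ≤
      hormanderConst s (fun x y => K y x) * ∫⁻ x, ‖b x‖ₑ := by
  set Q := P.dyadic 1 with hQ
  set H := hormanderConst s (fun x y => K y x) with hH
  have hKm := aestronglyMeasurable_kernel hd hK.1
  have hsec : ∀ᵐ y ∂(volume : Measure (Space d)), AEStronglyMeasurable (fun x => K x y) volume :=
    hKm.prodMk_right
  have hPQ : P.toSet ⊆ Q.toSet := by
    intro x hx i
    have := hx i
    have hs := P.side_pos
    change |x i - P.center i| ≤ 2 ^ 1 * P.side / 2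
    linarith
  have hhalf : Q.half = P := P.half_dyadic_one
  -- The reference point cannot simply be the centre: only almost every section K(·, z) is known to
  -- be measurable.
  obtain ⟨z, hzP, hz⟩ : ∃ z ∈ P.toSet, AEStronglyMeasurable (fun x => K x z) volume := by
    have : ∃ᵐ z ∂(volume : Measure (Space d)), z ∈ P.toSet := by
      intro h
      exact P.volume_toSet_ne_zero (by simpa [ae_iff] using h)
    exact (this.and_eventually hsec).exists
  have hbi : Integrable b volume :=
    memLp_one_iff_integrable.1 (memLp_of_bounded hm hM P.isCompact_toSet h0 1)
  have hpt : ∀ᵐ x ∂volume, x ∈ Q.toSetᶜ → ‖app T b x‖ₑ ≤ ∫⁻ y, ‖K x y - K x z‖ₑ * ‖b y‖ₑ := by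
    filter_upwards [ae_app_eq_integral hK hm hM P.isCompact_toSet h0,
      ae_integrableOn_kernel_of_notMem hK P.isCompact_toSet] with x hx1 hx2 hxQ
    have hxP : x ∉ P.toSet := fun h => hxQ (hPQ h)
    have i1 : Integrable (fun y => K x y * b y) volume := by
      have : (fun y => K x y * b y) = fun y => b y * P.toSet.indicator (K x) y := by
        ext y
        by_cases hy : y ∈ P.toSet
        · simp [hy, mul_comm]
        · simp [hy, h0 y hy]
      rw [this]
      exact ((integrable_indicator_iff P.measurableSet_toSet).2 (hx2 hxP)).bdd_mul hm
        (Eventually.of_forall hM)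
    -- Mean zero allows K(x, z) to be subtracted for free.
    have e : app T b x = ∫ y, (K x y - K x z) * b y := by
      rw [hx1 hxP]
      simp_rw [sub_mul]
      rw [integral_sub i1 (hbi.const_mul _), integral_const_mul, hb, mul_zero, sub_zero]
    rw [e]
    refine (enorm_integral_le_lintegral_enorm _).trans_eq ?_
    simp_rw [enorm_mul]
  have hQm : MeasurableSet Q.toSetᶜ := Q.measurableSet_toSet.compl
  calc ∫⁻ x in Q.toSetᶜ, ‖app T b x‖ₑ
      ≤ ∫⁻ x in Q.toSetᶜ, ∫⁻ y, ‖K x y - K x z‖ₑ * ‖b y‖ₑ :=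
        lintegral_mono_ae ((ae_restrict_iff' hQm).2 hpt)
    _ = ∫⁻ y, ∫⁻ x in Q.toSetᶜ, ‖K x y - K x z‖ₑ * ‖b y‖ₑ := by
        refine lintegral_lintegral_swap ?_
        have e1 : (volume.restrict Q.toSetᶜ).prod (volume : Measure (Space d)) ≪
            (volume.prod volume : Measure (Space d × Space d)) :=
          Measure.absolutelyContinuous_restrict.prod Measure.AbsolutelyContinuous.rfl
        refine AEMeasurable.mono_ac ?_ e1
        have m1 := (hKm.sub hz.comp_fst).enorm
        exact m1.mul hm.comp_snd.enorm
    _ ≤ ∫⁻ y, H * ‖b y‖ₑ := by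
        refine lintegral_mono_ae ?_
        filter_upwards [hsec] with y hy
        by_cases hyP : y ∈ P.toSet
        · rw [lintegral_mul_const' _ _ enorm_ne_top]
          gcongr
          -- Hölder against the constant 1, whose normalized norm is 1 on every dilate.
          have h1 := Q.setLIntegral_compl_mul_le (s := s) (r := r) (hy.sub hz) (h := fun _ => 1)
            aestronglyMeasurable_const (B := 1) (fun k => by
              rw [eLpNorm_const _ (ENNReal.HolderConjugate.ne_zero r s) (NeZero.ne _)]; simp)
          simp only [enorm_one, mul_one, Pi.sub_apply] at h1
          refine h1.trans ?_
          exact le_hormanderConst s (fun x y => K y x) Q (x := y) (z := z) (by rwa [hhalf])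
            (by rwa [hhalf])
        · simp [h0 y hyP]
    _ = _ := by
        rw [lintegral_const_mul'' _ hm.enorm]

end ConvexBody

end

/-! ### Ingredients of the Calderón–Zygmund decomposition. -/

noncomputable section

namespace ConvexBody

variable {d : ℕ}

namespace Cube

/-- If the top cube is not selected, every stopped cube has a dyadic parent, which is not selected;
all upper bounds on stopped cubes come from that parent and the ancestors above it. -/
theorem exists_of_mem_stopped {Q P : Cube d} {Sel : Cube d → Prop} (hQ : ¬ Sel Q)
    (h : P ∈ Q.stopped Sel) :
    ∃ x ∈ Q.box, ∃ k, P = Q.descend x (k + 1) ∧ ∀ j ≤ k, ¬ Sel (Q.descend x j) := by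
  obtain ⟨x, hx, k, rfl, hs, hj⟩ := h
  cases k with
  | zero => exact absurd hs hQ
  | succ k => exact ⟨x, hx, k, rfl, fun j hjk => hj j (by omega)⟩

theorem exists_subset_box (hd : 0 < d) {F : Set (Space d)} (hF : IsCompact F) (A : ℝ) :
    ∃ Q : Cube d, F ⊆ Q.box ∧ A ≤ Q.side ^ d := by
  obtain ⟨R, hR⟩ := hF.isBounded.exists_norm_le
  set L := max (2 * R + 1) (max A 1) with hL
  have h1 : (1 : ℝ) ≤ L := (le_max_right _ _).trans (le_max_right _ _)
  refine ⟨⟨0, L, by linarith⟩, fun x hx i => ?_, ?_⟩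
  · have h2 := (PiLp.norm_apply_le x i).trans (hR x hx)
    rw [Real.norm_eq_abs, abs_le] at h2
    have h3 : 2 * R + 1 ≤ L := le_max_left _ _
    change -(L / 2) ≤ x i - 0 ∧ x i - 0 < L / 2
    constructor <;> linarith
  · exact ((le_max_left _ _).trans (le_max_right _ _)).trans (le_self_pow₀ h1 hd.ne')

/-- Lebesgue differentiation in the form used at points never reached by stopping. It serves for the
good part below and, with f an indicator, for density arguments. -/
theorem ae_abs_le_of_descend {f : Space d → ℝ} (hf : Integrable f volume) (t : ℝ)
    (ht : 0 ≤ t) :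
    ∀ᵐ x ∂(volume : Measure (Space d)), ∀ Q : Cube d, x ∈ Q.box →
      (∀ k, ∫⁻ y in (Q.descend x k).toSet, ‖f y‖ₑ ≤
        ENNReal.ofReal t * volume (Q.descend x k).toSet) → |f x| ≤ t := by
  filter_upwards [ae_tendsto_average_descend (fun x => ‖f x‖) hf.norm.locallyIntegrable] with x hx Q hxQ hk
  refine le_of_tendsto (hx Q hxQ) (Eventually.of_forall fun k => ?_)
  set P := Q.descend x k with hP
  have hint : IntegrableOn f P.toSet volume := hf.integrableOn
  rw [setAverage_eq, integral_norm_eq_lintegral_enorm hint.aestronglyMeasurable, volume_real_toSet,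
    smul_eq_mul, inv_mul_le_iff₀ P.side_pow_pos]
  have h1 := hk k
  rw [volume_toSet, ← ENNReal.ofReal_mul ht] at h1
  refine (ENNReal.toReal_mono ENNReal.ofReal_ne_top h1).trans ?_
  rw [ENNReal.toReal_ofReal (mul_nonneg ht P.side_pow_pos.le), mul_comm]

/-- The average of `f` over `Q`. -/
def avg (Q : Cube d) (f : Space d → ℝ) : ℝ := ∫ x, f x ∂Q.avgMeasure

theorem enorm_avg_mul_le (Q : Cube d) (f : Space d → ℝ) :
    ‖Q.avg f‖ₑ * volume Q.toSet ≤ ∫⁻ x in Q.toSet, ‖f x‖ₑ := by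
  rw [setLIntegral_eq, volume_toSet, mul_comm]
  gcongr
  exact enorm_integral_le_lintegral_enorm _

theorem setIntegral_box_sub_avg (Q : Cube d) {f : Space d → ℝ} (hf : Integrable f volume) :
    ∫ x, Q.box.indicator (fun y => f y - Q.avg f) x = 0 := by
  rw [integral_indicator Q.measurableSet_box, setIntegral_congr_set Q.box_ae_eq_toSet,
    integral_sub hf.integrableOn (integrableOn_const Q.volume_toSet_ne_top)]
  simp only [avg, avgMeasure, integral_smul_measure, setIntegral_const, volume_real_toSet,
    ENNReal.toReal_inv, smul_eq_mul]
  change _ - _ * ((volume.real Q.toSet)⁻¹ * _) = 0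
  rw [volume_real_toSet, mul_inv_cancel_left₀ Q.side_pow_pos.ne', sub_self]

end Cube

theorem tsum_setLIntegral_box_le {S : Set (Cube d)} (hS : S.PairwiseDisjoint Cube.box)
    (F : Space d → ℝ≥0∞) : ∑' P : S, ∫⁻ x in P.1.toSet, F x ≤ ∫⁻ x, F x := by
  have e : ∀ P : S, ∫⁻ x in P.1.toSet, F x = ∫⁻ x in P.1.box, F x := fun P =>
    (setLIntegral_congr P.1.box_ae_eq_toSet).symm
  simp_rw [e]
  rw [← lintegral_biUnion (Cube.countable_of_pairwiseDisjoint hS)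
    (fun P _ => P.measurableSet_box) hS]
  exact setLIntegral_le_lintegral _ _

open Classical in
/-- The bad part of the Calderón–Zygmund decomposition belonging to a finite set of cubes. -/
def badPart (f : Space d → ℝ) (s : Finset (Cube d)) : Space d → ℝ :=
  ∑ P ∈ s, P.box.indicator fun y => f y - P.avg f

open Classical in
/-- The bad part of the Calderón–Zygmund decomposition. -/
def totalBadPart (f : Space d → ℝ) (S : Set (Cube d)) (x : Space d) : ℝ :=
  if h : ∃ P ∈ S, x ∈ P.box then f x - h.choose.avg f else 0

theorem totalBadPart_of_mem {f : Space d → ℝ} {S : Set (Cube d)} (hS : S.PairwiseDisjoint Cube.box)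
    {P : Cube d} (hP : P ∈ S) {x : Space d} (hx : x ∈ P.box) :
    totalBadPart f S x = f x - P.avg f := by
  have h : ∃ P ∈ S, x ∈ P.box := ⟨P, hP, hx⟩
  have e : h.choose = P := by
    by_contra hne
    exact Set.disjoint_left.1 (hS h.choose_spec.1 hP hne) h.choose_spec.2 hx
  rw [totalBadPart, dif_pos h, e]

theorem totalBadPart_of_notMem {f : Space d → ℝ} {S : Set (Cube d)} {x : Space d}
    (h : ¬ ∃ P ∈ S, x ∈ P.box) : totalBadPart f S x = 0 := dif_neg h

-- The half-open cubes are disjoint, so a finite bad part is the total one cut down to the chosen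
-- cubes. Hence it is dominated by the total bad part, as needed for convergence in L².
open Classical in
theorem badPart_apply {f : Space d → ℝ} {S : Set (Cube d)} (hS : S.PairwiseDisjoint Cube.box)
    {s : Finset (Cube d)} (hs : (s : Set (Cube d)) ⊆ S) (x : Space d) :
    badPart f s x = if ∃ P ∈ s, x ∈ P.box then totalBadPart f S x else 0 := by
  rw [badPart, Finset.sum_apply]
  split_ifs with h
  · obtain ⟨P, hP, hx⟩ := h
    rw [Finset.sum_eq_single P, Set.indicator_of_mem hx, totalBadPart_of_mem hS (hs hP) hx]
    · intro P' hP' hne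
      exact Set.indicator_of_notMem
        (fun hc => Set.disjoint_left.1 (hS (hs hP') (hs hP) hne) hc hx) _
    · exact fun h => absurd hP h
  · refine Finset.sum_eq_zero fun P hP => Set.indicator_of_notMem (fun hc => h ⟨P, hP, hc⟩) _

theorem tendsto_badPart {f : Space d → ℝ} {S : Set (Cube d)} (hS : S.PairwiseDisjoint Cube.box)
    {s : ℕ → Finset (Cube d)} (hs : ∀ k, (s k : Set (Cube d)) ⊆ S)
    (hs' : ∀ P ∈ S, ∀ᶠ k in atTop, P ∈ s k) (x : Space d) :
    Tendsto (fun k => badPart f (s k) x) atTop (𝓝 (totalBadPart f S x)) := by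
  classical
  by_cases h : ∃ P ∈ S, x ∈ P.box
  · obtain ⟨P, hP, hx⟩ := h
    refine tendsto_const_nhds.congr' ?_
    filter_upwards [hs' P hP] with k hk
    rw [badPart_apply hS (hs k), if_pos ⟨P, hk, hx⟩]
  · rw [totalBadPart_of_notMem h]
    refine tendsto_const_nhds.congr fun k => ?_
    rw [badPart_apply hS (hs k), totalBadPart_of_notMem h, ite_self]

theorem exists_finset_exhaustion {ι : Type*} {S : Set ι} (hS : S.Countable) :
    ∃ s : ℕ → Finset ι, (∀ k, (s k : Set ι) ⊆ S) ∧ ∀ P ∈ S, ∀ᶠ k in atTop, P ∈ s k := by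
  have := hS.to_subtype
  obtain ⟨s, hs⟩ := exists_seq_tendsto (atTop : Filter (Finset S))
  refine ⟨fun k => (s k).map (Function.Embedding.subtype _), fun k => ?_, fun P hP => ?_⟩
  · intro P hP
    simp only [Finset.coe_map, Set.mem_image] at hP
    obtain ⟨P', -, rfl⟩ := hP
    exact P'.2
  · filter_upwards [hs.eventually (eventually_ge_atTop {⟨P, hP⟩})] with k hk
    simp only [Finset.mem_map]
    exact ⟨⟨P, hP⟩, hk (by simp), rfl⟩

theorem measure_lt_abs_le_div {μ : Measure (Space d)} {v : Space d → ℝ}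
    (hv : AEMeasurable v μ) {t : ℝ} (ht : 0 < t) :
    μ {x | t < |v x|} ≤ (∫⁻ x, ‖v x‖ₑ ∂μ) / ENNReal.ofReal t := by
  rw [ENNReal.le_div_iff_mul_le (Or.inl (by simpa using ht)) (Or.inl ENNReal.ofReal_ne_top),
    mul_comm]
  refine le_trans ?_ (mul_meas_ge_le_lintegral₀ hv.enorm (ENNReal.ofReal t))
  gcongr with x
  intro hx
  rw [← ofReal_norm]
  exact ENNReal.ofReal_le_ofReal hx.le

/-- Weak type `(1,1)` for the good part: an `L²` function bounded by `A t`. -/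
theorem measure_app_good_le (T : Op d) {g : Space d → ℝ} (hg : MemLp g 2 volume) {A t : ℝ}
    (hA : 0 ≤ A) (ht : 0 < t) (hgA : ∀ᵐ x ∂volume, |g x| ≤ A * t) :
    volume {x | t < |app T g x|} ≤
      ‖T‖ₑ ^ 2 * ENNReal.ofReal A * ((∫⁻ x, ‖g x‖ₑ) / ENNReal.ofReal t) := by
  have ht0 : ENNReal.ofReal t ≠ 0 := by simpa using ht
  have h1 := mul_meas_ge_le_pow_eLpNorm' volume (p := 2) (by norm_num) (by norm_num)
    (memLp_app T g).aestronglyMeasurable (ENNReal.ofReal t)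
  have h2 : eLpNorm g 2 volume ^ (2 : ℝ) = ∫⁻ x, ‖g x‖ₑ ^ (2 : ℝ) := by
    rw [eLpNorm_eq_lintegral_rpow_enorm_toReal (by norm_num) (by norm_num), ← ENNReal.rpow_mul]
    simp
  -- One factor of |g| is traded for its bound At, which turns the t⁻² of Chebyshev's inequality in
  -- L² into t⁻¹.
  have h3 : ∫⁻ x, ‖g x‖ₑ ^ (2 : ℝ) ≤ ENNReal.ofReal (A * t) * ∫⁻ x, ‖g x‖ₑ := by
    rw [← lintegral_const_mul'' _ hg.aestronglyMeasurable.enorm]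
    refine lintegral_mono_ae ?_
    filter_upwards [hgA] with x hx
    rw [ENNReal.rpow_two, sq]
    gcongr
    rw [← ofReal_norm]
    exact ENNReal.ofReal_le_ofReal hx
  have h4 : eLpNorm (app T g) 2 volume ^ (2 : ℝ) ≤
      ‖T‖ₑ ^ 2 * (ENNReal.ofReal (A * t) * ∫⁻ x, ‖g x‖ₑ) := by
    refine (ENNReal.rpow_le_rpow (eLpNorm_app_le T hg) (by norm_num)).trans ?_
    rw [ENNReal.mul_rpow_of_nonneg _ _ (by norm_num), h2, ENNReal.rpow_two]
    gcongr
  simp only [ENNReal.toReal_ofNat, ENNReal.rpow_two] at h1 h4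
  have h5 : ENNReal.ofReal t * (ENNReal.ofReal t * volume {x | t < |app T g x|}) ≤
      ENNReal.ofReal t * (‖T‖ₑ ^ 2 * ENNReal.ofReal A * ∫⁻ x, ‖g x‖ₑ) := by
    calc ENNReal.ofReal t * (ENNReal.ofReal t * volume {x | t < |app T g x|})
        = ENNReal.ofReal t ^ 2 * volume {x | t < |app T g x|} := by ring
      _ ≤ ENNReal.ofReal t ^ 2 * volume {x | ENNReal.ofReal t ≤ ‖app T g x‖ₑ} := by
          gcongr with x
          intro hx
          rw [← ofReal_norm]
          exact ENNReal.ofReal_le_ofReal hx.le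
      _ ≤ _ := h1.trans h4
      _ = _ := by rw [ENNReal.ofReal_mul hA]; ring
  rw [ENNReal.mul_le_mul_iff_right ht0 ENNReal.ofReal_ne_top] at h5
  rw [← mul_div_assoc, ENNReal.le_div_iff_mul_le (Or.inl ht0) (Or.inl ENNReal.ofReal_ne_top),
    mul_comm]
  exact h5

end ConvexBody

end

/-! ### The weak (1,1) inequality for bounded functions with compact support. -/

noncomputable section

namespace ConvexBody

variable {d : ℕ}

/-- The weak `(1,1)` constant. -/
def weakConst (T : Op d) (H : ℝ≥0∞) : ℝ≥0∞ :=
  ‖T‖ₑ ^ 2 * ENNReal.ofReal (2 ^ d) + (ENNReal.ofReal (2 ^ d) + 2 * H)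

/-- The Calderón–Zygmund selection rule. -/
def Heavy (f : Space d → ℝ) (t : ℝ) (P : Cube d) : Prop :=
  ENNReal.ofReal t * volume P.toSet < ∫⁻ x in P.toSet, ‖f x‖ₑ

theorem Cube.volume_descend (Q : Cube d) (x : Space d) (k : ℕ) :
    volume (Q.descend x k).toSet =
      ENNReal.ofReal (2 ^ d) * volume (Q.descend x (k + 1)).toSet := by
  rw [volume_toSet, volume_toSet, descend_side, descend_side, ← ENNReal.ofReal_mul (by positivity),
    ← mul_pow, pow_succ (2 : ℝ) k]
  congr 2
  field_simp

/-- The parent is not heavy, contains P and has 2^d times its volume. -/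
theorem setLIntegral_le_of_mem_stopped {f : Space d → ℝ} {t : ℝ} {Q P : Cube d}
    (hQ : ¬ Heavy f t Q) (hP : P ∈ Q.stopped (Heavy f t)) :
    ∫⁻ x in P.toSet, ‖f x‖ₑ ≤ ENNReal.ofReal (2 ^ d * t) * volume P.toSet := by
  obtain ⟨x, -, k, rfl, hk⟩ := Cube.exists_of_mem_stopped hQ hP
  have h1 := not_lt.1 (hk k le_rfl)
  refine (lintegral_mono_set (Cube.descend_inside Q x (Nat.le_succ k)).toSet_subset).trans
    (h1.trans_eq ?_)
  rw [Cube.volume_descend Q x k, ENNReal.ofReal_mul (by positivity)]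
  ring

theorem abs_avg_le_of_mem_stopped {f : Space d → ℝ} {t : ℝ} (ht : 0 ≤ t) {Q P : Cube d}
    (hQ : ¬ Heavy f t Q) (hP : P ∈ Q.stopped (Heavy f t)) : |P.avg f| ≤ 2 ^ d * t := by
  have h := (P.enorm_avg_mul_le f).trans (setLIntegral_le_of_mem_stopped hQ hP)
  rw [ENNReal.mul_le_mul_iff_left P.volume_toSet_ne_zero P.volume_toSet_ne_top, ← ofReal_norm,
    ENNReal.ofReal_le_ofReal_iff (by positivity)] at h
  exact h

theorem lintegral_enorm_indicator_sub_avg_le (P : Cube d) {f : Space d → ℝ}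
    (hf : AEStronglyMeasurable f volume) :
    ∫⁻ x, ‖P.box.indicator (fun y => f y - P.avg f) x‖ₑ ≤ 2 * ∫⁻ x in P.toSet, ‖f x‖ₑ := by
  simp_rw [enorm_indicator_eq_indicator_enorm]
  rw [lintegral_indicator P.measurableSet_box, setLIntegral_congr P.box_ae_eq_toSet]
  calc ∫⁻ x in P.toSet, ‖f x - P.avg f‖ₑ ≤ ∫⁻ x in P.toSet, ‖f x‖ₑ + ‖P.avg f‖ₑ :=
        lintegral_mono fun x => enorm_sub_le
    _ = (∫⁻ x in P.toSet, ‖f x‖ₑ) + ‖P.avg f‖ₑ * volume P.toSet := by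
        rw [lintegral_add_left' hf.enorm.restrict, setLIntegral_const]
    _ ≤ _ := by rw [two_mul]; gcongr; exact P.enorm_avg_mul_le f

/-- The good part is an average of f on each stopping cube and f itself elsewhere; averaging does
not increase the L¹ norm. -/
theorem lintegral_enorm_sub_totalBadPart_le {f : Space d → ℝ} {S : Set (Cube d)}
    (hS : S.PairwiseDisjoint Cube.box) :
    ∫⁻ x, ‖f x - totalBadPart f S x‖ₑ ≤ ∫⁻ x, ‖f x‖ₑ := by
  have hc := Cube.countable_of_pairwiseDisjoint hS
  set U := ⋃ P ∈ S, P.box with hU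
  have hUm : MeasurableSet U := MeasurableSet.biUnion hc fun P _ => P.measurableSet_box
  rw [← lintegral_add_compl _ hUm, ← lintegral_add_compl (fun x => ‖f x‖ₑ) hUm]
  refine add_le_add ?_ (le_of_eq (setLIntegral_congr_fun hUm.compl fun x hx => ?_))
  · rw [lintegral_biUnion hc (fun P _ => P.measurableSet_box) hS,
      lintegral_biUnion hc (fun P _ => P.measurableSet_box) hS]
    refine ENNReal.tsum_le_tsum fun P => ?_
    have e : ∫⁻ x in P.1.box, ‖f x - totalBadPart f S x‖ₑ = ∫⁻ _ in P.1.box, ‖P.1.avg f‖ₑ := by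
      refine setLIntegral_congr_fun P.1.measurableSet_box fun x hx => ?_
      simp only [totalBadPart_of_mem hS P.2 hx, sub_sub_cancel]
    rw [e, setLIntegral_const, setLIntegral_congr P.1.box_ae_eq_toSet, Cube.volume_box,
      ← Cube.volume_toSet]
    exact P.1.enorm_avg_mul_le f
  · have : ¬ ∃ P ∈ S, x ∈ P.box := fun ⟨P, hP, hx'⟩ => hx (Set.mem_biUnion hP hx')
    simp only [totalBadPart_of_notMem this, sub_zero]

/-- The weak `(1,1)` inequality for bounded functions with compact support. -/
theorem measure_app_le_of_bounded (hd : 0 < d) {T : Op d} {K : Space d → Space d → ℝ}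
    (hK : IsKernel T K) {s r : ℝ≥0∞} [s.HolderConjugate r]
    {f : Space d → ℝ} (hm : AEStronglyMeasurable f volume) {M : ℝ} (hM : ∀ x, |f x| ≤ M)
    {F : Set (Space d)} (hF : IsCompact F) (h0 : ∀ x ∉ F, f x = 0) {t : ℝ} (ht : 0 < t) :
    volume {x | 3 * t < |app T f x|} ≤
      weakConst T (hormanderConst s fun x y => K y x) *
        ((∫⁻ x, ‖f x‖ₑ) / ENNReal.ofReal t) := by
  classical
  set H := hormanderConst s fun x y => K y x with hH
  set N := ∫⁻ x, ‖f x‖ₑ with hN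
  have ht0 : ENNReal.ofReal t ≠ 0 := by simpa using ht
  have hM0 : 0 ≤ M := (abs_nonneg _).trans (hM 0)
  have hf2 : MemLp f 2 volume := memLp_of_bounded hm hM hF h0 2
  have hfi : Integrable f volume := memLp_one_iff_integrable.1 (memLp_of_bounded hm hM hF h0 1)
  have hNtop : N ≠ ⊤ := hfi.2.ne
  -- The top cube is so large that the average of |f| over it is at most t, so it is not heavy and
  -- stopping begins strictly below it.
  obtain ⟨Q, hFQ, hQ⟩ := Cube.exists_subset_box hd hF (N.toReal / t)
  have hQS : ¬ Heavy f t Q := by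
    rw [Heavy, not_lt]
    refine (setLIntegral_le_lintegral _ _).trans ?_
    rw [Cube.volume_toSet, ← ENNReal.ofReal_mul ht.le]
    refine (ENNReal.le_ofReal_iff_toReal_le hNtop (by have := Q.side_pow_pos; positivity)).2 ?_
    rwa [div_le_iff₀' ht] at hQ
  set S := Q.stopped (Heavy f t) with hSdef
  have hS : S.PairwiseDisjoint Cube.box := Q.stopped_pairwiseDisjoint _
  have hSc : S.Countable := Q.stopped_countable _
  have hSQ : ∀ P ∈ S, P.box ⊆ Q.toSet := fun P hP =>
    (Cube.stopped_inside hP).box_subset.trans Q.box_subset_toSet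
  set A : ℝ := 2 ^ d * t with hA
  have hA0 : 0 ≤ A := by positivity
  have havg : ∀ P ∈ S, |P.avg f| ≤ A := fun P hP => abs_avg_le_of_mem_stopped ht.le hQS hP
  obtain ⟨σ, hσS, hσ⟩ := exists_finset_exhaustion hSc
  set b := totalBadPart f S with hb
  have htb : ∀ x, |b x| ≤ M + A := by
    intro x
    by_cases h : ∃ P ∈ S, x ∈ P.box
    · obtain ⟨P, hP, hx⟩ := h
      rw [hb, totalBadPart_of_mem hS hP hx]
      exact (abs_sub _ _).trans (add_le_add (hM x) (havg P hP))
    · rw [hb, totalBadPart_of_notMem h, abs_zero]; positivity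
  have htb0 : ∀ x ∉ Q.toSet, b x = 0 := fun x hx =>
    totalBadPart_of_notMem fun ⟨P, hP, hxP⟩ => hx (hSQ P hP hxP)
  have hindm : ∀ P : Cube d, AEStronglyMeasurable (P.box.indicator fun y => f y - P.avg f) volume :=
    fun P => (hm.sub aestronglyMeasurable_const).indicator P.measurableSet_box
  have hindb : ∀ P ∈ S, ∀ x, |P.box.indicator (fun y => f y - P.avg f) x| ≤ M + A := by
    intro P hP x
    by_cases hx : x ∈ P.box
    · rw [Set.indicator_of_mem hx]
      exact (abs_sub _ _).trans (add_le_add (hM x) (havg P hP))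
    · rw [Set.indicator_of_notMem hx, abs_zero]; positivity
  have hind0 : ∀ P : Cube d, ∀ x ∉ P.toSet, P.box.indicator (fun y => f y - P.avg f) x = 0 :=
    fun P x hx => Set.indicator_of_notMem (fun hc => hx (P.box_subset_toSet hc)) _
  have hind2 : ∀ P ∈ S, MemLp (P.box.indicator fun y => f y - P.avg f) 2 volume := fun P hP =>
    memLp_of_bounded (hindm P) (hindb P hP) P.isCompact_toSet (hind0 P) 2
  have hbk2 : ∀ k, MemLp (badPart f (σ k)) 2 volume := fun k =>
    memLp_finsetSum' _ fun P hP => hind2 P (hσS k hP)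
  have hbk : ∀ k x, |badPart f (σ k) x| ≤ |b x| := by
    intro k x
    rw [badPart_apply hS (hσS k)]
    split_ifs
    · exact le_rfl
    · simp
  have hlim : ∀ x, Tendsto (fun k => badPart f (σ k) x) atTop (𝓝 (b x)) :=
    tendsto_badPart hS hσS hσ
  have hbm : AEStronglyMeasurable b volume :=
    aestronglyMeasurable_of_tendsto_ae _ (fun k => (hbk2 k).aestronglyMeasurable)
      (Eventually.of_forall hlim)
  have hb2 : MemLp b 2 volume := memLp_of_bounded hbm htb Q.isCompact_toSet htb0 2
  -- There may be infinitely many stopping cubes, while T is additive only over finite sums; the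
  -- finite bad parts converge to b in L².
  have hconv : TendstoInMeasure volume (fun k => app T (badPart f (σ k))) atTop (app T b) :=
    tendsto_app T hbk2 hb2 (tendsto_eLpNorm_sub_of_dominated (by norm_num) (by norm_num)
      (fun k => (hbk2 k).aestronglyMeasurable) hb2.norm
      (fun k => Eventually.of_forall (hbk k)) (Eventually.of_forall hlim))
  -- the exceptional set
  set D := ⋃ P ∈ S, (P.dyadic 1).toSet with hD
  have hDm : MeasurableSet D := MeasurableSet.biUnion hSc fun P _ => Cube.measurableSet_toSet _
  have hsumN : ∑' P : S, ∫⁻ x in P.1.toSet, ‖f x‖ₑ ≤ N := tsum_setLIntegral_box_le hS _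
  -- Each stopping cube is heavy, so its volume is less than the integral of |f| over it divided by
  -- t; doubling the cube costs 2^d.
  have hDvol : volume D ≤ ENNReal.ofReal (2 ^ d) * (N / ENNReal.ofReal t) := by
    refine (measure_biUnion_le volume hSc _).trans ?_
    rw [← mul_div_assoc, ENNReal.le_div_iff_mul_le (Or.inl ht0) (Or.inl ENNReal.ofReal_ne_top),
      ← ENNReal.tsum_mul_right]
    refine le_trans ?_ (mul_le_mul_right hsumN _)
    rw [← ENNReal.tsum_mul_left]
    refine ENNReal.tsum_le_tsum fun P => ?_
    have h1 : Heavy f t P.1 := Cube.stopped_sel P.2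
    rw [Cube.volume_toSet, Cube.dyadic_side, mul_pow, pow_one, ENNReal.ofReal_mul (by positivity),
      mul_assoc]
    gcongr
    rw [mul_comm, ← Cube.volume_toSet]
    exact h1.le
  -- The bound must not depend on k, so that it passes to the limit in measure. That passage raises
  -- the level from t to 2t; with t for the good part this makes 3t.
  have hbad1 : ∀ k, volume ({x | t < |app T (badPart f (σ k)) x|} ∩ Dᶜ) ≤
      2 * H * (N / ENNReal.ofReal t) := by
    intro k
    have e1 : volume ({x | t < |app T (badPart f (σ k)) x|} ∩ Dᶜ) ≤
        (volume.restrict Dᶜ) {x | t < |app T (badPart f (σ k)) x|} :=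
      Measure.le_restrict_apply _ _
    refine e1.trans ((measure_lt_abs_le_div
      (memLp_app T _).aestronglyMeasurable.aemeasurable.restrict ht).trans ?_)
    rw [← mul_div_assoc]
    refine ENNReal.div_le_div_right ?_ _
    calc ∫⁻ x in Dᶜ, ‖app T (badPart f (σ k)) x‖ₑ
        ≤ ∫⁻ x in Dᶜ, ∑ P ∈ σ k, ‖app T (P.box.indicator fun y => f y - P.avg f) x‖ₑ := by
          refine lintegral_mono_ae (ae_restrict_of_ae ?_)
          filter_upwards [app_sum T (σ k) fun P hP => hind2 P (hσS k hP)] with x hx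
          rw [badPart, hx, Finset.sum_apply]
          exact enorm_sum_le _ _
      _ = ∑ P ∈ σ k, ∫⁻ x in Dᶜ, ‖app T (P.box.indicator fun y => f y - P.avg f) x‖ₑ :=
          lintegral_finsetSum' _ fun P _ =>
            (memLp_app T _).aestronglyMeasurable.enorm.restrict
      _ ≤ ∑ P ∈ σ k, H * (2 * ∫⁻ x in P.toSet, ‖f x‖ₑ) := by
          refine Finset.sum_le_sum fun P hP => ?_
          have hPS := hσS k hP
          refine (lintegral_mono_set (Set.compl_subset_compl.2
            (Set.subset_biUnion_of_mem (u := fun P : Cube d => (P.dyadic 1).toSet) hPS))).trans ?_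
          refine (setLIntegral_compl_app_le hd hK (s := s) (r := r) P (hindm P) (hindb P hPS)
            (hind0 P) (P.setIntegral_box_sub_avg hfi)).trans ?_
          gcongr
          exact lintegral_enorm_indicator_sub_avg_le P hm
      _ = 2 * H * ∑ P ∈ σ k, ∫⁻ x in P.toSet, ‖f x‖ₑ := by
          rw [Finset.mul_sum]
          exact Finset.sum_congr rfl fun P _ => by ring
      _ ≤ 2 * H * N := by
          gcongr
          refine le_trans ?_ hsumN
          have hinj : ∑ P ∈ σ k, ∫⁻ x in P.toSet, ‖f x‖ₑ =
              ∑ P ∈ (σ k).subtype (· ∈ S), ∫⁻ x in P.1.toSet, ‖f x‖ₑ :=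
            (Finset.sum_subtype_of_mem (fun P : Cube d => ∫⁻ x in P.toSet, ‖f x‖ₑ)
              (hσS k)).symm
          rw [hinj]
          exact ENNReal.sum_le_tsum _
  have hbad : volume {x | 2 * t < |app T b x|} ≤
      (ENNReal.ofReal (2 ^ d) + 2 * H) * (N / ENNReal.ofReal t) := by
    have h1 := measure_le_of_tendstoInMeasure hconv ht (F := Dᶜ) hbad1 tendsto_const_nhds
    calc volume {x | 2 * t < |app T b x|}
        ≤ volume (D ∪ ({x | 2 * t < |app T b x|} ∩ Dᶜ)) := by
          refine measure_mono fun x hx => ?_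
          by_cases hxD : x ∈ D
          · exact Or.inl hxD
          · exact Or.inr ⟨hx, hxD⟩
      _ ≤ _ := (measure_union_le _ _).trans (add_le_add hDvol h1)
      _ = _ := by ring
  -- the good part
  set g := f - b with hg
  have hg2 : MemLp g 2 volume := hf2.sub hb2
  -- On a stopping cube g is an average, bounded through the parent. Elsewhere in Q no cube on the
  -- dyadic path is heavy, and outside Q the function f vanishes.
  have hgA : ∀ᵐ x ∂volume, |g x| ≤ 2 ^ d * t := by
    filter_upwards [Cube.ae_abs_le_of_descend hfi t ht.le] with x hx
    by_cases h : ∃ P ∈ S, x ∈ P.box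
    · obtain ⟨P, hP, hxP⟩ := h
      rw [hg, Pi.sub_apply, hb, totalBadPart_of_mem hS hP hxP, sub_sub_cancel]
      exact havg P hP
    · rw [hg, Pi.sub_apply, hb, totalBadPart_of_notMem h, sub_zero]
      by_cases hxQ : x ∈ Q.box
      · refine (hx Q hxQ fun k => not_lt.1 (Cube.not_sel_of_notMem_stopped hxQ
          (fun P hP hxP => h ⟨P, hP, hxP⟩) k)).trans ?_
        exact le_mul_of_one_le_left ht.le (one_le_pow₀ one_le_two)
      · rw [h0 x fun hc => hxQ (hFQ hc), abs_zero]; positivity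
  have hgood := measure_app_good_le T hg2 (by positivity) ht hgA
  have hgN : ∫⁻ x, ‖g x‖ₑ ≤ N := lintegral_enorm_sub_totalBadPart_le hS
  have hsplit : ∀ᵐ x ∂volume, app T f x = app T g x + app T b x := by
    have h1 := app_add T hg2 hb2
    rw [hg, sub_add_cancel] at h1
    exact h1
  calc volume {x | 3 * t < |app T f x|}
      ≤ volume ({x | t < |app T g x|} ∪ {x | 2 * t < |app T b x|}) := by
        refine measure_mono_ae ?_
        filter_upwards [hsplit] with x hx hx3
        change t < |app T g x| ∨ 2 * t < |app T b x|
        by_contra hc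
        rw [not_or, not_lt, not_lt] at hc
        have h3 : 3 * t < |app T f x| := hx3
        rw [hx] at h3
        have := abs_add_le (app T g x) (app T b x)
        linarith
    _ ≤ _ := (measure_union_le _ _).trans (add_le_add hgood hbad)
    _ ≤ _ := by
        rw [weakConst, add_mul (‖T‖ₑ ^ 2 * ENNReal.ofReal (2 ^ d))]
        gcongr

end ConvexBody

end

/-! ### Truncation, the weak type bound on L², and the extension of T to L¹. -/

noncomputable section

namespace ConvexBody

variable {d : ℕ}

/-- Truncation of a function to a bounded function with compact support. -/
def trunc (f : Space d → ℝ) (k : ℕ) : Space d → ℝ :=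
  ({x | |f x| ≤ k} ∩ Metric.closedBall 0 k).indicator f

theorem aestronglyMeasurable_trunc {f : Space d → ℝ} (hf : AEStronglyMeasurable f volume) (k : ℕ) :
    AEStronglyMeasurable (trunc f k) volume := by
  refine hf.indicator₀ (NullMeasurableSet.inter ?_ measurableSet_closedBall.nullMeasurableSet)
  exact nullMeasurableSet_le hf.norm.aemeasurable aemeasurable_const

theorem abs_trunc_le (f : Space d → ℝ) (k : ℕ) (x : Space d) : |trunc f k x| ≤ |f x| := by
  unfold trunc
  by_cases h : x ∈ {x | |f x| ≤ k} ∩ Metric.closedBall 0 (k : ℝ)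
  · rw [Set.indicator_of_mem h]
  · rw [Set.indicator_of_notMem h, abs_zero]; exact abs_nonneg _

theorem abs_trunc_le_nat (f : Space d → ℝ) (k : ℕ) (x : Space d) : |trunc f k x| ≤ k := by
  unfold trunc
  by_cases h : x ∈ {x | |f x| ≤ k} ∩ Metric.closedBall 0 (k : ℝ)
  · rw [Set.indicator_of_mem h]; exact h.1
  · rw [Set.indicator_of_notMem h, abs_zero]; positivity

theorem trunc_eq_zero (f : Space d → ℝ) (k : ℕ) (x : Space d)
    (hx : x ∉ Metric.closedBall 0 (k : ℝ)) : trunc f k x = 0 :=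
  Set.indicator_of_notMem (fun h => hx h.2) _

theorem trunc_eq_zero_of_eq_zero {f : Space d → ℝ} (k : ℕ) {x : Space d}
    (hx : f x = 0) : trunc f k x = 0 := by
  have := abs_trunc_le f k x
  rw [hx, abs_zero] at this
  exact abs_eq_zero.1 (le_antisymm this (abs_nonneg _))

theorem tendsto_trunc (f : Space d → ℝ) (x : Space d) :
    Tendsto (fun k => trunc f k x) atTop (𝓝 (f x)) := by
  refine tendsto_const_nhds.congr' ?_
  filter_upwards [eventually_ge_atTop ⌈|f x|⌉₊, eventually_ge_atTop ⌈‖x‖⌉₊] with k h1 h2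
  rw [trunc, Set.indicator_of_mem]
  exact ⟨(Nat.le_ceil _).trans (Nat.cast_le.2 h1),
    by simpa using (Nat.le_ceil _).trans (Nat.cast_le.2 h2)⟩

theorem memLp_trunc {f : Space d → ℝ} (hf : AEStronglyMeasurable f volume) (k : ℕ) (p : ℝ≥0∞) :
    MemLp (trunc f k) p volume :=
  memLp_of_bounded (aestronglyMeasurable_trunc hf k) (abs_trunc_le_nat f k)
    (isCompact_closedBall 0 (k : ℝ)) (trunc_eq_zero f k) p

theorem tendsto_eLpNorm_trunc_sub {f : Space d → ℝ} {p : ℝ≥0∞} (hp0 : p ≠ 0) (hp : p ≠ ⊤)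
    (hf : MemLp f p volume) :
    Tendsto (fun k => eLpNorm (fun x => trunc f k x - f x) p volume) atTop (𝓝 0) :=
  tendsto_eLpNorm_sub_of_dominated hp0 hp
    (fun k => aestronglyMeasurable_trunc hf.aestronglyMeasurable k) hf.norm
    (fun k => Eventually.of_forall (abs_trunc_le f k)) (Eventually.of_forall (tendsto_trunc f))

/-- The weak `(1,1)` inequality on `L²`. -/
def HasWeakType (T : Op d) (C : ℝ≥0∞) : Prop :=
  1 ≤ C ∧ C ≠ ⊤ ∧ ∀ f, MemLp f 2 volume → ∀ t : ℝ, 0 < t →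
    volume {x | t < |app T f x|} ≤ C * ((∫⁻ x, ‖f x‖ₑ) / ENNReal.ofReal t)

/-- Truncations converge in L² and do not increase the L¹ norm, so the bound for bounded compactly
supported functions passes to all of L². -/
theorem hasWeakType_of_isKernel (hd : 0 < d) {T : Op d} {K : Space d → Space d → ℝ}
    (hK : IsKernel T K) {s r : ℝ≥0∞} [s.HolderConjugate r]
    (hH : hormanderConst s (fun x y => K y x) < ⊤) : ∃ C, HasWeakType T C := by
  set W := weakConst T (hormanderConst s fun x y => K y x) with hW
  have hWtop : W ≠ ⊤ := by
    rw [hW, weakConst]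
    refine ENNReal.add_ne_top.2 ⟨ENNReal.mul_ne_top (ENNReal.pow_ne_top enorm_ne_top)
      ENNReal.ofReal_ne_top, ENNReal.add_ne_top.2 ⟨ENNReal.ofReal_ne_top,
      ENNReal.mul_ne_top (by norm_num) hH.ne⟩⟩
  -- The bounded case is used at level t/6: a factor 3 is lost there and a factor 2 in the limit in
  -- measure. The added 1 provides the clause 1 ≤ C.
  refine ⟨6 * W + 1, le_add_self, ENNReal.add_ne_top.2
    ⟨ENNReal.mul_ne_top (by norm_num) hWtop, ENNReal.one_ne_top⟩, fun f hf t ht => ?_⟩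
  have hm := hf.aestronglyMeasurable
  have h1 := measure_le_of_tendstoInMeasure (μ := volume) (F := Set.univ)
    (M' := W * ((∫⁻ x, ‖f x‖ₑ) / ENNReal.ofReal (t / 6)))
    (tendsto_app T (fun k => memLp_trunc hm k 2) hf
      (tendsto_eLpNorm_trunc_sub (by norm_num) (by norm_num) hf)) (t := 3 * (t / 6))
    (by positivity) (fun k => by
      rw [Set.inter_univ]
      refine (measure_app_le_of_bounded hd hK (s := s) (r := r) (aestronglyMeasurable_trunc hm k)
        (abs_trunc_le_nat f k) (isCompact_closedBall 0 (k : ℝ)) (trunc_eq_zero f k)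
        (t := t / 6) (by positivity)).trans ?_
      gcongr with x
      rw [enorm_le_iff_norm_le]
      exact abs_trunc_le f k x) tendsto_const_nhds
  rw [Set.inter_univ] at h1
  have e : 2 * (3 * (t / 6)) = t := by ring
  rw [e] at h1
  refine h1.trans ?_
  rw [ENNReal.ofReal_div_of_pos (by norm_num), add_mul]
  refine le_trans (le_of_eq ?_) le_self_add
  have h6 : ENNReal.ofReal 6 = 6 := by norm_num
  rw [h6, div_eq_mul_inv, div_eq_mul_inv, div_eq_mul_inv,
    ENNReal.mul_inv (Or.inr (by simp)) (Or.inr (by simp)), inv_inv]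
  ring

theorem tendstoInMeasure_add {α : Type*} [MeasurableSpace α] {μ : Measure α}
    {a b : ℕ → α → ℝ} {u v : α → ℝ} (ha : TendstoInMeasure μ a atTop u)
    (hb : TendstoInMeasure μ b atTop v) :
    TendstoInMeasure μ (fun k => a k + b k) atTop (u + v) := by
  rw [tendstoInMeasure_iff_norm] at *
  intro ε hε
  have h := (ha (ε / 2) (by positivity)).add (hb (ε / 2) (by positivity))
  rw [add_zero] at h
  refine tendsto_of_tendsto_of_tendsto_of_le_of_le tendsto_const_nhds h (fun _ => zero_le)
    fun k => (measure_mono fun x hx => ?_).trans (measure_union_le _ _)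
  by_contra hc
  simp only [Set.mem_union, Set.mem_ofPred_eq, not_or, not_le, Pi.add_apply] at hc hx
  have : a k x + b k x - (u x + v x) = (a k x - u x) + (b k x - v x) := by ring
  rw [this] at hx
  have := norm_add_le (a k x - u x) (b k x - v x)
  linarith

theorem tendstoInMeasure_smul {α : Type*} [MeasurableSpace α] {μ : Measure α} (c : ℝ)
    {a : ℕ → α → ℝ} {u : α → ℝ} (ha : TendstoInMeasure μ a atTop u) :
    TendstoInMeasure μ (fun k => c • a k) atTop (c • u) := by
  rw [tendstoInMeasure_iff_norm] at *
  intro ε hε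
  have h := ha (ε / (|c| + 1)) (by positivity)
  refine tendsto_of_tendsto_of_tendsto_of_le_of_le tendsto_const_nhds h (fun _ => zero_le)
    fun k => measure_mono fun x hx => ?_
  simp only [Set.mem_ofPred_eq, Pi.smul_apply, smul_eq_mul, ← mul_sub, norm_mul,
    Real.norm_eq_abs] at hx ⊢
  rw [div_le_iff₀ (by positivity)]
  nlinarith [abs_nonneg (a k x - u x)]

/-- Rapidly Cauchy sequences converge in measure. -/
theorem exists_tendstoInMeasure {α : Type*} [MeasurableSpace α] {μ : Measure α} (v : ℕ → α → ℝ)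
    (h : ∑' k, μ {x | (1 / 2 : ℝ) ^ k < |v (k + 1) x - v k x|} ≠ ⊤) :
    ∃ u, TendstoInMeasure μ v atTop u := by
  set E : ℕ → Set α := fun k => {x | (1 / 2 : ℝ) ^ k < |v (k + 1) x - v k x|} with hE
  refine ⟨fun x => limUnder atTop fun k => v k x, tendstoInMeasure_iff_norm.2 fun ε hε => ?_⟩
  have h1 := ENNReal.tendsto_sum_nat_add (fun k => μ (E k)) h
  refine tendsto_of_tendsto_of_tendsto_of_le_of_le' tendsto_const_nhds h1
    (Eventually.of_forall fun _ => zero_le) ?_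
  have h2 : Tendsto (fun m : ℕ => 2 * (1 / 2 : ℝ) ^ m) atTop (𝓝 (2 * 0)) :=
    (tendsto_pow_atTop_nhds_zero_of_lt_one (by norm_num) (by norm_num)).const_mul _
  rw [mul_zero] at h2
  filter_upwards [h2.eventually (gt_mem_nhds hε)] with m hm
  -- Off the sets with index at least m the differences are geometric, so the sequence converges
  -- there and its m-th term is within 2·2^(-m) < ε of the limit.
  refine (measure_mono (t := ⋃ k, E (k + m)) fun x hx => ?_).trans (measure_iUnion_le _)
  by_contra hc
  have hc' : ∀ k, x ∉ E (k + m) := fun k hk => hc (Set.mem_iUnion.2 ⟨k, hk⟩)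
  have hd : ∀ n, dist (v (n + m) x) (v (n + 1 + m) x) ≤ (2 * (1 / 2 : ℝ) ^ m) / 2 / 2 ^ n := by
    intro n
    have : |v (n + m + 1) x - v (n + m) x| ≤ (1 / 2 : ℝ) ^ (n + m) := not_lt.1 (hc' n)
    rw [dist_comm, Real.dist_eq]
    rw [show n + 1 + m = n + m + 1 by ring]
    refine this.trans_eq ?_
    rw [pow_add]
    field_simp
    rw [← mul_pow]; norm_num
  have hcs : CauchySeq fun n => v (n + m) x := cauchySeq_of_le_geometric_two hd
  obtain ⟨l, hl⟩ := cauchySeq_tendsto_of_complete hcs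
  have hl' : Tendsto (fun k => v k x) atTop (𝓝 l) :=
    (tendsto_add_atTop_iff_nat (f := fun k => v k x) m).1 hl
  have h3 := dist_le_of_le_geometric_two_of_tendsto₀ hd hl
  simp only [Set.mem_ofPred_eq] at hx
  rw [hl'.limUnder_eq, ← dist_eq_norm] at hx
  rw [zero_add] at h3
  linarith

variable {T : Op d} {C : ℝ≥0∞}

theorem HasWeakType.tendstoInMeasure_zero (hT : HasWeakType T C) {φ : ℕ → Space d → ℝ}
    (hφ : ∀ k, MemLp (φ k) 2 volume)
    (h : Tendsto (fun k => eLpNorm (φ k) 1 volume) atTop (𝓝 0)) :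
    TendstoInMeasure volume (fun k => app T (φ k)) atTop 0 := by
  rw [tendstoInMeasure_iff_norm]
  intro ε hε
  have hε2 : ENNReal.ofReal (ε / 2) ≠ 0 := by simpa using hε
  have h1 : Tendsto (fun k => C * (eLpNorm (φ k) 1 volume / ENNReal.ofReal (ε / 2))) atTop
      (𝓝 (C * (0 / ENNReal.ofReal (ε / 2)))) :=
    ENNReal.Tendsto.const_mul (ENNReal.Tendsto.div_const h (Or.inr hε2)) (Or.inr hT.2.1)
  rw [ENNReal.zero_div, mul_zero] at h1
  refine tendsto_of_tendsto_of_tendsto_of_le_of_le tendsto_const_nhds h1 (fun _ => zero_le)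
    fun k => ?_
  rw [eLpNorm_one_eq_lintegral_enorm]
  refine le_trans (measure_mono fun x hx => ?_) (hT.2.2 (φ k) (hφ k) (ε / 2) (by positivity))
  simp only [Set.mem_ofPred_eq, Pi.zero_apply, sub_zero, Real.norm_eq_abs] at hx ⊢
  linarith

/-- A single approximating sequence decides the value: any other one differs from it by functions
tending to 0 in L¹, whose images tend to 0 in measure by the weak type bound. -/
theorem HasWeakType.isExtendedValue (hT : HasWeakType T C) {f u : Space d → ℝ}
    (hf : AEStronglyMeasurable f volume) {φ : ℕ → Space d → ℝ} (hφ : ∀ k, MemLp (φ k) 2 volume)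
    (h : Tendsto (fun k => eLpNorm (fun x => φ k x - f x) 1 volume) atTop (𝓝 0))
    (hu : TendstoInMeasure volume (fun k => app T (φ k)) atTop u) : IsExtendedValue T f u := by
  refine ⟨hu.aestronglyMeasurable fun k => (memLp_app T _).aestronglyMeasurable, fun ψ hψ => ?_⟩
  have h1 : TendstoInMeasure volume (fun k => app T ((ψ k : Space d → ℝ) - φ k)) atTop 0 := by
    refine hT.tendstoInMeasure_zero (fun k => (Lp.memLp _).sub (hφ k)) ?_
    have h2 := hψ.add h
    rw [add_zero] at h2
    refine tendsto_of_tendsto_of_tendsto_of_le_of_le tendsto_const_nhds h2 (fun _ => zero_le)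
      fun k => ?_
    have e : (ψ k : Space d → ℝ) - φ k = (fun x => ψ k x - f x) - fun x => φ k x - f x := by
      ext x; simp
    rw [e]
    exact eLpNorm_sub_le ((Lp.memLp _).aestronglyMeasurable.sub hf)
      ((hφ k).aestronglyMeasurable.sub hf) le_rfl
  have h3 := tendstoInMeasure_add h1 hu
  rw [zero_add] at h3
  refine h3.congr_left fun k => ?_
  filter_upwards [app_sub T (Lp.memLp (ψ k)) (hφ k)] with x hx
  rw [Pi.add_apply, hx, Pi.sub_apply, app_coe, sub_add_cancel]

theorem IsExtendedValue.tendstoInMeasure {f u : Space d → ℝ} (hu : IsExtendedValue T f u)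
    {φ : ℕ → Space d → ℝ} (hφ : ∀ k, MemLp (φ k) 2 volume)
    (h : Tendsto (fun k => eLpNorm (fun x => φ k x - f x) 1 volume) atTop (𝓝 0)) :
    TendstoInMeasure volume (fun k => app T (φ k)) atTop u := by
  have h1 := hu.2 (fun k => (hφ k).toLp (φ k)) (h.congr fun k => eLpNorm_congr_ae (by
    filter_upwards [(hφ k).coeFn_toLp] with x hx
    rw [hx]))
  exact h1.congr_left fun k => by rw [app_eq T (hφ k)]

theorem tendsto_eLpNorm_one_trunc_sub {f : Space d → ℝ} (hf : MemLp f 1 volume) :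
    Tendsto (fun k => eLpNorm (fun x => trunc f k x - f x) 1 volume) atTop (𝓝 0) :=
  tendsto_eLpNorm_trunc_sub one_ne_zero ENNReal.one_ne_top hf

theorem IsExtendedValue.tendstoInMeasure_trunc {f u : Space d → ℝ} (hf : MemLp f 1 volume)
    (hu : IsExtendedValue T f u) :
    TendstoInMeasure volume (fun k => app T (trunc f k)) atTop u :=
  hu.tendstoInMeasure (fun k => memLp_trunc hf.aestronglyMeasurable k 2)
    (tendsto_eLpNorm_one_trunc_sub hf)

theorem HasWeakType.exists_isExtendedValue (hT : HasWeakType T C) {f : Space d → ℝ}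
    (hf : MemLp f 1 volume) : ∃ u, IsExtendedValue T f u := by
  have h1 := tendsto_eLpNorm_one_trunc_sub hf
  have hpos : ∀ m : ℕ, (0 : ℝ≥0∞) < ENNReal.ofReal ((1 / 8 : ℝ) ^ m) := fun m => by
    rw [ENNReal.ofReal_pos]; positivity
  -- With L¹ errors below 8^(-k), the weak type bound at level 2^(-k) leaves sets of measure at most
  -- 2C·4^(-k), which is summable.
  choose ns hns using fun m : ℕ => (h1.eventually (gt_mem_nhds (hpos m))).exists
  set φ : ℕ → Space d → ℝ := fun m => trunc f (ns m) with hφ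
  have hφ2 : ∀ k, MemLp (φ k) 2 volume := fun k => memLp_trunc hf.aestronglyMeasurable _ 2
  have hφ1 : ∀ k, eLpNorm (fun x => φ k x - f x) 1 volume ≤ ENNReal.ofReal ((1 / 8 : ℝ) ^ k) :=
    fun k => (hns k).le
  have hlim : Tendsto (fun k => eLpNorm (fun x => φ k x - f x) 1 volume) atTop (𝓝 0) := by
    have h2 : Tendsto (fun k : ℕ => ENNReal.ofReal ((1 / 8 : ℝ) ^ k)) atTop (𝓝 0) := by
      have := ENNReal.tendsto_ofReal (tendsto_pow_atTop_nhds_zero_of_lt_one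
        (r := (1 / 8 : ℝ)) (by norm_num) (by norm_num))
      simpa using this
    exact tendsto_of_tendsto_of_tendsto_of_le_of_le tendsto_const_nhds h2 (fun _ => zero_le) hφ1
  have hsum : ∑' k, volume {x | (1 / 2 : ℝ) ^ k < |app T (φ (k + 1)) x - app T (φ k) x|} ≠ ⊤ := by
    have hb : ∀ k, volume {x | (1 / 2 : ℝ) ^ k < |app T (φ (k + 1)) x - app T (φ k) x|} ≤
        C * ENNReal.ofReal (2 * (1 / 4 : ℝ) ^ k) := by
      intro k
      have e1 : volume {x | (1 / 2 : ℝ) ^ k < |app T (φ (k + 1)) x - app T (φ k) x|} =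
          volume {x | (1 / 2 : ℝ) ^ k < |app T (φ (k + 1) - φ k) x|} := by
        refine measure_congr ?_
        filter_upwards [app_sub T (hφ2 (k + 1)) (hφ2 k)] with x hx
        change ((1 / 2 : ℝ) ^ k < |app T (φ (k + 1)) x - app T (φ k) x|) =
          ((1 / 2 : ℝ) ^ k < |app T (φ (k + 1) - φ k) x|)
        rw [hx, Pi.sub_apply]
      rw [e1]
      refine (hT.2.2 _ ((hφ2 (k + 1)).sub (hφ2 k)) _ (by positivity)).trans ?_
      gcongr
      rw [ENNReal.div_le_iff (by simp) ENNReal.ofReal_ne_top,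
        ← ENNReal.ofReal_mul (by positivity), ← eLpNorm_one_eq_lintegral_enorm]
      have e : φ (k + 1) - φ k = (fun x => φ (k + 1) x - f x) - fun x => φ k x - f x := by
        ext x; simp
      rw [e]
      refine (eLpNorm_sub_le ((hφ2 _).aestronglyMeasurable.sub hf.aestronglyMeasurable)
        ((hφ2 _).aestronglyMeasurable.sub hf.aestronglyMeasurable) le_rfl).trans
        ((add_le_add (hφ1 _) (hφ1 _)).trans ?_)
      rw [← ENNReal.ofReal_add (by positivity) (by positivity)]
      refine ENNReal.ofReal_le_ofReal ?_
      have : (1 / 4 : ℝ) ^ k * (1 / 2) ^ k = (1 / 8) ^ k := by rw [← mul_pow]; norm_num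
      rw [mul_assoc, this, pow_succ]
      have : (0 : ℝ) < (1 / 8) ^ k := by positivity
      linarith
    refine ne_top_of_le_ne_top ?_ (ENNReal.tsum_le_tsum hb)
    rw [ENNReal.tsum_mul_left]
    refine ENNReal.mul_ne_top hT.2.1 ?_
    rw [← ENNReal.ofReal_tsum_of_nonneg (fun k => by positivity)
      ((summable_geometric_of_lt_one (by norm_num) (by norm_num)).mul_left 2)]
    exact ENNReal.ofReal_ne_top
  obtain ⟨u, hu⟩ := exists_tendstoInMeasure (fun k => app T (φ k)) hsum
  exact ⟨u, hT.isExtendedValue hf.aestronglyMeasurable hφ2 hlim hu⟩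

theorem IsExtendedValue.ae_eq {f f' u u' : Space d → ℝ} (hf : MemLp f 1 volume)
    (h : f =ᵐ[volume] f') (hu : IsExtendedValue T f u) (hu' : IsExtendedValue T f' u') :
    u =ᵐ[volume] u' := by
  refine tendstoInMeasure_ae_unique (hu.tendstoInMeasure_trunc hf)
    (hu'.tendstoInMeasure (fun k => memLp_trunc hf.aestronglyMeasurable k 2)
      ((tendsto_eLpNorm_one_trunc_sub hf).congr fun k => eLpNorm_congr_ae ?_))
  filter_upwards [h] with x hx
  rw [hx]

theorem HasWeakType.isExtendedValue_add (hT : HasWeakType T C) {f g u v : Space d → ℝ}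
    (hf : MemLp f 1 volume) (hg : MemLp g 1 volume) (hu : IsExtendedValue T f u)
    (hv : IsExtendedValue T g v) : IsExtendedValue T (f + g) (u + v) := by
  have hf2 := fun k => memLp_trunc hf.aestronglyMeasurable k 2
  have hg2 := fun k => memLp_trunc hg.aestronglyMeasurable k 2
  refine hT.isExtendedValue (hf.add hg).aestronglyMeasurable
    (φ := fun k => trunc f k + trunc g k) (fun k => (hf2 k).add (hg2 k)) ?_
    ((tendstoInMeasure_add (hu.tendstoInMeasure_trunc hf)
      (hv.tendstoInMeasure_trunc hg)).congr_left fun k => (app_add T (hf2 k) (hg2 k)).symm)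
  have h := (tendsto_eLpNorm_one_trunc_sub hf).add (tendsto_eLpNorm_one_trunc_sub hg)
  rw [add_zero] at h
  refine tendsto_of_tendsto_of_tendsto_of_le_of_le tendsto_const_nhds h (fun _ => zero_le)
    fun k => ?_
  have e : (fun x => (trunc f k + trunc g k) x - (f + g) x) =
      (fun x => trunc f k x - f x) + fun x => trunc g k x - g x := by
    ext x; simp only [Pi.add_apply]; ring
  rw [e]
  exact eLpNorm_add_le ((hf2 k).aestronglyMeasurable.sub hf.aestronglyMeasurable)
    ((hg2 k).aestronglyMeasurable.sub hg.aestronglyMeasurable) le_rfl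

theorem HasWeakType.isExtendedValue_smul (hT : HasWeakType T C) (c : ℝ) {f u : Space d → ℝ}
    (hf : MemLp f 1 volume) (hu : IsExtendedValue T f u) : IsExtendedValue T (c • f) (c • u) := by
  have hf2 := fun k => memLp_trunc hf.aestronglyMeasurable k 2
  refine hT.isExtendedValue (hf.const_smul c).aestronglyMeasurable
    (φ := fun k => c • trunc f k) (fun k => (hf2 k).const_smul c) ?_
    ((tendstoInMeasure_smul c (hu.tendstoInMeasure_trunc hf)).congr_left
      fun k => (app_smul T c (hf2 k)).symm)
  have h := ENNReal.Tendsto.const_mul (a := ‖c‖ₑ) (tendsto_eLpNorm_one_trunc_sub hf)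
    (Or.inr enorm_ne_top)
  rw [mul_zero] at h
  refine h.congr fun k => ?_
  have e : (fun x => (c • trunc f k) x - (c • f) x) = c • fun x => trunc f k x - f x := by
    ext x; simp only [Pi.smul_apply, smul_eq_mul]; ring
  rw [e, eLpNorm_const_smul]

theorem HasWeakType.measure_le_of_isExtendedValue (hT : HasWeakType T C) {f u : Space d → ℝ}
    (hf : MemLp f 1 volume) (hu : IsExtendedValue T f u) {t : ℝ} (ht : 0 < t) :
    volume {x | t < |u x|} ≤ 2 * C * ((∫⁻ x, ‖f x‖ₑ) / ENNReal.ofReal t) := by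
  have h1 := measure_le_of_tendstoInMeasure (hu.tendstoInMeasure_trunc hf) (t := t / 2)
    (by positivity) (F := Set.univ) (M' := C * ((∫⁻ x, ‖f x‖ₑ) / ENNReal.ofReal (t / 2)))
    (fun k => by
      rw [Set.inter_univ]
      refine (hT.2.2 _ (memLp_trunc hf.aestronglyMeasurable k 2) (t / 2) (by positivity)).trans ?_
      gcongr with x
      rw [enorm_le_iff_norm_le]
      exact abs_trunc_le f k x) tendsto_const_nhds
  rw [Set.inter_univ, mul_div_cancel₀ t two_ne_zero] at h1
  refine h1.trans_eq ?_
  rw [ENNReal.ofReal_div_of_pos (by norm_num)]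
  have h6 : ENNReal.ofReal 2 = 2 := by norm_num
  rw [h6, div_eq_mul_inv, div_eq_mul_inv, div_eq_mul_inv,
    ENNReal.mul_inv (Or.inr (by simp)) (Or.inr (by simp)), inv_inv]
  ring

/-! ### Oscillation of images, from regularity of the kernel in its first variable. -/

/-- The oscillation of `T h` on a cube around which `h` vanishes. -/
theorem exists_ae_enorm_app_sub_le (hd : 0 < d) {K : Space d → Space d → ℝ}
    (hK : IsKernel T K) {s r : ℝ≥0∞} [s.HolderConjugate r] (P : Cube d)
    {h : Space d → ℝ} (hm : AEStronglyMeasurable h volume) {M : ℝ} (hM : ∀ x, |h x| ≤ M)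
    {F : Set (Space d)} (hF : IsCompact F) (h0 : ∀ x ∉ F, h x = 0)
    (hP : ∀ x ∈ (P.dyadic 1).toSet, h x = 0) {B : ℝ≥0∞}
    (hB : ∀ k, eLpNorm h r ((P.dyadic 1).dyadic (k + 1)).avgMeasure ≤ B) :
    ∃ G ∈ ae (volume : Measure (Space d)), ∀ x ∈ G, x ∈ P.toSet → ∀ x' ∈ G, x' ∈ P.toSet →
      ‖app T h x - app T h x'‖ₑ ≤ hormanderConst s K * B := by
  set Q := P.dyadic 1 with hQ
  have hUo : IsOpen {x : Space d | ∀ i, |x i - P.center i| < P.side} := by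
    have : {x : Space d | ∀ i, |x i - P.center i| < P.side} =
        ⋂ i, {x | |x i - P.center i| < P.side} := by ext x; simp
    rw [this]
    exact isOpen_iInter_of_finite fun i => isOpen_lt (by fun_prop) continuous_const
  -- The kernel formula holds only off a compact set carrying h. Removing the interior of 2P, where
  -- h vanishes, keeps that set compact and makes it disjoint from P.
  set F' := F ∩ {x : Space d | ∀ i, |x i - P.center i| < P.side}ᶜ with hF'
  have hF'c : IsCompact F' := hF.inter_right hUo.isClosed_compl
  have hPF : ∀ x ∈ P.toSet, x ∉ F' := fun x hx hc =>
    hc.2 fun i => (hx i).trans_lt (half_lt_self P.side_pos)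
  have h0' : ∀ x ∉ F', h x = 0 := by
    intro x hx
    by_cases hxF : x ∈ F
    · refine hP x fun i => ?_
      have : x ∈ {x : Space d | ∀ i, |x i - P.center i| < P.side} := by
        by_contra hc; exact hx ⟨hxF, hc⟩
      refine (this i).le.trans_eq ?_
      rw [hQ, Cube.dyadic_side]; ring
    · exact h0 x hxF
  have hKm : ∀ᵐ x ∂(volume : Measure (Space d)), AEStronglyMeasurable (K x) volume :=
    (aestronglyMeasurable_kernel hd hK.1).prodMk_left
  refine ⟨_, ((ae_app_eq_integral hK hm hM hF'c h0').and
    ((ae_integrableOn_kernel_of_notMem hK hF'c).and hKm)), fun x hx hxP x' hx' hxP' => ?_⟩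
  have key : ∀ x : Space d, IntegrableOn (K x) F' volume →
      Integrable (fun y => K x y * h y) volume := by
    intro x hx
    have : (fun y => K x y * h y) = fun y => h y * F'.indicator (K x) y := by
      ext y
      by_cases hy : y ∈ F'
      · simp [hy, mul_comm]
      · simp [hy, h0' y hy]
    rw [this]
    exact ((integrable_indicator_iff hF'c.measurableSet).2 hx).bdd_mul hm (Eventually.of_forall hM)
  rw [hx.1 (hPF x hxP), hx'.1 (hPF x' hxP'), ← integral_sub (key x (hx.2.1 (hPF x hxP)))
    (key x' (hx'.2.1 (hPF x' hxP')))]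
  refine (enorm_integral_le_lintegral_enorm _).trans ?_
  have e : ∫⁻ y, ‖K x y * h y - K x' y * h y‖ₑ =
      ∫⁻ y in Q.toSetᶜ, ‖K x y - K x' y‖ₑ * ‖h y‖ₑ := by
    rw [← lintegral_indicator Q.measurableSet_toSet.compl]
    refine lintegral_congr fun y => ?_
    rw [← sub_mul, enorm_mul]
    by_cases hy : y ∈ Q.toSet
    · simp [hy, hP y hy]
    · simp [hy]
  rw [e]
  refine (Q.setLIntegral_compl_mul_le (s := s) (r := r) (hx.2.2.sub hx'.2.2) hm hB).trans ?_
  gcongr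
  exact le_hormanderConst s K Q (by rwa [hQ, Cube.half_dyadic_one])
    (by rwa [hQ, Cube.half_dyadic_one])

/-- Truncations of h still vanish on 2P and have no larger averages, so the oscillation bound is
uniform along them and survives almost everywhere convergence of a subsequence. -/
theorem exists_ae_enorm_extendedValue_sub_le (hd : 0 < d) {K : Space d → Space d → ℝ}
    (hK : IsKernel T K) {s r : ℝ≥0∞} [s.HolderConjugate r] (P : Cube d)
    {h u : Space d → ℝ} (hh : MemLp h 1 volume) (hu : IsExtendedValue T h u)
    (hP : ∀ x ∈ (P.dyadic 1).toSet, h x = 0) {B : ℝ≥0∞}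
    (hB : ∀ k, eLpNorm h r ((P.dyadic 1).dyadic (k + 1)).avgMeasure ≤ B) :
    ∃ G ∈ ae (volume : Measure (Space d)), ∀ x ∈ G, x ∈ P.toSet → ∀ x' ∈ G, x' ∈ P.toSet →
      ‖u x - u x'‖ₑ ≤ hormanderConst s K * B := by
  have h1 := fun k => exists_ae_enorm_app_sub_le hd hK (s := s) (r := r) P
    (aestronglyMeasurable_trunc hh.aestronglyMeasurable k)
    (abs_trunc_le_nat h k) (isCompact_closedBall 0 (k : ℝ)) (trunc_eq_zero h k)
    (fun x hx => trunc_eq_zero_of_eq_zero k (hP x hx)) (B := B)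
    (fun j => (eLpNorm_mono fun x => abs_trunc_le h k x).trans (hB j))
  choose G hG hGb using h1
  obtain ⟨ns, -, hns⟩ := (hu.tendstoInMeasure_trunc hh).exists_seq_tendsto_ae
  refine ⟨_, (ae_all_iff.2 hG).and hns, fun x hx hxP x' hx' hxP' => ?_⟩
  refine le_of_tendsto ((hx.2.sub hx'.2).enorm) (Eventually.of_forall fun k => ?_)
  exact hGb (ns k) x (hx.1 _) hxP x' (hx'.1 _) hxP'

end ConvexBody

end

/-! ### Approximate Auerbach bases and duality for convex bodies. -/

noncomputable section

namespace ConvexBody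

/-- A seminorm attains its value at a point at some linear functional below it. -/
theorem exists_linear_le_seminorm {E : Type*} [AddCommGroup E] [Module ℝ E] (p : Seminorm ℝ E)
    {w : E} (hw : p w = 1) : ∃ α : E →ₗ[ℝ] ℝ, α w = 1 ∧ ∀ b, |α b| ≤ p b := by
  have hw0 : w ≠ 0 := by rintro rfl; simp at hw
  obtain ⟨α, h1, h2⟩ := exists_extension_of_le_sublinear (LinearPMap.mkSpanSingleton w (1 : ℝ) hw0) p
    (fun c hc x => by rw [map_smul_eq_mul, Real.norm_of_nonneg hc.le])
    (fun x y => map_add_le_add p x y) (by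
      rintro ⟨x, hx⟩
      obtain ⟨c, rfl⟩ := Submodule.mem_span_singleton.1 hx
      have e : LinearPMap.mkSpanSingleton w (1 : ℝ) hw0 ⟨c • w, hx⟩ = c • (1 : ℝ) :=
        LinearPMap.mkSpanSingleton'_apply _ _ _ _ _
      rw [e, map_smul_eq_mul, hw, smul_eq_mul, mul_one, mul_one]
      exact le_abs_self c)
  refine ⟨α, ?_, fun b => abs_le.2 ⟨?_, h2 b⟩⟩
  · have := h1 ⟨w, Submodule.mem_span_singleton_self w⟩
    rw [this]
    exact LinearPMap.mkSpanSingleton_apply ℝ ℝ hw0 (1 : ℝ)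
  · have := h2 (-b)
    rw [map_neg, map_neg_eq_map] at this
    linarith

/-- An approximate Auerbach basis of a seminorm on a finite-dimensional space. -/
theorem exists_approx_auerbach (m : ℕ) : ∀ {E : Type*} [AddCommGroup E] [Module ℝ E]
    [FiniteDimensional ℝ E] (p : Seminorm ℝ E), Module.finrank ℝ E ≤ m →
    ∃ (w : Fin m → E) (α : Fin m → E →ₗ[ℝ] ℝ), (∀ j, p (w j) ≤ 1) ∧
      (∀ j b, |α j b| ≤ 2 ^ m * p b) ∧ ∀ b, p (b - ∑ j, α j b • w j) = 0 := by
  induction m with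
  | zero =>
    intro E _ _ _ p h
    have := Module.finrank_zero_iff.1 (Nat.le_zero.1 h)
    exact ⟨fun _ => 0, fun _ => 0, fun j => j.elim0, fun j => j.elim0, fun b => by
      rw [Subsingleton.elim (b - _) 0, map_zero]⟩
  | succ m ih =>
    intro E _ _ _ p h
    by_cases hp : ∀ b, p b = 0
    · exact ⟨fun _ => 0, fun _ => 0, fun j => by simp, fun j b => by simp [hp b],
        fun b => hp _⟩
    push Not at hp
    obtain ⟨v, hv⟩ := hp
    have hv0 : 0 < p v := lt_of_le_of_ne (apply_nonneg p v) hv.symm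
    set w₀ := (p v)⁻¹ • v with hw₀
    have hw : p w₀ = 1 := by
      rw [hw₀, map_smul_eq_mul, Real.norm_of_nonneg (by positivity), inv_mul_cancel₀ hv]
    obtain ⟨α₀, h1, h2⟩ := exists_linear_le_seminorm p hw
    have hker : Module.finrank ℝ (LinearMap.ker α₀) ≤ m := by
      have e := LinearMap.finrank_range_add_finrank_ker α₀
      have : LinearMap.range α₀ = ⊤ := by
        rw [LinearMap.range_eq_top]
        intro c
        exact ⟨c • w₀, by rw [map_smul, h1, smul_eq_mul, mul_one]⟩
      rw [this, finrank_top, Module.finrank_self] at e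
      omega
    obtain ⟨w, α, hw1, hα, hb⟩ := ih (p.comp (LinearMap.ker α₀).subtype) hker
    -- As |α₀ b| ≤ p b and p w₀ = 1, this projection at most doubles p. Splitting off one vector per
    -- dimension produces the constant 2^m.
    let π : E →ₗ[ℝ] LinearMap.ker α₀ :=
      (LinearMap.id - α₀.smulRight w₀).codRestrict (LinearMap.ker α₀) fun b => by
        simp [LinearMap.mem_ker, h1]
    have hπ : ∀ b, (π b : E) = b - α₀ b • w₀ := fun b => rfl
    refine ⟨Fin.cons w₀ fun j => (w j : E), Fin.cons α₀ fun j => (α j).comp π, fun j => ?_,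
      fun j b => ?_, fun b => ?_⟩
    · refine Fin.cases ?_ (fun j => ?_) j
      · exact hw.le
      · exact hw1 j
    · refine Fin.cases ?_ (fun j => ?_) j
      · exact (h2 b).trans (le_mul_of_one_le_left (apply_nonneg p b) (one_le_pow₀ one_le_two))
      · refine (hα j (π b)).trans ?_
        have h3 : p (b - α₀ b • w₀) ≤ p b + |α₀ b| := by
          refine (map_sub_le_add p _ _).trans ?_
          rw [map_smul_eq_mul, hw, mul_one, Real.norm_eq_abs]
        have h4 : (p.comp (LinearMap.ker α₀).subtype) (π b) = p (b - α₀ b • w₀) := rfl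
        rw [h4, pow_succ]
        have h5 : (0 : ℝ) < 2 ^ m := by positivity
        nlinarith [h2 b]
    · have := hb (π b)
      rw [Fin.sum_univ_succ]
      simp only [Fin.cons_zero, Fin.cons_succ, LinearMap.comp_apply]
      rw [← sub_sub, ← hπ]
      simpa using this

variable {d n : ℕ}

theorem measurable_real_sign : Measurable Real.sign :=
  Measurable.ite measurableSet_Iio measurable_const
    (Measurable.ite measurableSet_Ioi measurable_const measurable_const)

theorem real_sign_mul_self (x : ℝ) : Real.sign x * x = |x| := by
  rcases lt_trichotomy x 0 with h | h | h
  · rw [Real.sign_of_neg h, abs_of_neg h, neg_one_mul]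
  · simp [h]
  · rw [Real.sign_of_pos h, abs_of_pos h, one_mul]

/-- The norming function in the duality of `L^r` and `L^{r'}`. -/
theorem exists_norming {α : Type*} [MeasurableSpace α] {μ : Measure α} {r s : ℝ}
    (hrs : r.HolderConjugate s) {F : α → ℝ} (hF : MemLp F (ENNReal.ofReal r) μ) :
    ∃ φ : α → ℝ, MemLp φ (ENNReal.ofReal s) μ ∧ eLpNorm φ (ENNReal.ofReal s) μ ≤ 1 ∧
      ∫ x, φ x * F x ∂μ = (eLpNorm F (ENNReal.ofReal r) μ).toReal := by
  have hr := hrs.pos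
  have hs := hrs.symm.pos
  have hr0 : ENNReal.ofReal r ≠ 0 := by simpa using hr
  have hs0 : ENNReal.ofReal s ≠ 0 := by simpa using hs
  have hrr : (ENNReal.ofReal r).toReal = r := ENNReal.toReal_ofReal hr.le
  have hss : (ENNReal.ofReal s).toReal = s := ENNReal.toReal_ofReal hs.le
  set N := eLpNorm F (ENNReal.ofReal r) μ with hN
  have hNtop : N ≠ ⊤ := hF.2.ne
  by_cases hN0 : N = 0
  · exact ⟨0, MemLp.zero, by simp, by simp [hN0]⟩
  have hNpos : 0 < N.toReal := ENNReal.toReal_pos hN0 hNtop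
  have hI : ∫⁻ x, ‖F x‖ₑ ^ r ∂μ = N ^ r := by
    rw [hN, eLpNorm_eq_lintegral_rpow_enorm_toReal hr0 ENNReal.ofReal_ne_top, hrr,
      ← ENNReal.rpow_mul, one_div_mul_cancel hr.ne', ENNReal.rpow_one]
  have hm := hF.aestronglyMeasurable
  -- The equality case of Hölder's inequality.
  set φ : α → ℝ := fun x => Real.sign (F x) * (|F x| ^ (r - 1) * (N.toReal ^ (r - 1))⁻¹) with hφ
  have hφm : AEStronglyMeasurable φ μ := by
    have h1 : AEMeasurable (fun x => Real.sign (F x)) μ :=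
      measurable_real_sign.comp_aemeasurable hm.aemeasurable
    exact (h1.mul (((hm.aemeasurable.norm).pow_const _).mul_const _)).aestronglyMeasurable
  have hφle : ∀ x, ‖φ x‖ₑ ^ s ≤ ‖F x‖ₑ ^ r * (N ^ r)⁻¹ := by
    intro x
    have e1 : ‖φ x‖ₑ ≤ ENNReal.ofReal (|F x| ^ (r - 1) * (N.toReal ^ (r - 1))⁻¹) := by
      rw [← ofReal_norm, hφ, norm_mul]
      refine ENNReal.ofReal_le_ofReal ?_
      rw [Real.norm_of_nonneg (r := |F x| ^ (r - 1) * _) (by positivity)]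
      refine mul_le_of_le_one_left (by positivity) ?_
      rcases Real.sign_apply_eq (F x) with h | h | h <;> rw [h] <;> simp
    refine (ENNReal.rpow_le_rpow e1 hs.le).trans_eq ?_
    rw [ENNReal.ofReal_mul (by positivity), ENNReal.mul_rpow_of_nonneg _ _ hs.le,
      ← ENNReal.ofReal_rpow_of_nonneg (abs_nonneg _) hrs.sub_one_pos.le,
      ENNReal.ofReal_inv_of_pos (by positivity),
      ← ENNReal.ofReal_rpow_of_pos hNpos, ENNReal.ofReal_toReal hNtop, ENNReal.inv_rpow,
      ← ENNReal.rpow_mul, ← ENNReal.rpow_mul, hrs.sub_one_mul_conj, ← Real.norm_eq_abs, ofReal_norm]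
  have hφ1 : eLpNorm φ (ENNReal.ofReal s) μ ≤ 1 := by
    rw [eLpNorm_eq_lintegral_rpow_enorm_toReal hs0 ENNReal.ofReal_ne_top, hss]
    refine ENNReal.rpow_le_one ?_ (by positivity)
    refine (lintegral_mono hφle).trans ?_
    rw [lintegral_mul_const'' _ (hm.enorm.pow_const r), hI]
    exact ENNReal.mul_inv_le_one _
  refine ⟨φ, ⟨hφm, hφ1.trans_lt ENNReal.one_lt_top⟩, hφ1, ?_⟩
  have e2 : ∀ x, φ x * F x = |F x| ^ r * (N.toReal ^ (r - 1))⁻¹ := by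
    intro x
    have e3 : Real.sign (F x) * F x = |F x| := real_sign_mul_self _
    have e4 : |F x| ^ (r - 1) * |F x| = |F x| ^ r := by
      rcases eq_or_ne (|F x|) 0 with h | h
      · rw [h, mul_zero, Real.zero_rpow hr.ne']
      · rw [← Real.rpow_add_one h, sub_add_cancel]
    rw [← e4, mul_right_comm, ← e3]
    simp only [e3]; ring
  simp_rw [e2]
  rw [integral_mul_const]
  have e5 : ∫ x, |F x| ^ r ∂μ = N.toReal ^ r := by
    simp_rw [← Real.norm_eq_abs]
    rw [integral_eq_lintegral_of_nonneg_ae (Eventually.of_forall fun x => by positivity)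
      ((hm.aemeasurable.norm.pow_const r).aestronglyMeasurable), ENNReal.toReal_rpow, ← hI]
    congr 1
    refine lintegral_congr fun x => ?_
    rw [← ENNReal.ofReal_rpow_of_nonneg (norm_nonneg _) hr.le, ofReal_norm]
  rw [e5, ← div_eq_mul_inv, ← Real.rpow_sub hNpos, sub_sub_cancel, Real.rpow_one]

theorem Cube.memLp_avgMeasure {F : Type*} [NormedAddCommGroup F] {f : Space d → F} {p : ℝ≥0∞}
    (hf : MemLp f p volume) (Q : Cube d) : MemLp f p Q.avgMeasure :=
  (hf.restrict _).smul_measure (ENNReal.inv_ne_top.2 Q.volume_toSet_ne_zero)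

theorem conjExponent_ofReal {r : ℝ} (hr : 1 < r) :
    (ENNReal.ofReal r).conjExponent = ENNReal.ofReal (r / (r - 1)) := by
  have : (ENNReal.ofReal r).HolderConjugate (ENNReal.ofReal (r / (r - 1))) :=
    (Real.HolderConjugate.conjExponent hr).ennrealOfReal
  exact ENNReal.HolderConjugate.conjExponent_eq

/-- The norm of ⟨f, b⟩ is attained on the body in direction b: a norming function for ⟨f, b⟩ defines
a point a of the body with ⟨a, b⟩ equal to that norm. -/
theorem eLpNorm_inner_le_bodyProd {r : ℝ} (hr : 1 < r) {f : Space d → Space n}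
    (hf : MemLp f (ENNReal.ofReal r) volume) (Q : Cube d) {B : Set (Space n)} {b : Space n}
    (hb : b ∈ B) :
    eLpNorm (fun x => inner ℝ (f x) b) (ENNReal.ofReal r) Q.avgMeasure ≤
      bodyProd (body (ENNReal.ofReal r) f Q) B := by
  have hfQ := Cube.memLp_avgMeasure hf Q
  have hFQ : MemLp (fun x => (inner ℝ (f x) b : ℝ)) (ENNReal.ofReal r) Q.avgMeasure :=
    hfQ.inner_const b
  obtain ⟨φ, h1, h2, h3⟩ := exists_norming (Real.HolderConjugate.conjExponent hr) hFQ
  rw [← ENNReal.ofReal_toReal hFQ.2.ne, ← h3]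
  set a := ∫ x, φ x • f x ∂Q.avgMeasure with ha
  have hab : a ∈ body (ENNReal.ofReal r) f Q := by
    refine ⟨φ, ?_, ?_, rfl⟩ <;> rw [conjExponent_ofReal hr]
    · exact h1
    · exact h2
  have e : ∫ x, φ x * inner ℝ (f x) b ∂Q.avgMeasure = inner ℝ a b := by
    have hint : Integrable (fun x => φ x • f x) Q.avgMeasure := by
      have := (Real.HolderConjugate.conjExponent hr).symm.ennrealOfReal
      exact memLp_one_iff_integrable.1 (MemLp.smul hfQ h1)
    rw [real_inner_comm, ha, ← integral_inner hint]
    refine integral_congr_ae (Eventually.of_forall fun x => ?_)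
    simp only [inner_smul_right, real_inner_comm b]
  rw [e]
  exact le_iSup₂_of_le a hab (le_iSup₂ (f := fun b _ => ENNReal.ofReal (inner ℝ a b)) b hb)

/-- If `a` lies in a multiple of the body of `f` then the average of `|⟨a, g⟩|` is controlled by
the product of bodies. -/
theorem setLIntegral_inner_le_bodyProd {r : ℝ} (hr : 1 < r) {f g : Space d → Space n}
    (hf : MemLp f (ENNReal.ofReal r) volume) (hg : MemLp g 1 volume) (Q : Cube d) {a : Space n}
    {c : ℝ≥0} (ha : ∀ b : Space n, ‖(inner ℝ a b : ℝ)‖ₑ ≤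
      c * eLpNorm (fun x => inner ℝ (f x) b) (ENNReal.ofReal r) Q.avgMeasure) :
    ∫⁻ x in Q.toSet, ‖(inner ℝ a (g x) : ℝ)‖ₑ ≤
      c * (bodyProd (body (ENNReal.ofReal r) f Q) (body 1 g Q) * volume Q.toSet) := by
  have hgQ := Cube.memLp_avgMeasure hg Q
  have hG : MemLp (fun x => (inner ℝ a (g x) : ℝ)) 1 Q.avgMeasure := hgQ.const_inner a
  have hφm : AEStronglyMeasurable (fun x => Real.sign (inner ℝ a (g x) : ℝ)) Q.avgMeasure :=
    (measurable_real_sign.comp_aemeasurable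
      hG.aestronglyMeasurable.aemeasurable).aestronglyMeasurable
  have hφ1 : ∀ x, ‖Real.sign (inner ℝ a (g x) : ℝ)‖ ≤ 1 := fun x => by
    rcases Real.sign_apply_eq (inner ℝ a (g x)) with h | h | h <;> rw [h] <;> simp
  have hφ : MemLp (fun x => Real.sign (inner ℝ a (g x) : ℝ)) ⊤ Q.avgMeasure :=
    memLp_top_of_bound hφm 1 (Eventually.of_forall hφ1)
  -- With this density, ⟨a, b⟩ is exactly the average of |⟨a, g⟩|.
  set b := ∫ x, Real.sign (inner ℝ a (g x) : ℝ) • g x ∂Q.avgMeasure with hb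
  have hc1 : (1 : ℝ≥0∞).conjExponent = ⊤ := by simp [ENNReal.conjExponent]
  have hbB : b ∈ body 1 g Q := by
    refine ⟨_, ?_, ?_, hb⟩ <;> rw [hc1]
    · exact hφ
    · refine (eLpNorm_le_of_ae_bound (C := 1) (Eventually.of_forall hφ1)).trans ?_
      simp
  have hint : Integrable (fun x => Real.sign (inner ℝ a (g x) : ℝ) • g x) Q.avgMeasure :=
    memLp_one_iff_integrable.1 (MemLp.smul hgQ hφ)
  have e : ∫⁻ x, ‖(inner ℝ a (g x) : ℝ)‖ₑ ∂Q.avgMeasure ≤ ‖(inner ℝ a b : ℝ)‖ₑ := by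
    have e1 : (inner ℝ a b : ℝ) = ∫ x, ‖(inner ℝ a (g x) : ℝ)‖ ∂Q.avgMeasure := by
      rw [hb, ← integral_inner hint]
      refine integral_congr_ae (Eventually.of_forall fun x => ?_)
      simp only [inner_smul_right, Real.norm_eq_abs, real_sign_mul_self]
    rw [e1, ← ofReal_integral_norm_eq_lintegral_enorm (memLp_one_iff_integrable.1 hG), ← ofReal_norm]
    exact ENNReal.ofReal_le_ofReal (Real.le_norm_self _)
  rw [Q.setLIntegral_eq, ← Cube.volume_toSet, mul_comm (volume Q.toSet), ← mul_assoc]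
  gcongr
  refine e.trans ((ha b).trans ?_)
  gcongr
  exact eLpNorm_inner_le_bodyProd hr hf Q hbB

end ConvexBody

end

/-! ### Triples of cubes, a covering estimate, and the linear extension of T to L¹. -/

noncomputable section

namespace ConvexBody

variable {d : ℕ}

namespace Cube

/-- `3 Q`. -/
def triple (Q : Cube d) : Cube d := Q.dilate 3 (by norm_num)

theorem triple_side (Q : Cube d) : Q.triple.side = 3 * Q.side := rfl

theorem triple_center (Q : Cube d) : Q.triple.center = Q.center := rfl

theorem toSet_subset_triple (Q : Cube d) : Q.toSet ⊆ Q.triple.toSet := fun x hx i => by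
  have := hx i
  have := Q.side_pos
  rw [triple_side, triple_center]
  linarith

theorem Inside.triple_subset {P Q : Cube d} (h : P.Inside Q) :
    P.triple.toSet ⊆ Q.triple.toSet :=
  (h.dilate (a := 3) (by norm_num)).toSet_subset

theorem volume_triple (Q : Cube d) :
    volume Q.triple.toSet = ENNReal.ofReal (3 ^ d) * volume Q.toSet := by
  rw [volume_toSet, volume_toSet, triple_side, mul_pow, ENNReal.ofReal_mul (by positivity)]

/-- Cubes on whose triples a function has a large average cover a small set. -/
theorem mul_volume_biUnion_le {S : Set (Cube d)} (hS : S.Countable) {R : ℝ}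
    (hR : ∀ P ∈ S, P.side ≤ R) {β : ℝ≥0∞} {F : Space d → ℝ≥0∞}
    (h : ∀ P ∈ S, β * volume P.toSet ≤ ∫⁻ x in P.triple.toSet, F x) :
    β * volume (⋃ P ∈ S, P.box) ≤ ENNReal.ofReal (11 ^ d) * ∫⁻ x, F x := by
  -- The chosen triples are disjoint, and every 3P meets a chosen 3P' with ℓ(P) ≤ 2ℓ(P'). A point of
  -- P is then within 2ℓ(P) + 3ℓ(P')/2 ≤ 11ℓ(P')/2 of the centre of P' in each coordinate, which
  -- explains 11.
  obtain ⟨u, huS, hu, hcov⟩ := Vitali.exists_disjoint_subfamily_covering_enlargement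
    (fun P : Cube d => P.triple.toSet) S Cube.side 2 one_lt_two (fun P _ => P.side_pos.le) R hR
    (fun P _ => ⟨P.center, P.toSet_subset_triple (P.box_subset_toSet P.center_mem_box)⟩)
  have huc : u.Countable := hS.mono huS
  have hsub : (⋃ P ∈ S, P.box) ⊆ ⋃ P ∈ u, (P.dilate 11 (by norm_num)).toSet := by
    refine Set.iUnion₂_subset fun P hP x hx => ?_
    obtain ⟨P', hP', ⟨y, hy, hy'⟩, hs⟩ := hcov P hP
    refine Set.mem_biUnion hP' fun i => ?_
    have h1 := abs_le.1 (P.box_subset_toSet hx i)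
    have h2 := abs_le.1 (hy i)
    have h3 := abs_le.1 (hy' i)
    rw [triple_side, triple_center] at h2 h3
    change |x i - P'.center i| ≤ 11 * P'.side / 2
    rw [abs_le]
    constructor <;> linarith
  calc β * volume (⋃ P ∈ S, P.box)
      ≤ β * ∑' P : u, volume (P.1.dilate 11 (by norm_num)).toSet := by
        gcongr
        exact (measure_mono hsub).trans (measure_biUnion_le volume huc _)
    _ = ENNReal.ofReal (11 ^ d) * ∑' P : u, β * volume P.1.toSet := by
        rw [← ENNReal.tsum_mul_left, ← ENNReal.tsum_mul_left]
        refine tsum_congr fun P => ?_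
        have : volume (P.1.dilate 11 (by norm_num)).toSet =
            ENNReal.ofReal (11 ^ d) * volume P.1.toSet := by
          rw [volume_toSet, volume_toSet, ← ENNReal.ofReal_mul (by positivity), ← mul_pow]; rfl
        rw [this]; ring
    _ ≤ ENNReal.ofReal (11 ^ d) * ∑' P : u, ∫⁻ x in P.1.triple.toSet, F x := by
        gcongr with P
        exact h P.1 (huS P.2)
    _ ≤ _ := by
        gcongr
        rw [← lintegral_biUnion huc (fun P _ => P.triple.measurableSet_toSet) hu]
        exact setLIntegral_le_lintegral _ _

/-- A dilate `2^(i+2) P` is contained in the triple of the ancestor of generation `i + 1`. -/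
theorem dyadic_subset_triple_descend (Q : Cube d) (x : Space d) {k i : ℕ} (hi : i ≤ k) :
    (((Q.descend x (k + 1)).dyadic 1).dyadic (i + 1)).toSet ⊆ (Q.descend x (k - i)).triple.toSet ∧
      volume (Q.descend x (k - i)).toSet ≤
        volume (((Q.descend x (k + 1)).dyadic 1).dyadic (i + 1)).toSet := by
  set P := Q.descend x (k + 1) with hP
  set D := Q.descend x (k - i) with hD
  have hin : P.Inside D := descend_inside Q x (by omega)
  have hs : D.side = 2 ^ (i + 1) * P.side := by
    rw [hD, hP, descend_side, descend_side]
    have : k + 1 = (k - i) + (i + 1) := by omega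
    rw [this, pow_add (2 : ℝ) (k - i)]
    field_simp
  have hPs := P.side_pos
  have hpow : (1 : ℝ) ≤ 2 ^ (i + 1) := one_le_pow₀ one_le_two
  constructor
  · intro y hy j
    have h1 := abs_le.1 (hy j)
    have h2 := abs_le.1 (hin.2 j)
    rw [dyadic_side, dyadic_side] at h1
    change (-(2 ^ (i + 1) * (2 ^ 1 * P.side) / 2) ≤ y j - P.center j ∧
      y j - P.center j ≤ 2 ^ (i + 1) * (2 ^ 1 * P.side) / 2) at h1
    rw [triple_side, triple_center, abs_le]
    rw [hs] at h2 ⊢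
    constructor <;> nlinarith
  · rw [volume_toSet, volume_toSet, dyadic_side, dyadic_side, hs]
    refine ENNReal.ofReal_le_ofReal (pow_le_pow_left₀ (by positivity) ?_ d)
    nlinarith

end Cube

theorem enorm_le_one_add_rpow (x : ℝ≥0∞) {r : ℝ} (hr : 1 ≤ r) : x ≤ 1 + x ^ r := by
  rcases le_total x 1 with h | h
  · exact h.trans le_self_add
  · exact (ENNReal.le_rpow_self_of_one_le h hr).trans le_add_self

open Classical in
/-- The extension of `T` to `L¹`. -/
def extOp (T : Op d) (f : Space d → ℝ) : Space d → ℝ :=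
  if h : ∃ u, IsExtendedValue T f u then h.choose else 0

variable {T : Op d} {C : ℝ≥0∞}

theorem HasWeakType.isExtendedValue_extOp (hT : HasWeakType T C) {f : Space d → ℝ}
    (hf : MemLp f 1 volume) : IsExtendedValue T f (extOp T f) := by
  have h := hT.exists_isExtendedValue hf
  rw [extOp, dif_pos h]
  exact h.choose_spec

theorem HasWeakType.extOp_congr (hT : HasWeakType T C) {f g : Space d → ℝ}
    (hf : MemLp f 1 volume) (h : f =ᵐ[volume] g) : extOp T f =ᵐ[volume] extOp T g :=
  (hT.isExtendedValue_extOp hf).ae_eq hf h (hT.isExtendedValue_extOp (hf.ae_eq h))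

theorem HasWeakType.extOp_add (hT : HasWeakType T C) {f g : Space d → ℝ}
    (hf : MemLp f 1 volume) (hg : MemLp g 1 volume) :
    extOp T (f + g) =ᵐ[volume] extOp T f + extOp T g :=
  (hT.isExtendedValue_extOp (hf.add hg)).ae_eq (hf.add hg) (EventuallyEq.refl _ _)
    (hT.isExtendedValue_add hf hg (hT.isExtendedValue_extOp hf) (hT.isExtendedValue_extOp hg))

theorem HasWeakType.extOp_smul (hT : HasWeakType T C) (c : ℝ) {f : Space d → ℝ}
    (hf : MemLp f 1 volume) : extOp T (c • f) =ᵐ[volume] c • extOp T f :=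
  (hT.isExtendedValue_extOp (hf.const_smul c)).ae_eq (hf.const_smul c) (EventuallyEq.refl _ _)
    (hT.isExtendedValue_smul c hf (hT.isExtendedValue_extOp hf))

theorem HasWeakType.extOp_zero (hT : HasWeakType T C) : extOp T 0 =ᵐ[volume] 0 := by
  have := hT.extOp_smul 0 (MemLp.zero (p := 1) (μ := (volume : Measure (Space d))) (ε := ℝ))
  simpa using this

theorem HasWeakType.extOp_sum (hT : HasWeakType T C) {ι : Type*} (s : Finset ι)
    {f : ι → Space d → ℝ} (hf : ∀ i ∈ s, MemLp (f i) 1 volume) :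
    extOp T (∑ i ∈ s, f i) =ᵐ[volume] ∑ i ∈ s, extOp T (f i) := by
  classical
  induction s using Finset.induction_on with
  | empty => simpa using hT.extOp_zero
  | insert i s his ih =>
    rw [Finset.sum_insert his, Finset.sum_insert his]
    refine (hT.extOp_add (hf i (by simp))
      (memLp_finsetSum' s fun j hj => hf j (by simp [hj]))).trans ?_
    exact (EventuallyEq.refl _ _).add (ih fun j hj => hf j (by simp [hj]))

theorem HasWeakType.extOp_sum_smul (hT : HasWeakType T C) {m : ℕ} {y : Fin m → Space d → ℝ}
    (hy : ∀ j, MemLp (y j) 1 volume) (c : Fin m → ℝ) :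
    ∀ᵐ x ∂volume, extOp T (∑ j, c j • y j) x = ∑ j, c j * extOp T (y j) x := by
  filter_upwards [hT.extOp_sum Finset.univ fun j _ => (hy j).const_smul (c j),
    ae_all_iff.2 fun j => hT.extOp_smul (c j) (hy j)] with x hx1 hx2
  rw [hx1, Finset.sum_apply]
  exact Finset.sum_congr rfl fun j _ => hx2 j

theorem HasWeakType.measure_extOp_le (hT : HasWeakType T C) {f : Space d → ℝ}
    (hf : MemLp f 1 volume) {t : ℝ} (ht : 0 < t) :
    volume {x | t < |extOp T f x|} ≤ ENNReal.ofReal ((2 * C).toReal / t) * ∫⁻ x, ‖f x‖ₑ := by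
  refine (hT.measure_le_of_isExtendedValue hf (hT.isExtendedValue_extOp hf) ht).trans_eq ?_
  have h2 : 2 * C ≠ ⊤ := ENNReal.mul_ne_top (by norm_num) hT.2.1
  rw [ENNReal.ofReal_div_of_pos ht, ENNReal.ofReal_toReal h2, div_eq_mul_inv, div_eq_mul_inv]
  ring

end ConvexBody

end

/-! ### The stopping step for scalar functions. -/

noncomputable section

namespace ConvexBody

variable {d : ℕ}

variable {T : Op d} {C : ℝ≥0∞}

theorem setLIntegral_enorm_le_add {r : ℝ} (hr : 1 ≤ r) (h : Space d → ℝ) (Q : Cube d) :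
    ∫⁻ x in Q.toSet, ‖h x‖ₑ ≤ volume Q.toSet + ∫⁻ x in Q.toSet, ‖h x‖ₑ ^ r := by
  calc ∫⁻ x in Q.toSet, ‖h x‖ₑ ≤ ∫⁻ x in Q.toSet, 1 + ‖h x‖ₑ ^ r :=
        lintegral_mono fun x => enorm_le_one_add_rpow _ hr
    _ = _ := by
        rw [lintegral_add_left measurable_const, setLIntegral_const, one_mul]

/-- The norm is at most B^(1/r), and this is at most B because B ≥ 1. -/
theorem eLpNorm_avgMeasure_le {r : ℝ} (hr : 1 ≤ r) {h : Space d → ℝ} {Q : Cube d} {B : ℝ}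
    (hB : 1 ≤ B) (hQ : ∫⁻ x in Q.toSet, ‖h x‖ₑ ^ r ≤ ENNReal.ofReal B * volume Q.toSet) :
    eLpNorm h (ENNReal.ofReal r) Q.avgMeasure ≤ ENNReal.ofReal B := by
  have hr0 : 0 < r := by linarith
  rw [eLpNorm_eq_lintegral_rpow_enorm_toReal (by simpa using hr0) ENNReal.ofReal_ne_top,
    ENNReal.toReal_ofReal hr0.le]
  rw [Q.setLIntegral_eq, ← Cube.volume_toSet, mul_comm,
    ENNReal.mul_le_mul_iff_left Q.volume_toSet_ne_zero Q.volume_toSet_ne_top] at hQ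
  refine (ENNReal.rpow_le_rpow hQ (by positivity)).trans ?_
  refine (ENNReal.rpow_le_rpow_of_exponent_le (z := 1) (by simpa using hB) ?_).trans_eq
    (ENNReal.rpow_one _)
  rw [div_le_one hr0]; exact hr

/-- The far part of `h` has a bounded image on a cube near which the image of `h` is not large. -/
theorem ae_abs_extOp_far_le (hd : 0 < d) {K : Space d → Space d → ℝ}
    (hK : IsKernel T K) {r : ℝ} (hr : 1 < r) {s : ℝ≥0∞} [s.HolderConjugate (ENNReal.ofReal r)]
    (hH : hormanderConst s K < ⊤) (hT : HasWeakType T C) {m : ℕ} (P : Cube d)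
    {h : Fin m → Space d → ℝ} (hh : ∀ j, MemLp (h j) 1 volume) {E : Set (Space d)} {A A' B : ℝ}
    (hB : 1 ≤ B) (hA' : 0 < A')
    (hA'' : m * ((2 * C).toReal / A' * (3 ^ d + 2 ^ d * B)) ≤ 1 / 4)
    (hE : volume (E ∩ P.toSet) ≤ ENNReal.ofReal (1 / 2) * volume P.toSet)
    (hA : ∀ x ∉ E, ∀ j, |extOp T (h j) x| ≤ A)
    (h3 : ∀ j, ∫⁻ x in P.triple.toSet, ‖h j x‖ₑ ^ r ≤ ENNReal.ofReal (2 ^ d * B) * volume P.toSet)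
    (hfar : ∀ j i, ∫⁻ x in ((P.dyadic 1).dyadic (i + 1)).toSet, ‖h j x‖ₑ ^ r ≤
      ENNReal.ofReal B * volume ((P.dyadic 1).dyadic (i + 1)).toSet) (j : Fin m) :
    ∀ᵐ x ∂volume, x ∈ P.toSet → |extOp T (P.triple.toSetᶜ.indicator (h j)) x| ≤
      A + A' + (hormanderConst s K).toReal * B := by
  have h3m := P.triple.measurableSet_toSet
  have hnear : ∀ j, MemLp (P.triple.toSet.indicator (h j)) 1 volume := fun j => (hh j).indicator h3m
  have hfarL : ∀ j, MemLp (P.triple.toSetᶜ.indicator (h j)) 1 volume := fun j =>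
    (hh j).indicator h3m.compl
  -- the image of the near part is rarely large
  have hweak : ∀ j, volume {x | A' < |extOp T (P.triple.toSet.indicator (h j)) x|} ≤
      ENNReal.ofReal ((2 * C).toReal / A' * (3 ^ d + 2 ^ d * B)) * volume P.toSet := by
    intro j
    refine (hT.measure_extOp_le (hnear j) hA').trans ?_
    rw [ENNReal.ofReal_mul (by positivity), mul_assoc]
    gcongr
    simp_rw [enorm_indicator_eq_indicator_enorm]
    rw [lintegral_indicator h3m]
    refine (setLIntegral_enorm_le_add hr.le (h j) P.triple).trans ?_
    rw [ENNReal.ofReal_add (by positivity) (by positivity), add_mul, ← Cube.volume_triple]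
    gcongr
    exact h3 j
  obtain ⟨G, hG, hGb⟩ := exists_ae_enorm_extendedValue_sub_le hd hK (s := s)
    (r := ENNReal.ofReal r) P (hfarL j) (hT.isExtendedValue_extOp (hfarL j)) (by
      intro x hx
      have hx3 : x ∈ P.triple.toSet := fun i => by
        refine (hx i).trans ?_
        rw [Cube.dyadic_side, Cube.triple_side]
        have := P.side_pos
        linarith
      exact Set.indicator_of_notMem (Set.notMem_compl_iff.2 hx3) _) (B := ENNReal.ofReal B) (fun i => by
      refine eLpNorm_avgMeasure_le hr.le hB ((lintegral_mono fun x => ?_).trans (hfar j i))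
      refine ENNReal.rpow_le_rpow ?_ (by linarith)
      rw [enorm_indicator_eq_indicator_enorm]
      exact Set.indicator_le_self _ _ x)
  have hsum : ∀ᵐ x ∂volume, extOp T (h j) x = extOp T (P.triple.toSet.indicator (h j)) x +
      extOp T (P.triple.toSetᶜ.indicator (h j)) x := by
    have := hT.extOp_add (hnear j) (hfarL j)
    rwa [Set.indicator_self_add_compl] at this
  -- a good point
  obtain ⟨x', hx'P, hx'E, hx'A, hx'G, hx's⟩ : ∃ x' ∈ P.toSet, x' ∉ E ∧
      |extOp T (P.triple.toSet.indicator (h j)) x'| ≤ A' ∧ x' ∈ G ∧ extOp T (h j) x' =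
      extOp T (P.triple.toSet.indicator (h j)) x' +
      extOp T (P.triple.toSetᶜ.indicator (h j)) x' := by
    by_contra hc
    push Not at hc
    -- Otherwise almost all of P would be covered by E, which takes at most half of it, and by the
    -- set where the near part has a large image, which takes at most a quarter.
    have hsub : P.toSet ≤ᵐ[volume] ((E ∩ P.toSet) ∪
        {x | A' < |extOp T (P.triple.toSet.indicator (h j)) x|} : Set (Space d)) := by
      filter_upwards [hG, hsum] with x hxG hxs hxP
      by_cases hxE : x ∈ E
      · exact Or.inl ⟨hxE, hxP⟩
      · refine Or.inr ?_
        by_contra hcc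
        exact hc x hxP hxE (not_lt.1 hcc) hxG hxs
    have hle := (measure_mono_ae hsub).trans ((measure_union_le _ _).trans
      (add_le_add hE (hweak j)))
    have hm1 : (1 : ℝ) ≤ m := by
      have : 0 < m := j.pos
      exact_mod_cast this
    have hx : (2 * C).toReal / A' * (3 ^ d + 2 ^ d * B) ≤ 1 / 4 :=
      (le_mul_of_one_le_left (by positivity) hm1).trans hA''
    rw [← add_mul, ← ENNReal.ofReal_add (by norm_num) (by positivity)] at hle
    nth_rewrite 1 [← one_mul (volume P.toSet)] at hle
    rw [ENNReal.mul_le_mul_iff_left P.volume_toSet_ne_zero P.volume_toSet_ne_top,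
      ENNReal.one_le_ofReal] at hle
    linarith
  have hfx' : |extOp T (P.triple.toSetᶜ.indicator (h j)) x'| ≤ A + A' := by
    have h1 := hA x' hx'E j
    rw [hx's] at h1
    have := abs_sub (extOp T (P.triple.toSet.indicator (h j)) x' +
      extOp T (P.triple.toSetᶜ.indicator (h j)) x') (extOp T (P.triple.toSet.indicator (h j)) x')
    rw [add_sub_cancel_left] at this
    linarith
  filter_upwards [hG] with x hxG hxP
  have h1 := hGb x hxG hxP x' hx'G hx'P
  have h2 : |extOp T (P.triple.toSetᶜ.indicator (h j)) x -
      extOp T (P.triple.toSetᶜ.indicator (h j)) x'| ≤ (hormanderConst s K).toReal * B := by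
    rw [← ENNReal.ofReal_toReal hH.ne, ← ENNReal.ofReal_mul ENNReal.toReal_nonneg,
      ← ofReal_norm, ENNReal.ofReal_le_ofReal_iff (by positivity)] at h1
    exact h1
  have := abs_sub_abs_le_abs_sub (extOp T (P.triple.toSetᶜ.indicator (h j)) x)
    (extOp T (P.triple.toSetᶜ.indicator (h j)) x')
  linarith

/-- The selection rule of the sparse domination. -/
def Selected {m : ℕ} (h : Fin m → Space d → ℝ) (r B : ℝ) (E : Set (Space d)) (P : Cube d) : Prop :=
  ENNReal.ofReal ((1 / 2) ^ (d + 1)) * volume P.toSet < volume (E ∩ P.toSet) ∨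
    ∃ j, ENNReal.ofReal B * volume P.toSet < ∫⁻ x in P.triple.toSet, ‖h j x‖ₑ ^ r

/-- Cubes selected for density cover at most 2^(d+1)|E| ≤ |Q|/4 by disjointness. Those selected for
a large average of one h_j cover at most 11^d·3^d|Q|/B by the covering estimate, and summing over
the m functions gives another |Q|/4. -/
theorem volume_biUnion_selected_le {m : ℕ} {h : Fin m → Space d → ℝ} {r B : ℝ} (hB : 0 < B)
    {E : Set (Space d)} (hEm : MeasurableSet E) {Q : Cube d}
    (hE : volume E ≤ ENNReal.ofReal ((1 / 2) ^ (d + 3)) * volume Q.toSet)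
    (hB' : m * (33 ^ d / B) ≤ 1 / 4)
    (hh : ∀ j, ∫⁻ x, ‖h j x‖ₑ ^ r ≤ ENNReal.ofReal (3 ^ d) * volume Q.toSet) :
    volume (⋃ P ∈ Q.stopped (Selected h r B E), P.box) ≤
      ENNReal.ofReal (1 / 2) * volume Q.toSet := by
  set S := Q.stopped (Selected h r B E) with hS
  have hSd : S.PairwiseDisjoint Cube.box := Q.stopped_pairwiseDisjoint _
  have hSc : S.Countable := Q.stopped_countable _
  set S₁ := {P ∈ S | ENNReal.ofReal ((1 / 2) ^ (d + 1)) * volume P.toSet < volume (E ∩ P.toSet)}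
    with hS₁
  set S₂ := fun j : Fin m => {P ∈ S | ENNReal.ofReal B * volume P.toSet <
    ∫⁻ x in P.triple.toSet, ‖h j x‖ₑ ^ r} with hS₂
  have hS₁S : S₁ ⊆ S := Set.sep_subset _ _
  have hS₂S : ∀ j, S₂ j ⊆ S := fun j => Set.sep_subset _ _
  have hcov : (⋃ P ∈ S, P.box) ⊆ (⋃ P ∈ S₁, P.box) ∪ ⋃ j, ⋃ P ∈ S₂ j, P.box := by
    refine Set.iUnion₂_subset fun P hP x hx => ?_
    rcases Cube.stopped_sel hP with h1 | ⟨j, h1⟩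
    · exact Or.inl (Set.mem_biUnion (show P ∈ S₁ from ⟨hP, h1⟩) hx)
    · exact Or.inr (Set.mem_iUnion.2 ⟨j, Set.mem_biUnion (show P ∈ S₂ j from ⟨hP, h1⟩) hx⟩)
  have b1 : volume (⋃ P ∈ S₁, P.box) ≤ ENNReal.ofReal (1 / 4) * volume Q.toSet := by
    have e : ∀ P : S₁, volume P.1.box ≤ ENNReal.ofReal (2 ^ (d + 1)) * volume (E ∩ P.1.box) := by
      intro P
      have h1 := P.2.2.le
      have h2 : volume (E ∩ P.1.box) = volume (E ∩ P.1.toSet) :=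
        measure_congr ((ae_eq_refl E).inter P.1.box_ae_eq_toSet)
      rw [h2, measure_congr P.1.box_ae_eq_toSet]
      calc volume P.1.toSet = ENNReal.ofReal (2 ^ (d + 1)) *
            (ENNReal.ofReal ((1 / 2) ^ (d + 1)) * volume P.1.toSet) := by
            rw [← mul_assoc, ← ENNReal.ofReal_mul (by positivity), ← mul_pow]; simp
        _ ≤ _ := by gcongr
    calc volume (⋃ P ∈ S₁, P.box) ≤ ∑' P : S₁, volume P.1.box :=
          measure_biUnion_le volume (hSc.mono hS₁S) _
      _ ≤ ∑' P : S₁, ENNReal.ofReal (2 ^ (d + 1)) * volume (E ∩ P.1.box) :=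
          ENNReal.tsum_le_tsum e
      _ = ENNReal.ofReal (2 ^ (d + 1)) * volume (⋃ P ∈ S₁, E ∩ P.box) := by
          rw [ENNReal.tsum_mul_left, measure_biUnion (hSc.mono hS₁S)
            ((hSd.subset hS₁S).mono fun P => Set.inter_subset_right)
            (fun P _ => hEm.inter P.measurableSet_box)]
      _ ≤ ENNReal.ofReal (2 ^ (d + 1)) * volume E := by
          gcongr
          exact Set.iUnion₂_subset fun P _ => Set.inter_subset_left
      _ ≤ ENNReal.ofReal (2 ^ (d + 1)) * (ENNReal.ofReal ((1 / 2) ^ (d + 3)) * volume Q.toSet) := by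
          gcongr
      _ = _ := by
          rw [← mul_assoc, ← ENNReal.ofReal_mul (by positivity)]
          congr 2
          rw [show d + 3 = d + 1 + 2 by ring, pow_add (1 / 2 : ℝ) (d + 1) 2, ← mul_assoc, ← mul_pow]
          norm_num
  have b2 : ∀ j, volume (⋃ P ∈ S₂ j, P.box) ≤ ENNReal.ofReal (33 ^ d / B) * volume Q.toSet := by
    intro j
    have h1 := Cube.mul_volume_biUnion_le (hSc.mono (hS₂S j)) (R := Q.side)
      (fun P hP => (Cube.stopped_inside (hS₂S j hP)).1) (β := ENNReal.ofReal B)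
      (F := fun x => ‖h j x‖ₑ ^ r) fun P hP => hP.2.le
    have h2 := h1.trans (mul_le_mul_right (hh j) _)
    rw [← mul_assoc, ← ENNReal.ofReal_mul (by positivity), ← mul_pow] at h2
    rw [ENNReal.ofReal_div_of_pos hB, ENNReal.mul_div_right_comm.symm,
      ENNReal.le_div_iff_mul_le (Or.inl (by simpa using hB)) (Or.inl ENNReal.ofReal_ne_top),
      mul_comm]
    refine h2.trans_eq ?_
    norm_num
  calc volume (⋃ P ∈ S, P.box)
      ≤ ENNReal.ofReal (1 / 4) * volume Q.toSet +
        ∑ _j : Fin m, ENNReal.ofReal (33 ^ d / B) * volume Q.toSet := by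
        refine (measure_mono hcov).trans ((measure_union_le _ _).trans (add_le_add b1 ?_))
        exact (measure_iUnion_fintype_le _ _).trans (Finset.sum_le_sum fun j _ => b2 j)
    _ = ENNReal.ofReal (1 / 4 + m * (33 ^ d / B)) * volume Q.toSet := by
        rw [Finset.sum_const, Finset.card_univ, Fintype.card_fin, nsmul_eq_mul,
          ENNReal.ofReal_add (by norm_num) (by positivity), ENNReal.ofReal_mul (by positivity),
          ENNReal.ofReal_natCast]
        ring
    _ ≤ _ := by
        gcongr
        linarith

/-- One step of the sparse domination, for scalar functions. -/
theorem exists_stopping (hd : 0 < d) {K : Space d → Space d → ℝ}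
    (hK : IsKernel T K) {r : ℝ} (hr : 1 < r) {s : ℝ≥0∞} [s.HolderConjugate (ENNReal.ofReal r)]
    (hH : hormanderConst s K < ⊤) (hT : HasWeakType T C) (m : ℕ) :
    ∃ A : ℝ≥0, ∀ (Q : Cube d) (h : Fin m → Space d → ℝ), (∀ j, MemLp (h j) 1 volume) →
      (∀ j, ∀ x ∉ Q.triple.toSet, h j x = 0) →
      (∀ j, ∫⁻ x, ‖h j x‖ₑ ^ r ≤ ENNReal.ofReal (3 ^ d) * volume Q.toSet) →
      ∃ S : Set (Cube d), S.PairwiseDisjoint Cube.box ∧ (∀ P ∈ S, P.Inside Q ∧ P.side < Q.side) ∧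
        volume (⋃ P ∈ S, P.box) ≤ ENNReal.ofReal (1 / 2) * volume Q.toSet ∧
        (∀ j, ∀ᵐ x ∂volume, x ∈ Q.box → (∀ P ∈ S, x ∉ P.box) → |extOp T (h j) x| ≤ A) ∧
        ∀ P ∈ S, ∀ j, ∀ᵐ x ∂volume, x ∈ P.box →
          |extOp T (P.triple.toSetᶜ.indicator (h j)) x| ≤ A := by
  set c := (2 * C).toReal with hc
  have hc0 : 0 ≤ c := ENNReal.toReal_nonneg
  -- The threshold B makes the cubes with large averages cover at most |Q|/4. The level A₁ makes the
  -- exceptional set at most 2^(-d-3)|Q|, and A₂ makes the image of a near part exceed it on at most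
  -- a quarter of a selected cube.
  set B : ℝ := 4 * (m + 1) * 33 ^ d with hBdef
  set A₁ : ℝ := (m + 1) * (c + 1) * (2 * 3 ^ d) * 2 ^ (d + 3) with hA₁def
  set A₂ : ℝ := 4 * (m + 1) * (c + 1) * (3 ^ d + 2 ^ d * B) with hA₂def
  set A : ℝ := A₁ + A₂ + (hormanderConst s K).toReal * B with hAdef
  have hB0 : 0 < B := by positivity
  have h33 : (3 : ℝ) ^ d ≤ 33 ^ d := pow_le_pow_left₀ (by norm_num) (by norm_num) d
  have hB3 : (3 : ℝ) ^ d ≤ B := by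
    refine h33.trans (le_mul_of_one_le_left (by positivity) ?_)
    have : (0 : ℝ) ≤ m := Nat.cast_nonneg m
    linarith
  have hB1 : 1 ≤ B := (one_le_pow₀ (by norm_num)).trans hB3
  have hA₁ : 0 < A₁ := by positivity
  have hA₂ : 0 < A₂ := by positivity
  have hHB : 0 ≤ (hormanderConst s K).toReal * B := by positivity
  have hA0 : 0 ≤ A := by positivity
  have hBm : (m : ℝ) * (33 ^ d / B) ≤ 1 / 4 := by
    rw [hBdef, mul_div_assoc', div_le_iff₀ (by positivity)]
    have : (0 : ℝ) < 33 ^ d := by positivity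
    nlinarith
  have hA₂m : m * (c / A₂ * (3 ^ d + 2 ^ d * B)) ≤ 1 / 4 := by
    set D : ℝ := 3 ^ d + 2 ^ d * B with hD
    have hD0 : 0 < D := by positivity
    have e : m * (c / A₂ * D) = (m * c) / (4 * (m + 1) * (c + 1)) := by
      rw [hA₂def]; field_simp
    rw [e, div_le_iff₀ (by positivity)]
    have : (0 : ℝ) ≤ m := Nat.cast_nonneg m
    nlinarith
  have hA₁m : m * (c / A₁ * (2 * 3 ^ d)) ≤ (1 / 2) ^ (d + 3) := by
    have e : m * (c / A₁ * (2 * 3 ^ d)) = (m * c) / ((m + 1) * (c + 1)) * (1 / 2) ^ (d + 3) := by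
      rw [hA₁def, one_div, inv_pow]; field_simp
    rw [e]
    refine mul_le_of_le_one_left (by positivity) ?_
    rw [div_le_one (by positivity)]
    have : (0 : ℝ) ≤ m := Nat.cast_nonneg m
    nlinarith
  refine ⟨⟨A, hA0⟩, fun Q h hh1 hh0 hhr => ?_⟩
  -- the exceptional set
  set E₀ : Set (Space d) := ⋃ j, {x | A₁ < |extOp T (h j) x|} with hE₀
  -- A measurable hull, because the extended values are only almost everywhere measurable.
  set E := toMeasurable volume E₀ with hEdef
  have hEm : MeasurableSet E := measurableSet_toMeasurable _ _
  have hh3 : ∀ j, ∫⁻ x, ‖h j x‖ₑ ≤ ENNReal.ofReal (2 * 3 ^ d) * volume Q.toSet := by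
    intro j
    have e1 : ∫⁻ x, ‖h j x‖ₑ = ∫⁻ x in Q.triple.toSet, ‖h j x‖ₑ := by
      rw [← lintegral_indicator Q.triple.measurableSet_toSet]
      refine lintegral_congr fun x => ?_
      by_cases hx : x ∈ Q.triple.toSet
      · simp [hx]
      · simp [hx, hh0 j x hx]
    rw [e1]
    refine (setLIntegral_enorm_le_add hr.le (h j) Q.triple).trans ?_
    rw [two_mul, ENNReal.ofReal_add (by positivity) (by positivity), add_mul, ← Cube.volume_triple]
    gcongr
    rw [Cube.volume_triple]
    exact (setLIntegral_le_lintegral _ _).trans (hhr j)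
  have hEvol : volume E ≤ ENNReal.ofReal ((1 / 2) ^ (d + 3)) * volume Q.toSet := by
    rw [hEdef, measure_toMeasurable]
    calc volume E₀ ≤ ∑ _j : Fin m, ENNReal.ofReal (c / A₁ * (2 * 3 ^ d)) * volume Q.toSet := by
          refine (measure_iUnion_fintype_le _ _).trans (Finset.sum_le_sum fun j _ => ?_)
          refine (hT.measure_extOp_le (hh1 j) hA₁).trans ?_
          rw [ENNReal.ofReal_mul (by positivity), mul_assoc]
          gcongr
          exact hh3 j
      _ = ENNReal.ofReal (m * (c / A₁ * (2 * 3 ^ d))) * volume Q.toSet := by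
          rw [Finset.sum_const, Finset.card_univ, Fintype.card_fin, nsmul_eq_mul,
            ENNReal.ofReal_mul (Nat.cast_nonneg m), ENNReal.ofReal_natCast, mul_assoc]
      _ ≤ _ := by gcongr
  have hEA : ∀ x ∉ E, ∀ j, |extOp T (h j) x| ≤ A₁ := fun x hx j => by
    by_contra hcc
    exact hx (subset_toMeasurable _ _ (Set.mem_iUnion.2 ⟨j, not_le.1 hcc⟩))
  -- The factor 2^(-d-3) in the bound for E and the inequality B ≥ 3^d guarantee that the top cube
  -- is not selected, so every selected cube has an unselected parent.
  have hQ : ¬ Selected h r B E Q := by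
    rintro (h1 | ⟨j, h1⟩)
    · refine (h1.trans_le ((measure_mono Set.inter_subset_left).trans hEvol)).not_ge ?_
      gcongr ?_ * _
      exact ENNReal.ofReal_le_ofReal
        (pow_le_pow_of_le_one (by norm_num) (by norm_num) (by omega))
    · refine (h1.trans_le ((setLIntegral_le_lintegral _ _).trans (hhr j))).not_ge ?_
      gcongr
  set S := Q.stopped (Selected h r B E) with hS
  refine ⟨S, Q.stopped_pairwiseDisjoint _, fun P hP => ⟨Cube.stopped_inside hP, ?_⟩,
    volume_biUnion_selected_le hB0 hEm hEvol hBm hhr, fun j => ?_, fun P hP j => ?_⟩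
  · obtain ⟨x, -, k, rfl, -⟩ := Cube.exists_of_mem_stopped hQ hP
    rw [Cube.descend_side]
    exact div_lt_self Q.side_pos (one_lt_pow₀ one_lt_two (by omega))
  -- A point never reached by stopping sees E with density at most 2^(-d-1) < 1 at every scale, so
  -- by differentiation of the indicator it is almost surely outside E.
  · have hEi : Integrable (E.indicator fun _ => (1 : ℝ)) volume := by
      refine (integrable_indicator_iff hEm).2 (integrableOn_const ?_)
      exact ne_top_of_le_ne_top
        (ENNReal.mul_ne_top ENNReal.ofReal_ne_top Q.volume_toSet_ne_top) hEvol
    filter_upwards [Cube.ae_abs_le_of_descend hEi ((1 / 2) ^ (d + 1)) (by positivity)]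
      with x hx hxQ hxS
    have h1 := hx Q hxQ fun k => by
      have h2 := Cube.not_sel_of_notMem_stopped hxQ hxS k
      rw [Selected, not_or, not_lt] at h2
      refine le_trans (le_of_eq ?_) h2.1
      simp_rw [enorm_indicator_eq_indicator_enorm]
      rw [lintegral_indicator hEm, Measure.restrict_restrict hEm, setLIntegral_const, enorm_one,
        one_mul]
    have hxE : x ∉ E := by
      intro hxE
      rw [Set.indicator_of_mem hxE, abs_one] at h1
      have : ((1 : ℝ) / 2) ^ (d + 1) < 1 := pow_lt_one₀ (by norm_num) (by norm_num) (by omega)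
      linarith
    refine (hEA x hxE j).trans ?_
    change A₁ ≤ A
    linarith
  · obtain ⟨x₀, -, k, hPk, hk⟩ := Cube.exists_of_mem_stopped hQ hP
    have hns : ∀ i ≤ k, volume (E ∩ (Q.descend x₀ i).toSet) ≤
        ENNReal.ofReal ((1 / 2) ^ (d + 1)) * volume (Q.descend x₀ i).toSet ∧
        ∀ j, ∫⁻ x in (Q.descend x₀ i).triple.toSet, ‖h j x‖ₑ ^ r ≤
          ENNReal.ofReal B * volume (Q.descend x₀ i).toSet := by
      intro i hi
      have h1 := hk i hi
      rw [Selected, not_or, not_lt, not_exists] at h1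
      exact ⟨h1.1, fun j => not_lt.1 (h1.2 j)⟩
    have hin : P.Inside (Q.descend x₀ k) := by
      rw [hPk]; exact Cube.descend_inside Q x₀ (Nat.le_succ k)
    have hvol : volume (Q.descend x₀ k).toSet = ENNReal.ofReal (2 ^ d) * volume P.toSet := by
      rw [hPk]; exact Cube.volume_descend Q x₀ k
    have hfar := ae_abs_extOp_far_le hd hK hr hH hT P hh1 (A := A₁) hB1 hA₂ hA₂m (E := E) ?_ hEA
      (fun j => ?_) (fun j i => ?_) j
    · filter_upwards [hfar] with x hx hxP
      exact hx (P.box_subset_toSet hxP)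
    -- Density 2^(-d-1) in the parent becomes at most 1/2 in P.
    · refine (measure_mono (Set.inter_subset_inter_right E hin.toSet_subset)).trans
        ((hns k le_rfl).1.trans_eq ?_)
      rw [hvol, ← mul_assoc, ← ENNReal.ofReal_mul (by positivity), pow_succ, mul_right_comm,
        ← mul_pow]
      norm_num
    · refine (lintegral_mono_set hin.triple_subset).trans (((hns k le_rfl).2 j).trans_eq ?_)
      rw [hvol, ← mul_assoc, ← ENNReal.ofReal_mul (by positivity), mul_comm B]
    -- For i ≤ k the dilate 2^(i+2)P lies in the triple of an unselected ancestor. For larger i it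
    -- is at least as large as Q in volume, and the global bound on h suffices.
    · rcases le_or_gt i k with hik | hik
      · obtain ⟨h1, h2⟩ := Cube.dyadic_subset_triple_descend Q x₀ hik
        rw [← hPk] at h1 h2
        refine (lintegral_mono_set h1).trans (((hns (k - i) (by omega)).2 j).trans ?_)
        gcongr
      · refine (setLIntegral_le_lintegral _ _).trans ((hhr j).trans ?_)
        gcongr ?_ * ?_
        · exact ENNReal.ofReal_le_ofReal hB3
        · rw [Cube.volume_toSet, Cube.volume_toSet, Cube.dyadic_side, Cube.dyadic_side, hPk,
            Cube.descend_side]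
          refine ENNReal.ofReal_le_ofReal (pow_le_pow_left₀ Q.side_pos.le ?_ d)
          have h2 : (2 : ℝ) ^ (k + 1) ≤ 2 ^ (i + 1) := pow_le_pow_right₀ one_le_two (by omega)
          have hQs := Q.side_pos
          have h3 : (2 : ℝ) ^ (i + 1) * (2 ^ 1 * (Q.side / 2 ^ (k + 1))) =
            (2 ^ (i + 1) * 2 / 2 ^ (k + 1)) * Q.side := by ring
          rw [h3]
          refine le_mul_of_one_le_left hQs.le ?_
          rw [one_le_div (by positivity)]
          have h4 : (0 : ℝ) < 2 ^ (i + 1) := by positivity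
          linarith

end ConvexBody

end

/-! ### A partition of space into starting cubes. -/

noncomputable section

namespace ConvexBody

variable {d : ℕ}

namespace Cube

/-- The cube of side `3^N ℓ(Q)` at position `e` in the grid around `Q`. -/
def grid (Q : Cube d) (N : ℕ) (e : Fin d → ℤ) : Cube d where
  center := WithLp.toLp 2 fun i => Q.center i + 3 ^ N * Q.side * e i
  side := 3 ^ N * Q.side
  side_pos := mul_pos (by positivity) Q.side_pos

theorem mem_box_grid {Q : Cube d} {N : ℕ} {e : Fin d → ℤ} {x : Space d} :
    x ∈ (Q.grid N e).box ↔ ∀ i, -(3 ^ N * Q.side / 2) ≤ x i - (Q.center i + 3 ^ N * Q.side * e i) ∧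
      x i - (Q.center i + 3 ^ N * Q.side * e i) < 3 ^ N * Q.side / 2 := Iff.rfl

theorem grid_index_unique {Q : Cube d} {N : ℕ} {e e' : Fin d → ℤ} {x : Space d}
    (h : x ∈ (Q.grid N e).box) (h' : x ∈ (Q.grid N e').box) : e = e' := by
  ext i
  have h1 := mem_box_grid.1 h i
  have h2 := mem_box_grid.1 h' i
  have hL : 0 < 3 ^ N * Q.side := mul_pos (by positivity) Q.side_pos
  set L := 3 ^ N * Q.side
  have a1 : L * ((e i : ℝ) - e' i) < L * 1 := by linarith
  have a2 : L * ((e' i : ℝ) - e i) < L * 1 := by linarith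
  have b1 := lt_of_mul_lt_mul_left a1 hL.le
  have b2 := lt_of_mul_lt_mul_left a2 hL.le
  have c1 : e i - e' i < 1 := by exact_mod_cast b1
  have c2 : e' i - e i < 1 := by exact_mod_cast b2
  omega

theorem grid_inside_succ {Q : Cube d} {N : ℕ} {e : Fin d → ℤ} (he : ∀ i, |e i| ≤ 1) :
    (Q.grid N e).Inside (Q.grid (N + 1) 0) := by
  have hL : 0 < 3 ^ N * Q.side := mul_pos (by positivity) Q.side_pos
  constructor
  · change 3 ^ N * Q.side ≤ 3 ^ (N + 1) * Q.side
    rw [pow_succ]; linarith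
  · intro i
    change |Q.center i + 3 ^ N * Q.side * e i - (Q.center i + 3 ^ (N + 1) * Q.side * ((0 : ℤ) : ℝ))|
      ≤ (3 ^ (N + 1) * Q.side - 3 ^ N * Q.side) / 2
    have h1 : |(e i : ℝ)| ≤ 1 := by exact_mod_cast he i
    have h2 : Q.center i + 3 ^ N * Q.side * e i - (Q.center i + 3 ^ (N + 1) * Q.side * ((0 : ℤ) : ℝ))
      = 3 ^ N * Q.side * e i := by push_cast; ring
    rw [h2, abs_mul, abs_of_pos hL, pow_succ]
    nlinarith

theorem grid_zero_inside (Q : Cube d) {N N' : ℕ} (h : N ≤ N') :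
    (Q.grid N 0).Inside (Q.grid N' 0) := by
  induction N', h using Nat.le_induction with
  | base => exact Inside.refl _
  | succ k _ ih => exact ih.trans (grid_inside_succ fun i => by simp)

theorem grid_zero_zero (Q : Cube d) : Q.grid 0 0 = Q := by
  ext
  · simp [grid]
  · simp [grid]

/-- A partition of space into cubes, all of whose triples contain `Q`. -/
def roots (Q : Cube d) : Set (Cube d) :=
  {R | R = Q.grid 0 0 ∨ ∃ N e, R = Q.grid N e ∧ e ≠ 0 ∧ ∀ i, |e i| ≤ 1}

/-- The cubes of level N are the neighbours of 3^N Q that fill 3^(N+1) Q around it. They lie in the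
central cube of every higher level, which the cubes of that level avoid. -/
theorem roots_pairwiseDisjoint (Q : Cube d) : Q.roots.PairwiseDisjoint box := by
  have key : ∀ {N N' : ℕ} {e e' : Fin d → ℤ} {x : Space d}, x ∈ (Q.grid N e).box →
      x ∈ (Q.grid N' e').box → N < N' → (∀ i, |e i| ≤ 1) → e' = 0 := by
    intro N N' e e' x hx hx' hN he
    exact grid_index_unique hx'
      (((grid_inside_succ he).trans (Q.grid_zero_inside hN)).box_subset hx)
  intro R hR R' hR' hne
  refine Set.disjoint_left.2 fun x hx hx' => hne ?_
  rcases hR with rfl | ⟨N, e, rfl, he0, he⟩ <;> rcases hR' with rfl | ⟨N', e', rfl, he0', he'⟩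
  · rfl
  · exact absurd (grid_index_unique hx' ((Q.grid_zero_inside (Nat.zero_le N')).box_subset hx)) he0'
  · exact absurd (grid_index_unique hx ((Q.grid_zero_inside (Nat.zero_le N)).box_subset hx')) he0
  · rcases lt_trichotomy N N' with h | rfl | h
    · exact absurd (key hx hx' h he) he0'
    · rw [grid_index_unique hx hx']
    · exact absurd (key hx' hx h he') he0

theorem exists_mem_roots (Q : Cube d) (x : Space d) : ∃ R ∈ Q.roots, x ∈ R.box := by
  classical
  have hex : ∃ N, x ∈ (Q.grid N 0).box := by
    have h1 : ∀ᶠ k : ℕ in atTop, ∀ i, |x i - Q.center i| * (3 / Q.side) ≤ 3 ^ k :=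
      eventually_all.2 fun i =>
        (tendsto_pow_atTop_atTop_of_one_lt (by norm_num)).eventually (eventually_ge_atTop _)
    obtain ⟨k, hk⟩ := h1.exists
    refine ⟨k, mem_box_grid.2 fun i => ?_⟩
    have h2 := hk i
    have hs := Q.side_pos
    rw [← mul_div_assoc, div_le_iff₀ hs] at h2
    have h4 : 0 < 3 ^ k * Q.side := mul_pos (by positivity) hs
    have h3 : |x i - Q.center i| < 3 ^ k * Q.side / 2 := by linarith
    rw [abs_lt] at h3
    simp only [Pi.zero_apply, Int.cast_zero, mul_zero, add_zero]
    exact ⟨h3.1.le, h3.2⟩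
  have hsp := Nat.find_spec hex
  rcases hN : Nat.find hex with _ | M
  · rw [hN] at hsp
    exact ⟨_, Or.inl rfl, hsp⟩
  · rw [hN] at hsp
    have hM : x ∉ (Q.grid M 0).box := Nat.find_min hex (by omega)
    set L := 3 ^ M * Q.side with hL
    have hLpos : 0 < L := mul_pos (by positivity) Q.side_pos
    -- With 3^(M+1) Q the first central cube containing x, trisecting it in each coordinate locates
    -- x; minimality excludes the middle cell.
    set e : Fin d → ℤ := fun i =>
      if x i - Q.center i < -(L / 2) then -1 else if x i - Q.center i < L / 2 then 0 else 1 with he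
    have hxe : x ∈ (Q.grid M e).box := by
      refine mem_box_grid.2 fun i => ?_
      have h1 := mem_box_grid.1 hsp i
      simp only [Pi.zero_apply, Int.cast_zero, mul_zero, add_zero, pow_succ] at h1
      have e3 : 3 ^ M * 3 * Q.side = 3 * L := by rw [hL]; ring
      rw [e3] at h1
      rw [← hL]
      simp only [he]
      split_ifs with c1 c2 <;> push_cast <;> constructor <;> linarith
    refine ⟨_, Or.inr ⟨M, e, rfl, fun h0 => hM (h0 ▸ hxe), fun i => ?_⟩, hxe⟩
    simp only [he]
    split_ifs <;> simp

/-- A root of level N is a neighbour of 3^N Q of the same size (or Q itself), so its triple covers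
that central cube. -/
theorem toSet_subset_triple_of_mem_roots {Q R : Cube d} (hR : R ∈ Q.roots) :
    Q.toSet ⊆ R.triple.toSet := by
  rcases hR with rfl | ⟨N, e, rfl, -, he⟩
  · rw [grid_zero_zero]; exact Q.toSet_subset_triple
  · intro x hx i
    have h1 : x ∈ (Q.grid N 0).toSet :=
      (Q.grid_zero_inside (Nat.zero_le N)).toSet_subset (by rwa [grid_zero_zero])
    have h2 : |x i - (Q.center i + 3 ^ N * Q.side * ((0 : ℤ) : ℝ))| ≤ 3 ^ N * Q.side / 2 := h1 i
    change |x i - (Q.center i + 3 ^ N * Q.side * e i)| ≤ 3 * (3 ^ N * Q.side) / 2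
    have h3 : |(e i : ℝ)| ≤ 1 := by exact_mod_cast he i
    have hL : 0 < 3 ^ N * Q.side := mul_pos (by positivity) Q.side_pos
    set L := 3 ^ N * Q.side
    rw [Int.cast_zero, mul_zero, add_zero, abs_le] at h2
    rw [abs_le] at h3 ⊢
    constructor <;> nlinarith

end Cube

/-! ### Coordinates adapted to a convex body, and the stopping step for vector functions. -/

variable {n : ℕ} {T : Op d} {C : ℝ≥0∞}

/-- The seminorm `w ↦ ‖⟨f, w⟩‖` in normalized `L^r` over a cube. -/
def directionalSeminorm {r : ℝ} (hr : 1 < r) {f : Space d → Space n}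
    (hf : MemLp f (ENNReal.ofReal r) volume) (Q : Cube d) : Seminorm ℝ (Space n) :=
  Seminorm.of (fun w => (eLpNorm (fun x => (inner ℝ (f x) w : ℝ)) (ENNReal.ofReal r)
      Q.avgMeasure).toReal)
    (fun v w => by
      have hfQ := Cube.memLp_avgMeasure hf Q
      rw [← ENNReal.toReal_add (hfQ.inner_const v).2.ne (hfQ.inner_const w).2.ne]
      refine ENNReal.toReal_mono (ENNReal.add_ne_top.2
        ⟨(hfQ.inner_const v).2.ne, (hfQ.inner_const w).2.ne⟩) ?_
      simp_rw [inner_add_right]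
      exact eLpNorm_add_le (hfQ.inner_const v).1 (hfQ.inner_const w).1 (by simpa using hr.le))
    (fun c w => by
      simp_rw [real_inner_smul_right]
      change (eLpNorm (c • fun x => (inner ℝ (f x) w : ℝ)) _ _).toReal = _
      rw [eLpNorm_const_smul, ENNReal.toReal_mul, toReal_enorm])

/-- The components of `f` on a cube, in coordinates adapted to its convex body. -/
theorem exists_adapted_coordinates {r : ℝ} (hr : 1 < r) {f : Space d → Space n}
    (hf : MemLp f (ENNReal.ofReal r) volume) (Q : Cube d) :
    ∃ a w : Fin n → Space n,
      (∀ j, eLpNorm (fun x => (inner ℝ (f x) (w j) : ℝ)) (ENNReal.ofReal r) Q.avgMeasure ≤ 1) ∧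
      (∀ j b, ‖(inner ℝ (a j) b : ℝ)‖ₑ ≤ ((2 ^ n : ℝ≥0) : ℝ≥0∞) *
        eLpNorm (fun x => inner ℝ (f x) b) (ENNReal.ofReal r) Q.avgMeasure) ∧
      ∀ i, ∀ᵐ x ∂volume, x ∈ Q.toSet → f x i = ∑ j, a j i * inner ℝ (f x) (w j) := by
  have hfQ := Cube.memLp_avgMeasure hf Q
  obtain ⟨w, α, h1, h2, h3⟩ := exists_approx_auerbach n (directionalSeminorm hr hf Q) (by simp)
  set a : Fin n → Space n := fun j =>
    (InnerProductSpace.toDual ℝ (Space n)).symm (LinearMap.toContinuousLinearMap (α j)) with ha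
  have haα : ∀ j b, (inner ℝ (a j) b : ℝ) = α j b := fun j b => by
    rw [ha, InnerProductSpace.toDual_symm_apply]; rfl
  have hp : ∀ b, ENNReal.ofReal (directionalSeminorm hr hf Q b) =
      eLpNorm (fun x => inner ℝ (f x) b) (ENNReal.ofReal r) Q.avgMeasure := fun b =>
    ENNReal.ofReal_toReal (hfQ.inner_const b).2.ne
  refine ⟨a, w, fun j => ?_, fun j b => ?_, fun i => ?_⟩
  · rw [← hp]
    simpa using h1 j
  · rw [← hp, haα, ← ofReal_norm]
    refine (ENNReal.ofReal_le_ofReal (h2 j b)).trans_eq ?_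
    rw [ENNReal.ofReal_mul (by positivity)]
    congr 1
    rw [ENNReal.ofReal_pow (by norm_num)]
    simp
  -- The remainder of the Auerbach expansion of e_i has seminorm zero, so f is orthogonal to it
  -- almost everywhere on Q; this is the expansion of the i-th component. Degenerate directions of f
  -- therefore need no separate treatment.
  · set b : Space n := EuclideanSpace.single i 1 with hb
    have h4 := h3 b
    have h5 := hp (b - ∑ j, α j b • w j)
    rw [h4, ENNReal.ofReal_zero, eq_comm, eLpNorm_eq_zero_iff (hfQ.inner_const _).1
      (by simp; linarith)] at h5
    have h6 : ∀ᵐ x ∂(volume.restrict Q.toSet),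
        (inner ℝ (f x) (b - ∑ j, α j b • w j) : ℝ) = 0 :=
      (Measure.ae_ennreal_smul_measure_iff
        (ENNReal.inv_ne_zero.2 Q.volume_toSet_ne_top)).1 h5
    filter_upwards [(ae_restrict_iff' Q.measurableSet_toSet).1 h6] with x hx hxQ
    have h7 := hx hxQ
    rw [inner_sub_right, inner_sum, sub_eq_zero] at h7
    have h8 : (inner ℝ (f x) b : ℝ) = f x i := by
      rw [hb, EuclideanSpace.inner_single_right]; simp
    rw [← h8, h7]
    refine Finset.sum_congr rfl fun j _ => ?_
    rw [real_inner_smul_right, ← haα, hb, EuclideanSpace.inner_single_right]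
    simp

/-- `T (f 1_{3Q})`, componentwise. -/
def localValue (T : Op d) (f : Space d → Space n) (Q : Cube d) (x : Space d) : Space n :=
  WithLp.toLp 2 fun i => extOp T (Q.triple.toSet.indicator fun y => f y i) x

theorem enorm_inner_le_of_coordinates {a : Fin n → Space n} {u v : Space n} {t : Fin n → ℝ}
    (hu : ∀ i, u i = ∑ j, a j i * t j) {A : ℝ≥0} (ht : ∀ j, |t j| ≤ A) :
    ‖(inner ℝ u v : ℝ)‖ₑ ≤ A * ∑ j, ‖(inner ℝ (a j) v : ℝ)‖ₑ := by
  have e : (inner ℝ u v : ℝ) = ∑ j, t j * inner ℝ (a j) v := by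
    simp only [PiLp.inner_apply, hu, Finset.mul_sum, RCLike.inner_apply, conj_trivial]
    rw [Finset.sum_comm]
    refine Finset.sum_congr rfl fun j _ => Finset.sum_congr rfl fun i _ => ?_
    ring
  rw [e, Finset.mul_sum]
  refine (enorm_sum_le _ _).trans (Finset.sum_le_sum fun j _ => ?_)
  rw [enorm_mul]
  gcongr
  rw [← ofReal_norm, Real.norm_eq_abs, ← ENNReal.ofReal_coe_nnreal]
  exact ENNReal.ofReal_le_ofReal (ht j)

theorem HasWeakType.extOp_linearCombination (hT : HasWeakType T C) {m : ℕ} {k : Space d → ℝ}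
    {y : Fin m → Space d → ℝ} (hy : ∀ j, MemLp (y j) 1 volume) (c : Fin m → ℝ)
    (h : ∀ᵐ x ∂volume, k x = ∑ j, c j * y j x) :
    ∀ᵐ x ∂volume, extOp T k x = ∑ j, c j * extOp T (y j) x := by
  have h1 : (∑ j, c j • y j) =ᵐ[volume] k := by
    filter_upwards [h] with x hx
    rw [hx, Finset.sum_apply]; rfl
  have h2 := hT.extOp_sum_smul hy c
  have h3 := hT.extOp_congr (memLp_finsetSum' _ fun j _ => (hy j).const_smul (c j)) h1
  filter_upwards [h2, h3] with x hx2 hx3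
  rw [← hx3, hx2]

/-- One step of the sparse domination, for vector valued functions. -/
theorem exists_vector_stopping (hd : 0 < d) {K : Space d → Space d → ℝ}
    (hK : IsKernel T K) {r : ℝ} (hr : 1 < r) {s : ℝ≥0∞} [s.HolderConjugate (ENNReal.ofReal r)]
    (hH : hormanderConst s K < ⊤) (hT : HasWeakType T C) (n : ℕ) :
    ∃ A : ℝ≥0, ∀ f : Space d → Space n, MemLp f (ENNReal.ofReal r) volume → MemLp f 1 volume →
      ∀ Q : Cube d, ∃ (S : Set (Cube d)) (a : Fin n → Space n),
        S.PairwiseDisjoint Cube.box ∧ (∀ P ∈ S, P.Inside Q ∧ P.side < Q.side) ∧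
        volume (⋃ P ∈ S, P.box) ≤ ENNReal.ofReal (1 / 2) * volume Q.toSet ∧
        (∀ j b, ‖(inner ℝ (a j) b : ℝ)‖ₑ ≤ ((2 ^ n : ℝ≥0) : ℝ≥0∞) *
          eLpNorm (fun x => inner ℝ (f x) b) (ENNReal.ofReal r) Q.triple.avgMeasure) ∧
        (∀ᵐ x ∂volume, x ∈ Q.box → (∀ P ∈ S, x ∉ P.box) → ∀ v,
          ‖(inner ℝ (localValue T f Q x) v : ℝ)‖ₑ ≤ A * ∑ j, ‖(inner ℝ (a j) v : ℝ)‖ₑ) ∧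
        ∀ P ∈ S, ∀ᵐ x ∂volume, x ∈ P.box → ∀ v,
          ‖(inner ℝ (localValue T f Q x - localValue T f P x) v : ℝ)‖ₑ ≤
            A * ∑ j, ‖(inner ℝ (a j) v : ℝ)‖ₑ := by
  obtain ⟨A, hA⟩ := exists_stopping hd hK hr hH hT n
  refine ⟨A, fun f hf hf1 Q => ?_⟩
  obtain ⟨a, w, hw, ha, hfa⟩ := exists_adapted_coordinates hr hf Q.triple
  have h3m := fun R : Cube d => R.triple.measurableSet_toSet
  set h : Fin n → Space d → ℝ := fun j => Q.triple.toSet.indicator fun x => inner ℝ (f x) (w j)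
    with hh
  have hh1 : ∀ j, MemLp (h j) 1 volume := fun j => (hf1.inner_const (w j)).indicator (h3m Q)
  have hr0 : 0 < r := by linarith
  have hhr : ∀ j, ∫⁻ x, ‖h j x‖ₑ ^ r ≤ ENNReal.ofReal (3 ^ d) * volume Q.toSet := by
    intro j
    have e1 : ∫⁻ x, ‖h j x‖ₑ ^ r =
        ∫⁻ x in Q.triple.toSet, ‖(inner ℝ (f x) (w j) : ℝ)‖ₑ ^ r := by
      rw [← lintegral_indicator (h3m Q)]
      refine lintegral_congr fun x => ?_
      by_cases hx : x ∈ Q.triple.toSet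
      · simp [hh, hx]
      · simp [hh, hx, hr0]
    have e2 := hw j
    rw [eLpNorm_eq_lintegral_rpow_enorm_toReal (by simpa using hr0) ENNReal.ofReal_ne_top,
      ENNReal.toReal_ofReal hr0.le] at e2
    have e3 : ∫⁻ x, ‖(inner ℝ (f x) (w j) : ℝ)‖ₑ ^ r ∂Q.triple.avgMeasure ≤ 1 := by
      by_contra hc
      exact absurd e2 (not_le.2 (ENNReal.one_lt_rpow (not_le.1 hc) (by positivity)))
    rw [e1, Cube.setLIntegral_eq, ← Cube.volume_toSet, Cube.volume_triple]
    exact mul_le_of_le_one_right' e3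
  obtain ⟨S, hS1, hS2, hS3, hS4, hS5⟩ := hA Q h hh1
    (fun j x hx => Set.indicator_of_notMem hx _) hhr
  have hfi : ∀ i, MemLp (fun x => f x i) 1 volume := fun i => by
    have : MemLp (fun x => (inner ℝ (f x) (EuclideanSpace.single i (1 : ℝ)) : ℝ)) 1 volume :=
      hf1.inner_const _
    refine this.ae_eq (Eventually.of_forall fun x => ?_)
    simp only [EuclideanSpace.inner_single_right]
    simp
  have hloc : ∀ i (R : Cube d), MemLp (R.triple.toSet.indicator fun x => f x i) 1 volume :=
    fun i R => (hfi i).indicator (h3m R)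
  have hQcoord : ∀ i, ∀ᵐ x ∂volume,
      (Q.triple.toSet.indicator fun x => f x i) x = ∑ j, a j i * h j x := by
    intro i
    filter_upwards [hfa i] with x hx
    by_cases hxQ : x ∈ Q.triple.toSet
    · simp only [hh, Set.indicator_of_mem hxQ, hx hxQ]
    · simp only [hh, Set.indicator_of_notMem hxQ, mul_zero, Finset.sum_const_zero]
  refine ⟨S, a, hS1, hS2, hS3, ha, ?_, fun P hP => ?_⟩
  · filter_upwards [ae_all_iff.2 fun i => hT.extOp_linearCombination hh1 (fun j => a j i)
      (hQcoord i), ae_all_iff.2 hS4] with x hx1 hx2 hxQ hxS v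
    exact enorm_inner_le_of_coordinates (t := fun j => extOp T (h j) x) hx1
      fun j => hx2 j hxQ hxS
  · have hPQ := (hS2 P hP).1.triple_subset
    -- The difference of local values is the image of f on 3Q minus 3P. It expands in the vectors
    -- a_j of Q, so no coordinates for P enter this step.
    have hdiff : ∀ i, ∀ᵐ x ∂volume, ((Q.triple.toSet.indicator fun x => f x i) +
        (-1 : ℝ) • P.triple.toSet.indicator fun x => f x i) x =
        ∑ j, a j i * P.triple.toSetᶜ.indicator (h j) x := by
      intro i
      filter_upwards [hQcoord i] with x hx
      rw [Pi.add_apply, Pi.smul_apply]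
      by_cases hxP : x ∈ P.triple.toSet
      · have : x ∉ P.triple.toSetᶜ := Set.notMem_compl_iff.2 hxP
        simp only [Set.indicator_of_mem hxP, Set.indicator_of_mem (hPQ hxP),
          Set.indicator_of_notMem this, mul_zero, Finset.sum_const_zero, smul_eq_mul]
        ring
      · have : x ∈ P.triple.toSetᶜ := hxP
        simp only [Set.indicator_of_notMem hxP, Set.indicator_of_mem this, smul_zero, add_zero]
        exact hx
    filter_upwards [ae_all_iff.2 fun i => hT.extOp_linearCombination
      (fun j => (hh1 j).indicator (h3m P).compl) (fun j => a j i) (hdiff i),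
      ae_all_iff.2 (hS5 P hP),
      ae_all_iff.2 fun i => hT.extOp_add (hloc i Q) ((hloc i P).const_smul (-1 : ℝ)),
      ae_all_iff.2 fun i => hT.extOp_smul (-1 : ℝ) (hloc i P)] with x hx1 hx2 hx3 hx4 hxP v
    refine enorm_inner_le_of_coordinates
      (t := fun j => extOp T (P.triple.toSetᶜ.indicator (h j)) x) (fun i => ?_)
      fun j => hx2 j hxP
    rw [← hx1 i, hx3 i, Pi.add_apply, hx4 i]
    simp [localValue, sub_eq_add_neg]

end ConvexBody

end

/-! ### Iteration of a stopping rule: telescoping and sparseness. -/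

noncomputable section

namespace ConvexBody

variable {d : ℕ}

namespace Cube

/-- The `k`-th generation of descendants of a family of cubes. -/
def generation (ch : Cube d → Set (Cube d)) (R : Set (Cube d)) : ℕ → Set (Cube d)
  | 0 => R
  | k + 1 => ⋃ Q ∈ generation ch R k, ch Q

/-- The points covered by a generation. -/
def shadow (ch : Cube d → Set (Cube d)) (R : Set (Cube d)) (k : ℕ) : Set (Space d) :=
  ⋃ Q ∈ generation ch R k, Q.box

/-- All descendants of a family of cubes. -/
def descendants (ch : Cube d → Set (Cube d)) (R : Set (Cube d)) : Set (Cube d) :=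
  ⋃ k, generation ch R k

/-- The part of a cube outside its children. -/
def core (ch : Cube d → Set (Cube d)) (Q : Cube d) : Set (Space d) :=
  Q.box \ ⋃ P ∈ ch Q, P.box

/-- A choice, in each cube, of disjoint smaller cubes that cover at most half of it. -/
structure IsStoppingRule (ch : Cube d → Set (Cube d)) : Prop where
  disjoint : ∀ Q, (ch Q).PairwiseDisjoint box
  inside : ∀ Q, ∀ P ∈ ch Q, P.Inside Q ∧ P.side < Q.side
  volume_le : ∀ Q, volume (⋃ P ∈ ch Q, P.box) ≤ ENNReal.ofReal (1 / 2) * volume Q.toSet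

namespace IsStoppingRule

variable {ch : Cube d → Set (Cube d)} {R : Set (Cube d)}

theorem generation_pairwiseDisjoint (h : IsStoppingRule ch) (hR : R.PairwiseDisjoint box) (k : ℕ) :
    (generation ch R k).PairwiseDisjoint box := by
  induction k with
  | zero => exact hR
  | succ k ih =>
    intro P hP P' hP' hne
    simp only [generation, Set.mem_iUnion] at hP hP'
    obtain ⟨Q, hQ, hPQ⟩ := hP
    obtain ⟨Q', hQ', hPQ'⟩ := hP'
    by_cases hQQ : Q = Q'
    · subst hQQ
      exact h.disjoint Q hPQ hPQ' hne
    · exact (ih hQ hQ' hQQ).mono (h.inside Q P hPQ).1.box_subset (h.inside Q' P' hPQ').1.box_subset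

theorem countable_descendants (h : IsStoppingRule ch) (hR : R.PairwiseDisjoint box) :
    (descendants ch R).Countable :=
  Set.countable_iUnion fun k => countable_of_pairwiseDisjoint (h.generation_pairwiseDisjoint hR k)

theorem shadow_antitone (h : IsStoppingRule ch) : Antitone (shadow ch R) := by
  refine antitone_nat_of_succ_le fun k x hx => ?_
  simp only [shadow, generation, Set.mem_iUnion] at hx ⊢
  obtain ⟨P, ⟨Q, hQ, hP⟩, hx⟩ := hx
  exact ⟨Q, hQ, (h.inside Q P hP).1.box_subset hx⟩

theorem exists_child_of_mem_shadow (h : IsStoppingRule ch) (hR : R.PairwiseDisjoint box) {k : ℕ}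
    {Q : Cube d} (hQ : Q ∈ generation ch R k) {x : Space d} (hx : x ∈ Q.box)
    (hxs : x ∈ shadow ch R (k + 1)) : ∃ P ∈ ch Q, x ∈ P.box := by
  simp only [shadow, generation, Set.mem_iUnion] at hxs
  obtain ⟨P, ⟨Q', hQ', hP⟩, hxP⟩ := hxs
  have : Q' = Q := (h.generation_pairwiseDisjoint hR k).elim_set hQ' hQ x
    ((h.inside Q' P hP).1.box_subset hxP) hx
  exact ⟨P, this ▸ hP, hxP⟩

theorem mem_generation_succ {k : ℕ} {P Q : Cube d} (hQ : Q ∈ generation ch R k) (hP : P ∈ ch Q) :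
    P ∈ generation ch R (k + 1) :=
  Set.mem_iUnion₂.2 ⟨Q, hQ, hP⟩

/-- Each generation covers at most half of the one before. -/
theorem volume_box_inter_shadow_le (h : IsStoppingRule ch) (hR : R.PairwiseDisjoint box) (k : ℕ) :
    ∀ {m : ℕ} {Q : Cube d}, Q ∈ generation ch R m →
      volume (Q.box ∩ shadow ch R (m + k)) ≤ ENNReal.ofReal (1 / 2) ^ k * volume Q.toSet := by
  induction k with
  | zero =>
    intro m Q _
    rw [pow_zero, one_mul]
    exact measure_mono (Set.inter_subset_left.trans Q.box_subset_toSet)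
  | succ k ih =>
    intro m Q hQ
    have hcount : (ch Q).Countable := countable_of_pairwiseDisjoint (h.disjoint Q)
    have hsub : Q.box ∩ shadow ch R (m + (k + 1)) ⊆
        ⋃ P ∈ ch Q, P.box ∩ shadow ch R (m + 1 + k) := by
      rintro x ⟨hxQ, hx⟩
      have e : m + (k + 1) = m + 1 + k := by ring
      rw [e] at hx
      obtain ⟨P, hP, hxP⟩ := h.exists_child_of_mem_shadow hR hQ hxQ
        (h.shadow_antitone (Nat.le_add_right _ _) hx)
      exact Set.mem_iUnion₂.2 ⟨P, hP, hxP, hx⟩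
    calc volume (Q.box ∩ shadow ch R (m + (k + 1)))
        ≤ ∑' P : ch Q, volume (P.1.box ∩ shadow ch R (m + 1 + k)) :=
          (measure_mono hsub).trans (measure_biUnion_le _ hcount _)
      _ ≤ ∑' P : ch Q, ENNReal.ofReal (1 / 2) ^ k * volume P.1.box := by
          refine ENNReal.tsum_le_tsum fun P => ?_
          rw [measure_congr P.1.box_ae_eq_toSet]
          exact ih (mem_generation_succ hQ P.2)
      _ = ENNReal.ofReal (1 / 2) ^ k * volume (⋃ P ∈ ch Q, P.box) := by
          rw [ENNReal.tsum_mul_left,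
            measure_biUnion hcount (h.disjoint Q) fun P _ => P.measurableSet_box]
      _ ≤ ENNReal.ofReal (1 / 2) ^ k * (ENNReal.ofReal (1 / 2) * volume Q.toSet) := by
          gcongr; exact h.volume_le Q
      _ = _ := by rw [pow_succ, mul_assoc]

/-- Geometric decay of the shadows: almost every point belongs to finitely many generations, so
telescoping terminates and no limiting remainder arises. -/
theorem ae_exists_notMem_shadow (h : IsStoppingRule ch) (hR : R.PairwiseDisjoint box) :
    ∀ᵐ x ∂volume, ∀ Q ∈ R, x ∈ Q.box → ∃ k, x ∉ shadow ch R k := by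
  refine (ae_ball_iff (countable_of_pairwiseDisjoint hR)).2 fun Q hQ => ?_
  rw [ae_iff]
  have hle : ∀ k, volume {x | ¬(x ∈ Q.box → ∃ k, x ∉ shadow ch R k)} ≤
      ENNReal.ofReal (1 / 2) ^ k * volume Q.toSet := fun k => by
    refine (measure_mono fun x hx => ?_).trans
      (h.volume_box_inter_shadow_le hR k (m := 0) hQ)
    simp only [Set.mem_ofPred_eq, not_forall, not_exists, not_not] at hx
    rw [zero_add]
    exact ⟨hx.1, hx.2 k⟩
  have hlim : Tendsto (fun k => ENNReal.ofReal (1 / 2) ^ k * volume Q.toSet) atTop (𝓝 0) := by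
    have h1 := ENNReal.tendsto_pow_atTop_nhds_zero_of_lt_one
      (r := ENNReal.ofReal (1 / 2)) (by rw [ENNReal.ofReal_lt_one]; norm_num)
    simpa using ENNReal.Tendsto.mul_const h1 (Or.inr Q.volume_toSet_ne_top)
  exact le_antisymm (ge_of_tendsto' hlim hle) bot_le

theorem measurableSet_core (h : IsStoppingRule ch) (Q : Cube d) : MeasurableSet (core ch Q) :=
  Q.measurableSet_box.diff (MeasurableSet.biUnion (countable_of_pairwiseDisjoint (h.disjoint Q))
    fun P _ => P.measurableSet_box)

theorem volume_le_core (h : IsStoppingRule ch) (Q : Cube d) :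
    ENNReal.ofReal (1 / 2) * volume Q.toSet ≤ volume (core ch Q) := by
  have h1 : volume Q.toSet ≤ volume (core ch Q) + ENNReal.ofReal (1 / 2) * volume Q.toSet := by
    rw [← measure_congr Q.box_ae_eq_toSet]
    have hsub : Q.box ⊆ core ch Q ∪ ⋃ P ∈ ch Q, P.box := by
      rw [core, Set.sdiff_union_self]
      exact Set.subset_union_left
    refine (measure_mono hsub).trans ((measure_union_le _ _).trans ?_)
    rw [measure_congr Q.box_ae_eq_toSet]
    gcongr
    exact h.volume_le Q
  have h2 : volume Q.toSet =
      ENNReal.ofReal (1 / 2) * volume Q.toSet + ENNReal.ofReal (1 / 2) * volume Q.toSet := by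
    rw [← add_mul, ← ENNReal.ofReal_add (by norm_num) (by norm_num)]
    norm_num
  exact (ENNReal.add_le_add_iff_right
    (ENNReal.mul_ne_top ENNReal.ofReal_ne_top Q.volume_toSet_ne_top)).1 (h2.symm.le.trans h1)

/-- A core excludes the children of its cube, hence everything in later generations inside it;
within one generation the cubes themselves are disjoint. -/
theorem core_pairwiseDisjoint (h : IsStoppingRule ch) (hR : R.PairwiseDisjoint box) :
    (descendants ch R).PairwiseDisjoint (core ch) := by
  have key : ∀ {k k' : ℕ} {Q Q' : Cube d} {x : Space d}, Q ∈ generation ch R k →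
      Q' ∈ generation ch R k' → k < k' → x ∈ core ch Q → x ∈ core ch Q' → False := by
    intro k k' Q Q' x hQ hQ' hk hx hx'
    have h1 : x ∈ shadow ch R k' := Set.mem_iUnion₂.2 ⟨Q', hQ', hx'.1⟩
    obtain ⟨P, hP, hxP⟩ := h.exists_child_of_mem_shadow hR hQ hx.1 (h.shadow_antitone hk h1)
    exact hx.2 (Set.mem_iUnion₂.2 ⟨P, hP, hxP⟩)
  intro Q hQ Q' hQ' hne
  obtain ⟨k, hQ⟩ := Set.mem_iUnion.1 hQ
  obtain ⟨k', hQ'⟩ := Set.mem_iUnion.1 hQ'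
  refine Set.disjoint_left.2 fun x hx hx' => ?_
  rcases lt_trichotomy k k' with hk | rfl | hk
  · exact key hQ hQ' hk hx hx'
  · exact hne ((h.generation_pairwiseDisjoint hR k).elim_set hQ hQ' x hx.1 hx'.1)
  · exact key hQ' hQ hk hx' hx

/-- Telescoping down the finite chain of cubes containing x: each step costs q Q, and the last cube
is paid for by `hfinal`. The induction is on the number of generations left before x leaves the
shadows. -/
theorem exists_finset_le_sum (h : IsStoppingRule ch) {x : Space d} {N q : Cube d → ℝ≥0∞}
    (hfinal : ∀ Q ∈ descendants ch R, x ∈ Q.box → (∀ P ∈ ch Q, x ∉ P.box) → N Q ≤ q Q)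
    (hstep : ∀ Q ∈ descendants ch R, ∀ P ∈ ch Q, x ∈ P.box → N Q ≤ q Q + N P) (m : ℕ) :
    ∀ {k : ℕ} {Q : Cube d}, Q ∈ generation ch R k → x ∈ Q.box → x ∉ shadow ch R (k + 1 + m) →
      ∃ s : Finset (Cube d), (∀ P ∈ s, P ∈ descendants ch R ∧ x ∈ P.box ∧ P.side ≤ Q.side) ∧
        N Q ≤ ∑ P ∈ s, q P := by
  classical
  induction m with
  | zero =>
    intro k Q hQ hx hxs
    have hQ' : Q ∈ descendants ch R := Set.mem_iUnion.2 ⟨k, hQ⟩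
    refine ⟨{Q}, by simpa using ⟨hQ', hx⟩, ?_⟩
    rw [Finset.sum_singleton]
    exact hfinal Q hQ' hx fun P hP hxP =>
      hxs (Set.mem_iUnion₂.2 ⟨P, mem_generation_succ hQ hP, hxP⟩)
  | succ m ih =>
    intro k Q hQ hx hxs
    have hQ' : Q ∈ descendants ch R := Set.mem_iUnion.2 ⟨k, hQ⟩
    by_cases hc : ∀ P ∈ ch Q, x ∉ P.box
    · refine ⟨{Q}, by simpa using ⟨hQ', hx⟩, ?_⟩
      rw [Finset.sum_singleton]
      exact hfinal Q hQ' hx hc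
    · push Not at hc
      obtain ⟨P, hP, hxP⟩ := hc
      obtain ⟨s, hs, hsum⟩ := ih (mem_generation_succ hQ hP) hxP
        (by rwa [show k + 1 + 1 + m = k + 1 + (m + 1) by ring])
      have hlt := (h.inside Q P hP).2
      refine ⟨insert Q s, ?_, ?_⟩
      · intro P' hP'
        rcases Finset.mem_insert.1 hP' with rfl | hP'
        · exact ⟨hQ', hx, le_rfl⟩
        · exact ⟨(hs P' hP').1, (hs P' hP').2.1, (hs P' hP').2.2.trans hlt.le⟩
      -- Side lengths strictly decrease along the chain, so Q is a new element and no summand is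
      -- lost.
      · rw [Finset.sum_insert fun hmem => absurd (hs Q hmem).2.2 (not_le.2 hlt)]
        exact (hstep Q hQ' P hP hxP).trans (by gcongr)

theorem le_tsum_indicator (h : IsStoppingRule ch) {x : Space d} {N q : Cube d → ℝ≥0∞}
    (hfinal : ∀ Q ∈ descendants ch R, x ∈ Q.box → (∀ P ∈ ch Q, x ∉ P.box) → N Q ≤ q Q)
    (hstep : ∀ Q ∈ descendants ch R, ∀ P ∈ ch Q, x ∈ P.box → N Q ≤ q Q + N P)
    {Q : Cube d} (hQ : Q ∈ R) (hx : x ∈ Q.box) (hxs : ∃ k, x ∉ shadow ch R k) :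
    N Q ≤ ∑' P : descendants ch R, P.1.box.indicator (fun _ => q P) x := by
  classical
  obtain ⟨k, hk⟩ := hxs
  obtain ⟨s, hs, hsum⟩ := h.exists_finset_le_sum hfinal hstep k (k := 0) hQ hx
    fun hmem => hk (h.shadow_antitone (by omega) hmem)
  refine hsum.trans ?_
  have e : ∀ P ∈ s, q P =
      (descendants ch R).indicator (fun P => P.box.indicator (fun _ => q P) x) P := fun P hP => by
    rw [Set.indicator_of_mem (hs P hP).1, Set.indicator_of_mem (hs P hP).2.1]
  rw [Finset.sum_congr rfl e, tsum_subtype (descendants ch R)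
    fun P => P.box.indicator (fun _ => q P) x]
  exact ENNReal.sum_le_tsum s

theorem isSparse_triple (h : IsStoppingRule ch) (hR : R.PairwiseDisjoint box) :
    IsSparse (1 / (2 * 3 ^ d)) (triple '' descendants ch R) := by
  have htt : ∀ Q : Cube d, Q.triple.dilate (1 / 3) (by norm_num) = Q := fun Q => by
    ext
    · rfl
    · change 1 / 3 * Q.triple.side = _
      rw [triple_side]; ring
  -- Dilation by 1/3 recovers the original cube from its triple. The core holds half of that cube,
  -- hence a proportion 1/(2·3^d) of the triple.
  refine ⟨fun Q => core ch (Q.dilate (1 / 3) (by norm_num)), ?_, ?_⟩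
  · rintro _ ⟨Q, -, rfl⟩
    beta_reduce
    rw [htt]
    refine ⟨h.measurableSet_core Q,
      Set.sdiff_subset.trans (Q.box_subset_toSet.trans Q.toSet_subset_triple), ?_⟩
    refine le_trans (le_of_eq ?_) (h.volume_le_core Q)
    rw [volume_triple, ← mul_assoc, ← ENNReal.ofReal_mul (by positivity)]
    congr 2
    field_simp
  · rintro _ ⟨Q, hQ, rfl⟩ _ ⟨Q', hQ', rfl⟩ hne
    simp only [Function.onFun, htt]
    exact h.core_pairwiseDisjoint hR hQ hQ' fun e => hne (by rw [e])

end IsStoppingRule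

end Cube

end ConvexBody

end

/-! ### Assembly of the sparse domination. -/

noncomputable section

namespace ConvexBody

variable {d n : ℕ} {T : Op d} {C : ℝ≥0∞}

theorem memLp_one_of_hasCompactSupport {r : ℝ} (hr : 1 < r) {f : Space d → Space n}
    (hf : MemLp f (ENNReal.ofReal r) volume) (hc : HasCompactSupport f) : MemLp f 1 volume :=
  MemLp.mono_exponent_of_measure_support_ne_top hf (s := tsupport f)
    (fun _ hx => image_eq_zero_of_notMem_tsupport hx) hc.isCompact.measure_lt_top.ne
    (by simpa using hr.le)

theorem memLp_apply {p : ℝ≥0∞} {f : Space d → Space n} (hf : MemLp f p volume) (i : Fin n) :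
    MemLp (fun x => f x i) p volume := by
  have : MemLp (fun x => (inner ℝ (f x) (EuclideanSpace.single i (1 : ℝ)) : ℝ)) p volume :=
    hf.inner_const _
  refine this.ae_eq (Eventually.of_forall fun x => ?_)
  simp only [EuclideanSpace.inner_single_right]
  simp

theorem HasWeakType.exists_isVectorExtendedValue (hT : HasWeakType T C) {f : Space d → Space n}
    (hf : MemLp f 1 volume) : ∃ u, IsVectorExtendedValue T f u := by
  choose u hu using fun i => hT.exists_isExtendedValue (memLp_apply hf i)
  exact ⟨fun x => WithLp.toLp 2 fun i => u i x, hu⟩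

/-- When 3Q contains the support, cutting f off to 3Q returns literally the same function, so one
null set works for all of the uncountably many Q. -/
theorem HasWeakType.localValue_ae_eq (hT : HasWeakType T C) {f u : Space d → Space n}
    (hf : MemLp f 1 volume) (hu : IsVectorExtendedValue T f u) :
    ∀ᵐ x ∂volume, ∀ Q : Cube d, tsupport f ⊆ Q.triple.toSet → localValue T f Q x = u x := by
  filter_upwards [ae_all_iff.2 fun i => IsExtendedValue.ae_eq (memLp_apply hf i)
    (EventuallyEq.refl _ _) (hT.isExtendedValue_extOp (memLp_apply hf i)) (hu i)] with x hx Q hQ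
  ext i
  rw [← hx i]
  change extOp T (Q.triple.toSet.indicator fun y => f y i) x = _
  have : (Q.triple.toSet.indicator fun y => f y i) = fun y => f y i := by
    refine Set.indicator_eq_self.2 fun y hy => hQ (subset_tsupport f fun h => hy ?_)
    change f y i = 0
    rw [h]; rfl
  rw [this]

/-- The vector step supplies a stopping rule that depends on f alone. Telescoping bounds |⟨Tf, g⟩|
at almost every point by a sum over the descendants of the roots. Integrating each term and passing
to convex bodies costs A for the step, n for the coordinates and 2^n for the Auerbach basis. -/
theorem sparse_domination (hd : 0 < d) {K : Space d → Space d → ℝ}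
    (hK : IsKernel T K) {r : ℝ} (hr : 1 < r) {s : ℝ≥0∞} [s.HolderConjugate (ENNReal.ofReal r)]
    (hH : hormanderConst s K < ⊤) (hT : HasWeakType T C) (n : ℕ) :
    ∃ c : ℝ≥0, ∀ f u g : Space d → Space n, MemLp f (ENNReal.ofReal r) volume →
      HasCompactSupport f → IsVectorExtendedValue T f u → MemLp g 1 volume →
      ∃ S : Set (Cube d), IsSparse (1 / (2 * 3 ^ d)) S ∧
        ∫⁻ x, ‖(inner ℝ (u x) (g x) : ℝ)‖ₑ ≤ c * ∑' Q : S,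
          bodyProd (body (ENNReal.ofReal r) f Q.1) (body 1 g Q.1) * volume Q.1.toSet := by
  obtain ⟨A, hA⟩ := exists_vector_stopping hd hK hr hH hT n
  refine ⟨A * (n * 2 ^ n), fun f u g hf hc hu hg => ?_⟩
  have hf1 := memLp_one_of_hasCompactSupport hr hf hc
  obtain ⟨Q₀, hQ₀, -⟩ := Cube.exists_subset_box hd hc.isCompact 0
  choose ch a hdisj hins hvol ha hfinal hstep using hA f hf hf1
  have hch : Cube.IsStoppingRule ch := ⟨hdisj, hins, hvol⟩
  have hR := Q₀.roots_pairwiseDisjoint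
  set D := Cube.descendants ch Q₀.roots with hD
  have hDc : D.Countable := hch.countable_descendants hR
  set G : Cube d → Space d → ℝ≥0∞ := fun P x => A * ∑ j, ‖(inner ℝ (a P j) (g x) : ℝ)‖ₑ with hG
  have hGm : ∀ P, AEMeasurable (G P) volume := fun P =>
    (Finset.aemeasurable_fun_sum _ fun j _ => (hg.1.const_inner (𝕜 := ℝ) (c := a P j)).enorm).const_mul _
  have hpoint : ∀ᵐ x ∂volume, ‖(inner ℝ (u x) (g x) : ℝ)‖ₑ ≤
      ∑' P : D, P.1.box.indicator (G P) x := by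
    -- The almost everywhere statements of all steps hold together because there are countably many
    -- descendants, each with countably many children.
    filter_upwards [hT.localValue_ae_eq hf1 hu, hch.ae_exists_notMem_shadow hR,
      (ae_ball_iff hDc).2 fun Q _ => hfinal Q, (ae_ball_iff hDc).2 fun Q _ =>
        (ae_ball_iff (Cube.countable_of_pairwiseDisjoint (hdisj Q))).2 (hstep Q)]
      with x hx1 hx2 hx3 hx4
    obtain ⟨Q, hQ, hxQ⟩ := Q₀.exists_mem_roots x
    have h1 := hch.le_tsum_indicator (R := Q₀.roots) (x := x)
      (N := fun Q => ‖(inner ℝ (localValue T f Q x) (g x) : ℝ)‖ₑ) (q := fun P => G P x)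
      (fun Q hQ hxQ hxS => hx3 Q hQ hxQ hxS (g x))
      (fun Q hQ P hP hxP => by
        have h2 := hx4 Q hQ P hP hxP (g x)
        rw [inner_sub_left] at h2
        calc _ = ‖((inner ℝ (localValue T f Q x) (g x) : ℝ) - inner ℝ (localValue T f P x) (g x)) +
              inner ℝ (localValue T f P x) (g x)‖ₑ := by rw [sub_add_cancel]
          _ ≤ _ := (enorm_add_le _ _).trans (by gcongr))
      hQ hxQ (hx2 Q hQ hxQ)
    beta_reduce at h1
    rw [hx1 Q (hQ₀.trans (Q₀.box_subset_toSet.trans (Cube.toSet_subset_triple_of_mem_roots hQ)))]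
      at h1
    exact h1
  set F : Cube d → ℝ≥0∞ := fun Q =>
    bodyProd (body (ENNReal.ofReal r) f Q) (body 1 g Q) * volume Q.toSet with hF
  have hbound : ∀ P : Cube d, ∫⁻ x, P.box.indicator (G P) x ≤ A * (n * 2 ^ n) * F P.triple := by
    intro P
    rw [lintegral_indicator P.measurableSet_box, hG]
    beta_reduce
    rw [lintegral_const_mul' _ _ ENNReal.coe_ne_top, lintegral_finsetSum' _ fun j _ =>
      (hg.1.const_inner (𝕜 := ℝ) (c := a P j)).enorm.restrict, mul_assoc, mul_assoc]
    gcongr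
    calc ∑ j, ∫⁻ x in P.box, ‖(inner ℝ (a P j) (g x) : ℝ)‖ₑ
        ≤ ∑ _j : Fin n, ((2 ^ n : ℝ≥0) : ℝ≥0∞) * F P.triple := by
          refine Finset.sum_le_sum fun j _ => (lintegral_mono_set
            (P.box_subset_toSet.trans P.toSet_subset_triple)).trans ?_
          exact setLIntegral_inner_le_bodyProd hr hf hg P.triple (ha P j)
      _ = n * (2 ^ n * F P.triple) := by simp
  refine ⟨Cube.triple '' D, hch.isSparse_triple hR, ?_⟩
  have hinj : Set.InjOn Cube.triple D := fun P _ P' _ h => by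
    ext i
    · exact congrFun (congrArg (fun Q : Cube d => (Q.center : Fin d → ℝ)) h) i
    · have h1 : 3 * P.side = 3 * P'.side := congrArg Cube.side h
      linarith
  have := hDc.to_subtype
  calc ∫⁻ x, ‖(inner ℝ (u x) (g x) : ℝ)‖ₑ
      ≤ ∫⁻ x, ∑' P : D, P.1.box.indicator (G P) x := lintegral_mono_ae hpoint
    _ = ∑' P : D, ∫⁻ x, P.1.box.indicator (G P) x :=
        lintegral_tsum fun P => (hGm P).indicator P.1.measurableSet_box
    _ ≤ ∑' P : D, A * (n * 2 ^ n) * F P.1.triple := ENNReal.tsum_le_tsum fun P => hbound P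
    _ = A * (n * 2 ^ n) * ∑' Q : Cube.triple '' D, F Q := by
        rw [ENNReal.tsum_mul_left, tsum_image F hinj]
    _ = _ := by push_cast; rfl

end ConvexBody

end

theorem mainTheorem6 (d : ℕ) (hd : 0 < d) :
    ∃ η : ℝ, 0 < η ∧ η < 1 ∧
      ∀ (n : ℕ) (r : ℝ), 1 < r →
      ∀ T : Lp ℝ 2 (volume : Measure (ConvexBody.Space d)) →L[ℝ]
          Lp ℝ 2 (volume : Measure (ConvexBody.Space d)),
        ConvexBody.IsHormanderOperator (ENNReal.ofReal r).conjExponent T →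
        ∃ c : ℝ≥0,
          ∀ f : ConvexBody.Space d → ConvexBody.Space n,
            MemLp f (ENNReal.ofReal r) volume → HasCompactSupport f →
            (∃ u : ConvexBody.Space d → ConvexBody.Space n,
              ConvexBody.IsVectorExtendedValue T f u) ∧
            ∀ u : ConvexBody.Space d → ConvexBody.Space n,
              ConvexBody.IsVectorExtendedValue T f u →
              ∀ g : ConvexBody.Space d → ConvexBody.Space n, MemLp g 1 volume →
                ∃ S : Set (ConvexBody.Cube d), ConvexBody.IsSparse η S ∧
                  ∫⁻ x, ‖inner ℝ (u x) (g x)‖ₑ ≤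
                    c * ∑' Q : S,
                      ConvexBody.bodyProd
                        (ConvexBody.body (ENNReal.ofReal r) f Q.1)
                        (ConvexBody.body 1 g Q.1) *
                      volume Q.1.toSet := by
  refine ⟨1 / (2 * 3 ^ d), by positivity, ?_, fun n r hr T hT => ?_⟩
  · rw [div_lt_one (by positivity)]
    have : (1 : ℝ) ≤ 3 ^ d := one_le_pow₀ (by norm_num)
    linarith
  · obtain ⟨K, hKint, hKrep, hH, hH'⟩ := hT
    have hK : ConvexBody.IsKernel T K := ⟨hKint, hKrep⟩
    have : (ENNReal.ofReal r).HolderConjugate (ENNReal.ofReal r).conjExponent :=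
      ENNReal.HolderConjugate.conjExponent (by simpa using hr.le)
    have : (ENNReal.ofReal r).conjExponent.HolderConjugate (ENNReal.ofReal r) :=
      ENNReal.HolderTriple.symm
    -- The two halves of the Hörmander condition have separate roles: regularity in the second
    -- variable gives the weak type bound, and regularity in the first gives the oscillation bound
    -- used in the stopping step.
    obtain ⟨C, hC⟩ := ConvexBody.hasWeakType_of_isKernel (r := ENNReal.ofReal r) hd hK hH'
    obtain ⟨c, hc⟩ := ConvexBody.sparse_domination hd hK hr hH hC n
    exact ⟨c, fun f hf hfc =>
      ⟨hC.exists_isVectorExtendedValue (ConvexBody.memLp_one_of_hasCompactSupport hr hf hfc),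
        fun u hu g hg => hc f u g hf hfc hu hg⟩⟩
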